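/- Let $\mathfrak g$ be a finite-dimensional simple Lie algebra over $\mathbb C$, $\mathfrak h$ a Cartan subalgebra, $\alpha_1,\dots,\alpha_\ell$ a base of the root system, $\mathfrak b$ the sum of $\mathfrak h$ and the positive root spaces, and $f_i\neq 0$ a vector in the root space $\mathfrak g_{-\alpha_i}$. Let $G$ be the connected algebraic group of adjoint type with Lie algebra $\mathfrak g$ and $B\subset G$ the Borel subgroup with Lie algebra $\mathfrak b$. ($G$ is the Langlands dual ${}^LG_0$ of a simply-connected simple group $G_0$; the $\alpha_i$ are the simple coroots $\check\alpha_i$ of $G_0$.) Let $P^+$ be the set of $\lambda\in\mathfrak h$ such that $\langle\alpha_i,\lambda\rangle\in\mathbb Z_{\ge 0}$ for all $i$, i.e. the dominant integral coweights of $G$, equivalently the dominant integral weights of $G_0$. For $R=\mathbb C[[t]]$ or $\mathbb C((t))$, an element $g\in G(R)$ acts on operators $\partial_t+A(t)$, $A\in\mathfrak g\otimes R$, by the gauge transformation $g\cdot(\partial_t+A)=\partial_t+gAg^{-1}-(\partial_t g)g^{-1}$. A $G$-local system on the punctured disc $D^\times$ is a $G((t))$-gauge equivalence class of operators $\partial_t+A(t)$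 with $A(t)\in\mathfrak g((t))$; the trivial one is the class of $\partial_t$. The set $\mathrm{Op}_G(D^\times)$ of $G$-opers on $D^\times$ is the set of $B((t))$-gauge equivalence classes of operators $$\partial_t+\sum_{i=1}^{\ell}\psi_i(t)f_i+v(t),\qquad 0\neq\psi_i(t)\in\mathbb C((t)),\quad v(t)\in\mathfrak b((t)),$$ and the local system underlying an oper is the $G((t))$-gauge class of such an operator. For $\lambda\in P^+$ let $\mathrm{Op}_G^\lambda$ be the set of $B[[t]]$-gauge equivalence classes of operators $$\partial_t+\sum_{i=1}^{\ell}t^{\langle\alpha_i,\lambda\rangle}\psi_i(t)f_i+v(t),\qquad \psi_i(t)\in\mathbb C[[t]],\ \psi_i(0)\neq 0,\quad v(t)\in\mathfrak b[[t]].$$ Then the natural maps $\mathrm{Op}_G^\lambda\to\mathrm{Op}_G(D^\times)$, $\lambda\in P^+$, are injective and have pairwise disjoint images, so that $\bigsqcup_{\lambda\in P^+}\mathrm{Op}_G^\lambda$ is a subset of $\mathrm{Op}_G(D^\times)$; and if the local system underlying an oper $\chi\in\mathrm{Op}_G(D^\times)$ is trivial, then $\chi$ belongs to $\bigsqcup_{\lambda\in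 P^+}\mathrm{Op}_G^\lambda$. -/

import Mathlib

open scoped TensorProduct LaurentSeries PowerSeries

noncomputable section

namespace Oper

/-! ### The adjoint group and its points -/

section AdjointGroup

variable (𝔤 : Type*) [LieRing 𝔤] [LieAlgebra ℂ 𝔤]

/-- The adjoint group of a complex semisimple Lie algebra `𝔤`, as an abstract group: the subgroup
of `GL(𝔤)` generated by all `exp (ad x) = ∑ (ad x)ⁿ / n!` with `ad x` nilpotent. It is a Zariski closed subgroup
of `GL(𝔤)`, the group of complex points of the connected algebraic group of adjoint type with
Lie algebra `𝔤`. -/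
def adjGroup : Subgroup (𝔤 ≃ₗ[ℂ] 𝔤) :=
  Subgroup.closure {g | ∃ (x : 𝔤) (N : ℕ), LieAlgebra.ad ℂ 𝔤 x ^ N = 0 ∧
    ∀ y, g y = ∑ n ∈ Finset.range N, ((n.factorial : ℂ)⁻¹) • (LieAlgebra.ad ℂ 𝔤 x ^ n) y}

/-- Indices of the coordinates on `GL(𝔤)`: the matrix coefficients of `g` (`Sum.inl (x, φ)`)
and those of `g⁻¹` (`Sum.inr (x, φ)`), for a vector `x` and a linear form `φ`. -/
abbrev CoordIdx : Type _ := (𝔤 × Module.Dual ℂ 𝔤) ⊕ (𝔤 × Module.Dual ℂ 𝔤)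

variable {𝔤}

/-- The coordinates of a complex point of `GL(𝔤)`. -/
def coordC (g : 𝔤 ≃ₗ[ℂ] 𝔤) : CoordIdx 𝔤 → ℂ :=
  Sum.elim (fun c => c.2 (g c.1)) (fun c => c.2 (g⁻¹ c.1))

section

variable {R : Type*} [CommRing R] [Algebra ℂ R]

/-- The coordinates of an `R`-point of `GL(𝔤)`. -/
def coord (g : (R ⊗[ℂ] 𝔤) ≃ₗ[R] (R ⊗[ℂ] 𝔤)) : CoordIdx 𝔤 → R :=
  Sum.elim (fun c => Module.Dual.baseChange R c.2 (g (1 ⊗ₜ c.1))) (fun c => Module.Dual.baseChange R c.2 (g⁻¹ (1 ⊗ₜ c.1)))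

/-- `p` is a polynomial in the coordinates on `GL(𝔤)` which vanishes on the adjoint group. -/
def IsEquation (p : MvPolynomial (CoordIdx 𝔤) ℂ) : Prop :=
  ∀ a ∈ adjGroup 𝔤, MvPolynomial.aeval (coordC a) p = 0

lemma isEquation_inv {p : MvPolynomial (CoordIdx 𝔤) ℂ} (hp : IsEquation p) :
    IsEquation (MvPolynomial.rename Sum.swap p) := by
  intro a ha
  rw [MvPolynomial.aeval_rename]
  have : coordC a ∘ Sum.swap = coordC a⁻¹ := by
    funext c; rcases c with c | c <;> simp [coordC]
  rw [this]
  exact hp _ (inv_mem ha)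

/-- An equation with coefficients in `R` of the adjoint group holds on every `R`-point of the
Zariski closure. -/
lemma eval_eq_zero_of_forall (P : MvPolynomial (CoordIdx 𝔤) R)
    (hP : ∀ a ∈ adjGroup 𝔤, MvPolynomial.eval (fun c => algebraMap ℂ R (coordC a c)) P = 0)
    (y : CoordIdx 𝔤 → R)
    (hy : ∀ p : MvPolynomial (CoordIdx 𝔤) ℂ, IsEquation p → MvPolynomial.aeval y p = 0) :
    MvPolynomial.eval y P = 0 := by
  classical
  let e := Module.Free.chooseBasis ℂ R
  let S := P.support.biUnion fun m => (e.repr (P.coeff m)).support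
  let q : Module.Free.ChooseBasisIndex ℂ R → MvPolynomial (CoordIdx 𝔤) ℂ := fun k =>
    ∑ m ∈ P.support, MvPolynomial.monomial m (e.repr (P.coeff m) k)
  have key : P = ∑ k ∈ S, e k • MvPolynomial.map (algebraMap ℂ R) (q k) := by
    conv_lhs => rw [P.as_sum]
    simp only [q, map_sum, Finset.smul_sum, MvPolynomial.map_monomial]
    rw [Finset.sum_comm]
    refine Finset.sum_congr rfl fun m hm => ?_
    simp only [MvPolynomial.smul_monomial]
    rw [← map_sum]
    congr 1
    conv_lhs => rw [← e.linearCombination_repr (P.coeff m)]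
    rw [Finsupp.linearCombination_apply, Finsupp.sum]
    refine (Finset.sum_subset (s₂ := S) ?_ ?_).trans ?_
    · exact Finset.subset_biUnion_of_mem (fun m => (e.repr (P.coeff m)).support) hm
    · intro k _ hk
      simp [Finsupp.notMem_support_iff.mp hk]
    · refine Finset.sum_congr rfl fun k _ => ?_
      rw [Algebra.smul_def, smul_eq_mul, mul_comm]
  have hq : ∀ k ∈ S, IsEquation (q k) := by
    intro k hk a ha
    have h := hP a ha
    rw [key] at h
    simp only [map_sum, MvPolynomial.smul_eval, MvPolynomial.eval_map] at h
    have h2 : ∀ k, MvPolynomial.eval₂ (algebraMap ℂ R) (fun c => algebraMap ℂ R (coordC a c)) (q k)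
        = algebraMap ℂ R (MvPolynomial.aeval (coordC a) (q k)) := by
      intro k
      rw [← MvPolynomial.aeval_def]
      exact MvPolynomial.aeval_algebraMap_apply _ _ _
    simp only [h2] at h
    have h3 : ∑ k ∈ S, (MvPolynomial.aeval (coordC a) (q k)) • e k = 0 := by
      rw [← h]
      refine Finset.sum_congr rfl fun k _ => ?_
      rw [Algebra.smul_def, mul_comm]
    exact linearIndependent_iff'.mp e.linearIndependent S _ h3 k hk
  rw [key]
  simp only [map_sum, MvPolynomial.smul_eval, MvPolynomial.eval_map]
  refine Finset.sum_eq_zero fun k hk => ?_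
  rw [← MvPolynomial.aeval_def, hy _ (hq k hk), mul_zero]

end

variable (𝔤) (R : Type*) [CommRing R] [Algebra ℂ R]

variable [FiniteDimensional ℂ 𝔤]

/-- `G(R)`: the group of `R`-points of the adjoint group `G` of `𝔤`, regarded as a closed
subgroup of `GL(𝔤)`: all `R`-points of `GL(𝔤)` whose coordinates satisfy every polynomial
equation that holds on the group of complex points. -/
def adjPoints : Subgroup ((R ⊗[ℂ] 𝔤) ≃ₗ[R] (R ⊗[ℂ] 𝔤)) where
  carrier := {g | ∀ p : MvPolynomial (CoordIdx 𝔤) ℂ, IsEquation p →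
    MvPolynomial.aeval (coord g) p = 0}
  one_mem' := by
    intro p hp
    have h : coord (1 : (R ⊗[ℂ] 𝔤) ≃ₗ[R] (R ⊗[ℂ] 𝔤)) =
        fun c => algebraMap ℂ R (coordC (1 : 𝔤 ≃ₗ[ℂ] 𝔤) c) := by
      funext c
      rcases c with c | c <;> simp [coord, coordC, Algebra.smul_def]
    rw [h]
    have := MvPolynomial.aeval_algebraMap_apply R (coordC (1 : 𝔤 ≃ₗ[ℂ] 𝔤)) p
    rw [hp 1 (one_mem _), map_zero] at this
    exact this
  inv_mem' := by
    intro g hg p hp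
    have h := hg _ (isEquation_inv hp)
    rw [MvPolynomial.aeval_rename] at h
    have : coord g ∘ Sum.swap = coord g⁻¹ := by
      funext c; rcases c with c | c <;> simp [coord]
    rwa [this] at h
  mul_mem' := by
    intro g h hg hh p hp
    let e := Module.finBasis ℂ 𝔤
    -- the coordinates of `g * y` as linear forms in the coordinates of `y`
    let s : CoordIdx 𝔤 → MvPolynomial (CoordIdx 𝔤) R := Sum.elim
      (fun c => ∑ j : Fin (Module.finrank ℂ 𝔤), MvPolynomial.C (Module.Dual.baseChange R c.2 (g (1 ⊗ₜ e j))) *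
        (MvPolynomial.X (Sum.inl (c.1, e.coord j)) : MvPolynomial (CoordIdx 𝔤) R))
      (fun c => ∑ j : Fin (Module.finrank ℂ 𝔤), MvPolynomial.C (Module.Dual.baseChange R (e.coord j) (g⁻¹ (1 ⊗ₜ c.1))) *
        (MvPolynomial.X (Sum.inr (e j, c.2)) : MvPolynomial (CoordIdx 𝔤) R))
    have expand : ∀ w : R ⊗[ℂ] 𝔤,
        w = ∑ j, Module.Dual.baseChange R (e.coord j) w • ((1 : R) ⊗ₜ[ℂ] e j) := by
      intro w
      induction w using TensorProduct.induction_on with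
      | zero => simp
      | tmul r x =>
        simp only [Module.Dual.baseChange_apply_tmul, TensorProduct.smul_tmul', smul_eq_mul,
          mul_one, TensorProduct.smul_tmul]
        rw [← TensorProduct.tmul_sum]
        congr 1
        exact (e.sum_repr x).symm
      | add x y hx hy =>
        simp only [map_add, add_smul, Finset.sum_add_distrib]
        rw [← hx, ← hy]
    have hs : ∀ y : (R ⊗[ℂ] 𝔤) ≃ₗ[R] (R ⊗[ℂ] 𝔤), ∀ c,
        MvPolynomial.eval (coord y) (s c) = coord (g * y) c := by
      intro y c
      rcases c with c | c
      · simp only [s, coord, Sum.elim_inl, map_sum, map_mul, MvPolynomial.eval_C,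
          MvPolynomial.eval_X, LinearEquiv.mul_apply]
        conv_rhs => rw [expand (y (1 ⊗ₜ c.1))]
        simp [mul_comm]
      · simp only [s, coord, Sum.elim_inr, map_sum, map_mul, MvPolynomial.eval_C,
          MvPolynomial.eval_X, LinearEquiv.mul_apply, mul_inv_rev]
        conv_rhs => rw [expand (g⁻¹ (1 ⊗ₜ c.1))]
        simp
    let P : MvPolynomial (CoordIdx 𝔤) R := MvPolynomial.aeval s p
    have hP : ∀ y : CoordIdx 𝔤 → R, MvPolynomial.eval y P =
        MvPolynomial.aeval (fun c => MvPolynomial.eval y (s c)) p := by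
      intro y
      have := MvPolynomial.comp_aeval_apply s
        ((MvPolynomial.aeval y : MvPolynomial (CoordIdx 𝔤) R →ₐ[R] R).restrictScalars ℂ) p
      simpa [P, MvPolynomial.aeval_eq_eval] using this
    have main := eval_eq_zero_of_forall P ?_ (coord h) hh
    · rw [hP] at main
      simpa only [hs] using main
    · intro a ha
      have h2 : (a.baseChange ℂ R 𝔤 𝔤)⁻¹ = (a⁻¹).baseChange ℂ R 𝔤 𝔤 := by
        rw [inv_eq_iff_mul_eq_one]
        ext x
        induction x using TensorProduct.induction_on with
        | zero => simp
        | tmul r x => simp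
        | add x y hx hy => rw [map_add, hx, hy, map_add]
      have ext_a : (fun c => algebraMap ℂ R (coordC a c)) = coord (a.baseChange ℂ R 𝔤 𝔤) := by
        funext c
        rcases c with c | c <;> simp [coord, coordC, Algebra.smul_def, h2]
      rw [ext_a, hP]
      simp only [hs]
      let τ : CoordIdx 𝔤 → CoordIdx 𝔤 := Sum.map (fun c => (a c.1, c.2))
        (fun c => (c.1, c.2 ∘ₗ (a⁻¹ : 𝔤 ≃ₗ[ℂ] 𝔤).toLinearMap))
      have hτ : ∀ c, coord (g * a.baseChange ℂ R 𝔤 𝔤) c = coord g (τ c) := by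
        intro c
        rcases c with c | c
        · simp [coord, τ]
        · simp only [coord, τ, Sum.elim_inr, Sum.map_inr, mul_inv_rev, LinearEquiv.mul_apply, h2]
          generalize g⁻¹ (1 ⊗ₜ[ℂ] c.1) = w
          induction w using TensorProduct.induction_on with
          | zero => simp
          | tmul r x => simp
          | add x y hx hy => simp only [map_add, hx, hy]
      simp only [hτ]
      have hren : IsEquation (MvPolynomial.rename τ p) := by
        intro b hb
        rw [MvPolynomial.aeval_rename]
        have : coordC b ∘ τ = coordC (b * a) := by
          funext c; rcases c with c | c <;> simp [coordC, τ]
        rw [this]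
        exact hp _ (mul_mem hb ha)
      have := hg _ hren
      rw [MvPolynomial.aeval_rename] at this
      exact this

end AdjointGroup

/-! ### Extension of scalars for points -/

section ExtendScalars

variable {𝔤 : Type*} [LieRing 𝔤] [LieAlgebra ℂ 𝔤]
variable {R S : Type*} [CommRing R] [Algebra ℂ R] [CommRing S] [Algebra ℂ S] (j : R →ₐ[ℂ] S)

/-- The map `R ⊗ 𝔤 → S ⊗ 𝔤` induced by a homomorphism `j : R → S`. -/
abbrev extVec : R ⊗[ℂ] 𝔤 →ₗ[ℂ] S ⊗[ℂ] 𝔤 := LinearMap.rTensor 𝔤 j.toLinearMap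

/-- The `S`-linear extension of an `R`-linear endomorphism of `R ⊗ 𝔤`. -/
def extEnd (g : Module.End R (R ⊗[ℂ] 𝔤)) : Module.End S (S ⊗[ℂ] 𝔤) :=
  LinearMap.liftBaseChange S
    (extVec j ∘ₗ g.restrictScalars ℂ ∘ₗ TensorProduct.mk ℂ R 𝔤 1)

lemma extEnd_tmul (g : Module.End R (R ⊗[ℂ] 𝔤)) (s : S) (x : 𝔤) :
    extEnd j g (s ⊗ₜ x) = s • extVec j (g (1 ⊗ₜ x)) := rfl

lemma extVec_smul (r : R) (w : R ⊗[ℂ] 𝔤) : extVec j (r • w) = j r • extVec j w := by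
  induction w using TensorProduct.induction_on with
  | zero => simp
  | tmul r x => simp [TensorProduct.smul_tmul']
  | add x y hx hy => simp only [smul_add, map_add, hx, hy]

lemma extEnd_extVec (g : Module.End R (R ⊗[ℂ] 𝔤)) (w : R ⊗[ℂ] 𝔤) :
    extEnd j g (extVec j w) = extVec j (g w) := by
  induction w using TensorProduct.induction_on with
  | zero => simp
  | tmul r x =>
    have : r ⊗ₜ[ℂ] x = r • ((1 : R) ⊗ₜ[ℂ] x) := by simp [TensorProduct.smul_tmul']
    rw [LinearMap.rTensor_tmul, extEnd_tmul, this, map_smul, extVec_smul]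
    rfl
  | add x y hx hy => simp only [map_add, hx, hy]

lemma extEnd_mul (g h : Module.End R (R ⊗[ℂ] 𝔤)) :
    extEnd j (g * h) = extEnd j g * extEnd j h := by
  refine LinearMap.ext fun w => ?_
  induction w using TensorProduct.induction_on with
  | zero => simp
  | tmul s x =>
    rw [Module.End.mul_apply, extEnd_tmul, extEnd_tmul, map_smul, extEnd_extVec]
    rfl
  | add x y hx hy => simp only [map_add, hx, hy]

lemma extEnd_one : extEnd j (1 : Module.End R (R ⊗[ℂ] 𝔤)) = 1 := by
  refine LinearMap.ext fun w => ?_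
  induction w using TensorProduct.induction_on with
  | zero => simp
  | tmul s x => simp [extEnd_tmul, TensorProduct.smul_tmul']
  | add x y hx hy => simp only [map_add, hx, hy]

/-- The `S`-point of `GL(𝔤)` defined by an `R`-point and a homomorphism `j : R → S`. -/
def extGL (g : (R ⊗[ℂ] 𝔤) ≃ₗ[R] (R ⊗[ℂ] 𝔤)) : (S ⊗[ℂ] 𝔤) ≃ₗ[S] (S ⊗[ℂ] 𝔤) :=
  LinearEquiv.ofLinearMap (extEnd j g.toLinearMap) (extEnd j (g⁻¹).toLinearMap)
    (by
      change extEnd j g.toLinearMap * extEnd j (g⁻¹).toLinearMap = 1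
      rw [← extEnd_mul, ← extEnd_one j]
      congr 1
      ext x; simp)
    (by
      change extEnd j (g⁻¹).toLinearMap * extEnd j g.toLinearMap = 1
      rw [← extEnd_mul, ← extEnd_one j]
      congr 1
      ext x; simp)

lemma extGL_tmul (g : (R ⊗[ℂ] 𝔤) ≃ₗ[R] (R ⊗[ℂ] 𝔤)) (s : S) (x : 𝔤) :
    extGL j g (s ⊗ₜ x) = s • extVec j (g (1 ⊗ₜ x)) := rfl

lemma extGL_extVec (g : (R ⊗[ℂ] 𝔤) ≃ₗ[R] (R ⊗[ℂ] 𝔤)) (w : R ⊗[ℂ] 𝔤) :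
    extGL j g (extVec j w) = extVec j (g w) := extEnd_extVec j g.toLinearMap w

lemma extVec_mem_baseChange (V : Submodule ℂ 𝔤) {w : R ⊗[ℂ] 𝔤} (hw : w ∈ V.baseChange R) :
    extVec j w ∈ V.baseChange S := by
  rw [Submodule.baseChange_eq_span] at hw
  induction hw using Submodule.span_induction with
  | mem w hw =>
    obtain ⟨x, hx, rfl⟩ := hw
    simpa using Submodule.tmul_mem_baseChange_of_mem (1 : S) hx
  | zero => simp
  | add v w _ _ hv hw => rw [map_add]; exact add_mem hv hw
  | smul r w _ hw => rw [extVec_smul]; exact Submodule.smul_mem _ _ hw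

lemma extGL_inv (g : (R ⊗[ℂ] 𝔤) ≃ₗ[R] (R ⊗[ℂ] 𝔤)) : (extGL j g)⁻¹ = extGL j g⁻¹ := by
  ext w
  rfl

lemma coord_extGL (g : (R ⊗[ℂ] 𝔤) ≃ₗ[R] (R ⊗[ℂ] 𝔤)) (c : CoordIdx 𝔤) :
    coord (extGL j g) c = j (coord g c) := by
  have h : ∀ (φ : Module.Dual ℂ 𝔤) (w : R ⊗[ℂ] 𝔤),
      Module.Dual.baseChange S φ (extVec j w) = j (Module.Dual.baseChange R φ w) := by
    intro φ w
    induction w using TensorProduct.induction_on with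
    | zero => simp
    | tmul r x => simp
    | add x y hx hy => simp only [map_add, hx, hy]
  rcases c with c | c
  · simp only [coord, Sum.elim_inl, extGL_tmul, one_smul, h]
  · simp only [coord, Sum.elim_inr, extGL_inv, extGL_tmul, one_smul, h]

lemma extGL_mem_adjPoints [FiniteDimensional ℂ 𝔤] {g : (R ⊗[ℂ] 𝔤) ≃ₗ[R] (R ⊗[ℂ] 𝔤)}
    (hg : g ∈ adjPoints 𝔤 R) : extGL j g ∈ adjPoints 𝔤 S := by
  intro p hp
  have h : coord (extGL j g) = fun c => j (coord g c) := funext (coord_extGL j g)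
  have h2 := MvPolynomial.comp_aeval_apply (coord g) j p
  rw [hg p hp, map_zero] at h2
  rw [h]
  exact h2.symm

end ExtendScalars

/-! ### Connections and gauge transformations -/

section Gauge

variable {𝔤 : Type*} [LieRing 𝔤] [LieAlgebra ℂ 𝔤]
variable {R : Type*} [CommRing R] [Algebra ℂ R] (d : R →ₗ[ℂ] R)

/-- Gauge transformations. An element `A` of `R ⊗ 𝔤` stands for the connection operator `d + A`,
where `d` is the derivation of `R`. The predicate says that the gauge transformation by `g` takes
`d + A` to `d + A'`, namely `g ∘ (d + ad A) ∘ g⁻¹ = d + ad A'` as operators on `R ⊗ 𝔤`; as `𝔤` has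
trivial centre, this is the formula `A' = g A g⁻¹ - (d g) g⁻¹`. -/
def IsGauge (g : (R ⊗[ℂ] 𝔤) ≃ₗ[R] (R ⊗[ℂ] 𝔤)) (A A' : R ⊗[ℂ] 𝔤) : Prop :=
  ∀ x : R ⊗[ℂ] 𝔤,
    g (LinearMap.rTensor 𝔤 d x + ⁅A, x⁆) = LinearMap.rTensor 𝔤 d (g x) + ⁅A', g x⁆

/-- Gauge equivalence of connections under a group `Γ` of `R`-points. -/
def gaugeSetoid (Γ : Subgroup ((R ⊗[ℂ] 𝔤) ≃ₗ[R] (R ⊗[ℂ] 𝔤))) : Setoid (R ⊗[ℂ] 𝔤) where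
  r A A' := ∃ g ∈ Γ, IsGauge d g A A'
  iseqv :=
    { refl := fun A => ⟨1, one_mem _, fun x => by simp⟩
      symm := by
        rintro A A' ⟨g, hg, h⟩
        refine ⟨g⁻¹, inv_mem hg, fun x => ?_⟩
        have hx := h (g⁻¹ x)
        have hgx : ∀ y, g (g⁻¹ y) = y := fun y => g.apply_symm_apply y
        rw [hgx] at hx
        rw [← hx]
        exact g.symm_apply_apply _
      trans := by
        rintro A A' A'' ⟨g, hg, h⟩ ⟨g', hg', h'⟩
        refine ⟨g' * g, mul_mem hg' hg, fun x => ?_⟩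
        rw [LinearEquiv.mul_apply, h x, h' (g x)]
        rfl }

end Gauge

/-! ### The derivation of Laurent series -/

/-- The coefficientwise `ℂ`-algebra structure of `ℂ((t))`; it is given priority over the
(propositionally equal) one that is obtained through `ℂ[[t]]`. -/
instance (priority := 10000) algebraLaurent : Algebra ℂ ℂ⸨X⸩ := HahnSeries.instAlgebra

/-- The inclusion `ℂ[[t]] → ℂ((t))`. -/
abbrev toLaurent : ℂ⟦X⟧ →ₐ[ℂ] ℂ⸨X⸩ := HahnSeries.ofPowerSeriesAlg (R := ℂ) (A := ℂ) ℤ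

/-- The derivation `∂_t` of `ℂ((t))`. -/
abbrev dLaurent : ℂ⸨X⸩ →ₗ[ℂ] ℂ⸨X⸩ := LaurentSeries.derivative ℂ

/-- The derivation `∂_t` of `ℂ[[t]]`. -/
abbrev dPower : ℂ⟦X⟧ →ₗ[ℂ] ℂ⟦X⟧ := (PowerSeries.derivative ℂ).toLinearMap

lemma toLaurent_apply (p : ℂ⟦X⟧) : toLaurent p = HahnSeries.ofPowerSeries ℤ ℂ p := rfl

lemma dLaurent_coeff (a : ℂ⸨X⸩) (n : ℤ) :
    (dLaurent a).coeff n = ((n : ℂ) + 1) * a.coeff (n + 1) := by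
  simp [LaurentSeries.hasseDeriv_coeff]

lemma dLaurent_toLaurent (p : ℂ⟦X⟧) : dLaurent (toLaurent p) = toLaurent (dPower p) := by
  ext n
  rw [dLaurent_coeff, toLaurent_apply, toLaurent_apply]
  rcases lt_trichotomy n (-1) with hn | rfl | hn
  · rw [PowerSeries.coeff_coe, PowerSeries.coeff_coe, if_pos (by omega), if_pos (by omega),
      mul_zero]
  · rw [PowerSeries.coeff_coe (i := -1), if_pos (by omega)]
    simp
  · obtain ⟨m, rfl⟩ : ∃ m : ℕ, n = m := ⟨n.toNat, by omega⟩
    rw [show ((m : ℤ) + 1) = ((m + 1 : ℕ) : ℤ) by simp, LaurentSeries.coeff_coe_powerSeries,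
      LaurentSeries.coeff_coe_powerSeries]
    simp [PowerSeries.coeff_derivative, mul_comm]

lemma coeff_single_mul_dLaurent (a : ℂ⸨X⸩) (n : ℤ) :
    (HahnSeries.single 1 1 * dLaurent a).coeff n = (n : ℂ) * a.coeff n := by
  rw [HahnSeries.coeff_single_mul, dLaurent_coeff]
  simp

lemma dLaurent_mul (a b : ℂ⸨X⸩) : dLaurent (a * b) = a * dLaurent b + dLaurent a * b := by
  have ht : (HahnSeries.single (1 : ℤ) (1 : ℂ)) ≠ 0 := by simp
  refine mul_left_cancel₀ ht ?_
  have e1 : HahnSeries.single (1 : ℤ) (1 : ℂ) * (a * dLaurent b + dLaurent a * b) =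
      a * (HahnSeries.single 1 1 * dLaurent b) + (HahnSeries.single 1 1 * dLaurent a) * b := by
    ring
  rw [e1]
  ext n
  have sb : (HahnSeries.single (1 : ℤ) (1 : ℂ) * dLaurent b).support ⊆ b.support := by
    intro m hm
    rw [HahnSeries.mem_support, coeff_single_mul_dLaurent] at hm
    exact right_ne_zero_of_mul hm
  have sa : (HahnSeries.single (1 : ℤ) (1 : ℂ) * dLaurent a).support ⊆ a.support := by
    intro m hm
    rw [HahnSeries.mem_support, coeff_single_mul_dLaurent] at hm
    exact right_ne_zero_of_mul hm
  rw [coeff_single_mul_dLaurent, HahnSeries.coeff_add, HahnSeries.coeff_mul,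
    HahnSeries.coeff_mul_right' b.isPWO_support sb, HahnSeries.coeff_mul_left' a.isPWO_support sa,
    Finset.mul_sum, ← Finset.sum_add_distrib]
  refine Finset.sum_congr rfl fun ij hij => ?_
  rw [coeff_single_mul_dLaurent, coeff_single_mul_dLaurent]
  have : ij.1 + ij.2 = n := (Finset.mem_antidiagonal.mp hij).2.2
  rw [← this]
  push_cast
  ring

/-- The `ℂ[[t]]`-gauge transformations are gauge transformations over `ℂ((t))`. -/
lemma isGauge_extGL {𝔤 : Type*} [LieRing 𝔤] [LieAlgebra ℂ 𝔤]
    {g : (ℂ⟦X⟧ ⊗[ℂ] 𝔤) ≃ₗ[ℂ⟦X⟧] (ℂ⟦X⟧ ⊗[ℂ] 𝔤)} {A A' : ℂ⟦X⟧ ⊗[ℂ] 𝔤}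
    (h : IsGauge dPower g A A') :
    IsGauge dLaurent (extGL toLaurent g) (extVec toLaurent A) (extVec toLaurent A') := by
  have hd : ∀ w : ℂ⟦X⟧ ⊗[ℂ] 𝔤, LinearMap.rTensor 𝔤 dLaurent (extVec toLaurent w) =
      extVec toLaurent (LinearMap.rTensor 𝔤 dPower w) := by
    intro w
    rw [← LinearMap.rTensor_comp_apply, ← LinearMap.rTensor_comp_apply]
    congr 2
    exact LinearMap.ext dLaurent_toLaurent
  have hl : ∀ v w : ℂ⟦X⟧ ⊗[ℂ] 𝔤, ⁅extVec toLaurent v, extVec toLaurent w⁆ =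
      extVec toLaurent ⁅v, w⁆ := fun v w =>
    (LieHom.map_lie (LieAlgebra.ExtendScalars.map toLaurent (LieHom.id : 𝔤 →ₗ⁅ℂ⁆ 𝔤)) v w).symm
  have hls : ∀ (s : ℂ⸨X⸩) (v w : ℂ⸨X⸩ ⊗[ℂ] 𝔤), ⁅v, s • w⁆ = s • ⁅v, w⁆ := fun s v w =>
    lie_smul s v w
  have hs : ∀ (s : ℂ⸨X⸩) (w : ℂ⸨X⸩ ⊗[ℂ] 𝔤), LinearMap.rTensor 𝔤 dLaurent (s • w) =
      s • LinearMap.rTensor 𝔤 dLaurent w + dLaurent s • w := by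
    intro s w
    induction w using TensorProduct.induction_on with
    | zero => simp
    | tmul r x =>
      simp only [TensorProduct.smul_tmul', smul_eq_mul, LinearMap.rTensor_tmul, dLaurent_mul,
        TensorProduct.add_tmul]
    | add x y hx hy =>
      simp only [smul_add, map_add, hx, hy]
      abel
  intro x
  induction x using TensorProduct.induction_on with
  | zero => simp
  | tmul s x =>
    have e : s ⊗ₜ[ℂ] x = s • extVec toLaurent (1 ⊗ₜ[ℂ] x) := by
      simp [TensorProduct.smul_tmul']
    rw [e, hs, hd, hls, hl, map_smul, hs, hls, extGL_extVec, hd, hl, map_add, map_add,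
      map_smul, map_smul, map_smul, extGL_extVec, extGL_extVec, extGL_extVec]
    have hx := congrArg (extVec toLaurent) (h (1 ⊗ₜ x))
    simp only [map_add] at hx
    rw [add_right_comm, ← smul_add, hx, smul_add, add_right_comm]
  | add x y hx hy =>
    simp only [map_add, lie_add] at hx hy ⊢
    calc _ = _ := add_add_add_comm _ _ _ _
      _ = _ := by rw [hx, hy]
      _ = _ := add_add_add_comm _ _ _ _

/-! ### Opers on the punctured disc -/

section Opers

variable {𝔤 : Type*} [LieRing 𝔤] [LieAlgebra ℂ 𝔤] [FiniteDimensional ℂ 𝔤]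
  [LieAlgebra.IsSimple ℂ 𝔤] {H : LieSubalgebra ℂ 𝔤} [H.IsCartanSubalgebra]
  (b : (LieAlgebra.IsKilling.rootSystem H).Base)

/-- The Borel subalgebra `𝔟` which is the sum of the Cartan subalgebra and the root spaces of
the positive roots. -/
def borel : Submodule ℂ 𝔤 :=
  H.toSubmodule ⊔ ⨆ (α : H.root) (_ : b.IsPos α),
    (LieAlgebra.rootSpace H (α : LieModule.Weight ℂ H 𝔤)).toSubmodule

/-- `B(R)`: the group of `R`-points of the Borel subgroup `B` with Lie algebra `𝔟`, which is the
stabilizer of `𝔟` in the adjoint group `G`. -/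
def borelPoints (R : Type*) [CommRing R] [Algebra ℂ R] :
    Subgroup ((R ⊗[ℂ] 𝔤) ≃ₗ[R] (R ⊗[ℂ] 𝔤)) :=
  adjPoints 𝔤 R ⊓
  { carrier := {g | ((borel b).baseChange R).map g.toLinearMap = (borel b).baseChange R}
    one_mem' := Submodule.map_id _
    mul_mem' := by
      intro g h hg hh
      rw [Set.mem_ofPred_eq] at hg hh ⊢
      conv_rhs => rw [← hg, ← hh]
      exact Submodule.map_comp _ _ _
    inv_mem' := by
      intro g hg
      rw [Set.mem_ofPred_eq] at hg ⊢
      conv_lhs => rw [← hg]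
      rw [← Submodule.map_comp]
      convert! Submodule.map_id _
      ext x; simp }

lemma extGL_mem_borelPoints {R S : Type*} [CommRing R] [Algebra ℂ R] [CommRing S] [Algebra ℂ S]
    (j : R →ₐ[ℂ] S) {g : (R ⊗[ℂ] 𝔤) ≃ₗ[R] (R ⊗[ℂ] 𝔤)} (hg : g ∈ borelPoints b R) :
    extGL j g ∈ borelPoints b S := by
  have key : ∀ g ∈ borelPoints b R,
      ((borel b).baseChange S).map (extGL j g).toLinearMap ≤ (borel b).baseChange S := by
    intro g hg
    rw [Submodule.map_le_iff_le_comap]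
    conv_lhs => rw [Submodule.baseChange_eq_span]
    rw [Submodule.span_le]
    rintro _ ⟨x, hx, rfl⟩
    have h1 : g (1 ⊗ₜ x) ∈ (borel b).baseChange R := by
      have h2 := hg.2
      change ((borel b).baseChange R).map g.toLinearMap = (borel b).baseChange R at h2
      rw [← h2]
      exact Submodule.mem_map_of_mem (Submodule.tmul_mem_baseChange_of_mem (1 : R) hx)
    change extGL j g (1 ⊗ₜ x) ∈ (borel b).baseChange S
    rw [extGL_tmul, one_smul]
    exact extVec_mem_baseChange j _ h1
  refine ⟨extGL_mem_adjPoints j hg.1, le_antisymm (key g hg) ?_⟩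
  intro w hw
  refine ⟨(extGL j g)⁻¹ w, ?_, (extGL j g).apply_symm_apply w⟩
  rw [extGL_inv]
  exact key _ (inv_mem hg) (Submodule.mem_map_of_mem hw)

variable (f : b.support → 𝔤)

variable (𝔤) in
/-- The set of `G`-local systems on the punctured disc: connections `∂_t + A(t)`,
`A ∈ 𝔤((t))`, up to gauge transformations from `G((t))`. -/
def Loc : Type _ := Quotient (gaugeSetoid dLaurent (adjPoints 𝔤 ℂ⸨X⸩))

variable (𝔤) in
/-- The trivial local system, the class of `∂_t`. -/
def Loc.trivial : Loc 𝔤 := Quotient.mk _ 0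

/-- `∂_t + A` has the form `∂_t + ∑ ψ_i(t) f_i + v(t)` with nowhere vanishing (that is, non-zero)
functions `ψ_i ∈ ℂ((t))` on the punctured disc and `v ∈ 𝔟((t))`. -/
def IsOper (A : ℂ⸨X⸩ ⊗[ℂ] 𝔤) : Prop :=
  ∃ ψ : b.support → ℂ⸨X⸩, (∀ i, ψ i ≠ 0) ∧ ∃ v ∈ (borel b).baseChange ℂ⸨X⸩,
    A = ∑ i, ψ i ⊗ₜ[ℂ] f i + v

/-- The set of `G`-opers on the punctured disc: operators of the above form up to gauge
transformations from `B((t))`. -/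
def Op : Type _ :=
  Quotient ((gaugeSetoid dLaurent (borelPoints b ℂ⸨X⸩)).comap
    (Subtype.val : {A : ℂ⸨X⸩ ⊗[ℂ] 𝔤 // IsOper b f A} → ℂ⸨X⸩ ⊗[ℂ] 𝔤))

/-- The local system underlying an oper. -/
def Op.toLoc : Op b f → Loc 𝔤 :=
  Quotient.map Subtype.val (by rintro A A' ⟨g, hg, h⟩; exact ⟨g, hg.1, h⟩)

/-- The dominant integral coweights of `G`, that is, the dominant integral weights of the
simply-connected group whose Langlands dual group is the adjoint group `G`: elements `λ` of the
Cartan subalgebra such that `⟨α_i, λ⟩` is a non-negative integer for all simple roots `α_i`. -/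
def DominantCoweight : Type _ :=
  {lam : H // ∀ i : b.support, ∃ n : ℕ, (i.1 : LieModule.Weight ℂ H 𝔤) lam = n}

variable {b}

/-- The non-negative integer `⟨α_i, λ⟩`. -/
def DominantCoweight.pairing (lam : DominantCoweight b) (i : b.support) : ℕ := (lam.2 i).choose

lemma DominantCoweight.pairing_spec (lam : DominantCoweight b) (i : b.support) :
    (i.1 : LieModule.Weight ℂ H 𝔤) lam.1 = lam.pairing i := (lam.2 i).choose_spec

/-- `∂_t + A` has the form `∂_t + ∑ t ^ ⟨α_i, λ⟩ ψ_i(t) f_i + v(t)` with `ψ_i ∈ ℂ[[t]]`,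
`ψ_i(0) ≠ 0` and `v ∈ 𝔟[[t]]`. -/
def IsOperOfWeight (lam : DominantCoweight b) (A : ℂ⟦X⟧ ⊗[ℂ] 𝔤) : Prop :=
  ∃ ψ : b.support → ℂ⟦X⟧, (∀ i, PowerSeries.constantCoeff (ψ i) ≠ 0) ∧
    ∃ v ∈ (borel b).baseChange ℂ⟦X⟧,
      A = ∑ i, (PowerSeries.X ^ lam.pairing i * ψ i) ⊗ₜ[ℂ] f i + v

/-- The set `Op^λ` of `B[[t]]`-gauge equivalence classes of operators of the above form. -/
def OpOfWeight (lam : DominantCoweight b) : Type _ :=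
  Quotient ((gaugeSetoid dPower (borelPoints b ℂ⟦X⟧)).comap
    (Subtype.val : {A : ℂ⟦X⟧ ⊗[ℂ] 𝔤 // IsOperOfWeight f lam A} → ℂ⟦X⟧ ⊗[ℂ] 𝔤))

variable {f}

lemma IsOperOfWeight.isOper {lam : DominantCoweight b} {A : ℂ⟦X⟧ ⊗[ℂ] 𝔤}
    (h : IsOperOfWeight f lam A) : IsOper b f (extVec toLaurent A) := by
  obtain ⟨ψ, hψ, v, hv, rfl⟩ := h
  refine ⟨fun i => toLaurent (PowerSeries.X ^ lam.pairing i * ψ i), fun i => ?_,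
    extVec toLaurent v, extVec_mem_baseChange toLaurent _ hv, ?_⟩
  · change toLaurent (PowerSeries.X ^ lam.pairing i * ψ i) ≠ 0
    rw [toLaurent_apply, Ne, map_eq_zero_iff _ HahnSeries.ofPowerSeries_injective]
    refine mul_ne_zero (pow_ne_zero _ PowerSeries.X_ne_zero) fun h0 => hψ i ?_
    rw [h0, map_zero]
  · rw [map_add, map_sum]
    rfl

/-- The natural map from `Op^λ` to the set of opers on the punctured disc. -/
def OpOfWeight.toOp {lam : DominantCoweight b} : OpOfWeight f lam → Op b f :=
  Quotient.map (fun A => ⟨extVec toLaurent A.1, A.2.isOper⟩) (by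
    rintro A A' ⟨g, hg, h⟩
    exact ⟨extGL toLaurent g, extGL_mem_borelPoints b toLaurent hg, isGauge_extGL h⟩)

end Opers

end Oper

end

/-!
The adjoint group `G` is given by the polynomial equations of the group generated by the
exponentials `exp (ad x)`, so everything about `G(R)` is deduced from equations that hold on that
group. The Lie algebra enters through a `RootFrame`: a basis of fundamental coweights `ω i` and root
vectors `e α`, graded by a generic height which takes distinct non-zero values on the roots. The
Borel subalgebra is the part of non-negative height, the opposite nilradical `𝔫⁻` the part of
negative height, and `∂_t + A` is an oper with symbol `(ψ i)` if `A` is congruent to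
`∑ ψ i • e (-α i)` modulo the Borel subalgebra (`HasSymbol`).

*Symbols.* A point of `G` that preserves the Borel subalgebra acts trivially on its quotient by the
nilradical (`map_cartan_sub_mem`). To see this for points with values in an arbitrary `ℂ`-algebra, one
needs an equation on `G`: on the big cell, an element of `G` induces an automorphism of the Cartan
subalgebra that preserves eigenvalues of `ad`, so it has finitely many possible values, and as
elements of `G` lie on polynomial curves through `1`, it is the identity (`cellNum_eq`). Evaluating a
gauge transformation from `B` on `ω i`, one finds that it multiplies the `i`-th component of the
symbol by a function, and so does its inverse (`HasSymbol.dvd`).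

*Injectivity and disjointness.* The matrix coefficients of a gauge transformation between two
connections without poles satisfy a linear differential equation without poles, hence have no poles
(`exists_extGL_eq_of_isGauge`). Two elements of the `Op^λ` with the same image in the opers on the
punctured disc are therefore already equivalent under `B[[t]]`, and then the orders of vanishing of
their symbols, which are the numbers `⟨α i, λ⟩`, agree.

*Trivial local systems.* If `g ∈ G((t))` takes an oper to the trivial connection, write `g⁻¹ = b⁻¹ k`
with `b ∈ B((t))` and `k ∈ G[[t]]` by the Iwasawa decomposition (`exists_conjBorel_eq`). Then `b` takes
the oper to the transform of the trivial connection by `k`, which has no poles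
(`exists_isGauge_zero`), and it has a symbol with non-zero components since `b` preserves oper forms
(`exists_isGauge_of_trivial`). Their orders of vanishing define `λ`.

The Iwasawa decomposition says that each conjugate of `𝔟((t))` is conjugate to it under `G[[t]]`. The
reduction modulo `t` of the integral part of the conjugate is a subalgebra of the dimension of `𝔟`
whose commutators are isotropic for the Killing form. By an analysis of leading terms and by simple
reflections, it can be moved to a position in which it meets `𝔫⁻` trivially
(`IsBorelLike.exists_map_disjoint`). Then the conjugate contains an integral element congruent to the
grading element modulo `𝔫⁻`, which is conjugate to the grading element under the opposite unipotent
group (`exists_conj_grading`), and a subalgebra that contains the grading element is a sum of weight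
spaces.
-/

noncomputable section

namespace Oper

/-! ### Root frames and the weight filtrations of `R ⊗ 𝔤` -/

/-- The part of the structure of a split semisimple Lie algebra that the argument uses. Here `S`
indexes the simple roots and `Φ` the roots. The basis consists of the fundamental coweights
`ω i` (`Sum.inl i`) and of root vectors `e α` (`Sum.inr α`); a root `α` is encoded by the
numbers `wt α i = α (ω i)`. The generic height `deg` is the pairing of a root with the coweight
`∑ ht i • ω i`, chosen in such a way that distinct roots have distinct non-zero heights; the
positive roots are those of positive height. -/
structure RootFrame (𝔤 : Type*) [LieRing 𝔤] [LieAlgebra ℂ 𝔤] (S Φ : Type*) [Fintype S]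
    [Fintype Φ] where
  /-- Fundamental coweights and root vectors. -/
  basis : Module.Basis (S ⊕ Φ) ℂ 𝔤
  /-- The value of a root on the fundamental coweights. -/
  wt : Φ → S → ℂ
  /-- The generic height of a root. -/
  deg : Φ → ℤ
  /-- The coefficients of the coweight that defines the generic height. -/
  ht : S → ℤ
  /-- The negative of a root. -/
  neg : Φ → Φ
  /-- The simple roots. -/
  simple : S → Φ
  /-- The simple reflections. -/
  refl : S → Φ → Φ
  /-- The coordinates of the simple coroots in the basis of fundamental coweights. -/
  cor : S → S → ℂ
  lie_cartan : ∀ i k, ⁅basis (Sum.inl i), basis k⁆ =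
    Sum.elim (fun _ => (0 : S → ℂ)) wt k i • basis k
  wt_add : ∀ j k l, basis.repr ⁅basis j, basis k⁆ l ≠ 0 →
    Sum.elim (fun _ => (0 : S → ℂ)) wt l =
      Sum.elim (fun _ => (0 : S → ℂ)) wt j + Sum.elim (fun _ => (0 : S → ℂ)) wt k
  deg_eq : ∀ α, (deg α : ℂ) = ∑ i, (ht i : ℂ) * wt α i
  deg_injective : Function.Injective deg
  deg_ne_zero : ∀ α, deg α ≠ 0
  wt_neg : ∀ α, wt (neg α) = -wt α
  wt_simple_self : ∀ i, wt (simple i) i = 1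
  wt_simple_of_ne : ∀ i j, j ≠ i → wt (simple i) j = 0
  deg_simple_pos : ∀ i, 0 < deg (simple i)
  killing_ne_zero : ∀ α, killingForm ℂ 𝔤 ⁅basis (Sum.inr α), basis (Sum.inr (neg α))⁆
    ⁅basis (Sum.inr α), basis (Sum.inr (neg α))⁆ ≠ 0
  exists_lie_simple_ne_zero : ∀ β, 0 < deg β →
    ∃ i, ⁅basis (Sum.inr (simple i)), basis (Sum.inr (neg β))⁆ ≠ 0
  wt_refl : ∀ i β, wt (refl i β) = wt β - (∑ k, cor i k * wt β k) • wt (simple i)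
  deg_refl_pos : ∀ i β, 0 < deg β → β ≠ simple i → 0 < deg (refl i β)
  deg_sub_simple_pos : ∀ i β γ, 0 < deg β → wt γ = wt β - wt (simple i) → 0 < deg γ
  exists_lie_eq_cor : ∀ i, ∃ c : ℂ, ⁅basis (Sum.inr (simple i)),
    c • basis (Sum.inr (neg (simple i)))⁆ = ∑ j, cor i j • basis (Sum.inl j)
  cor_self : ∀ i, cor i i = 2

namespace RootFrame

variable {𝔤 : Type*} [LieRing 𝔤] [LieAlgebra ℂ 𝔤] {S Φ : Type*} [Fintype S] [Fintype Φ]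
  (F : RootFrame 𝔤 S Φ)

/-- The weight of a basis vector; it is zero for the vectors of the Cartan subalgebra. -/
def weight (k : S ⊕ Φ) : S → ℂ := Sum.elim (fun _ => 0) F.wt k

/-- The generic height of a basis vector; it is zero for the vectors of the Cartan subalgebra. -/
def height (k : S ⊕ Φ) : ℤ := Sum.elim (fun _ => 0) F.deg k

@[simp] lemma height_inl (i : S) : F.height (Sum.inl i) = 0 := rfl
@[simp] lemma height_inr (α : Φ) : F.height (Sum.inr α) = F.deg α := rfl
@[simp] lemma weight_inl (i : S) : F.weight (Sum.inl i) = 0 := rfl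
@[simp] lemma weight_inr (α : Φ) : F.weight (Sum.inr α) = F.wt α := rfl

lemma height_eq (k : S ⊕ Φ) : (F.height k : ℂ) = ∑ i, (F.ht i : ℂ) * F.weight k i := by
  rcases k with i | α
  · simp
  · simpa using F.deg_eq α

lemma height_neg (α : Φ) : F.deg (F.neg α) = -F.deg α := by
  have : ((F.deg (F.neg α) : ℤ) : ℂ) = ((-F.deg α : ℤ) : ℂ) := by
    push_cast
    rw [F.deg_eq, F.deg_eq, F.wt_neg]
    simp
  exact_mod_cast this

lemma wt_injective : Function.Injective F.wt := by
  intro α β h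
  apply F.deg_injective
  have : ((F.deg α : ℤ) : ℂ) = F.deg β := by rw [F.deg_eq, F.deg_eq, h]
  exact_mod_cast this

lemma neg_neg (α : Φ) : F.neg (F.neg α) = α := by
  apply F.deg_injective
  rw [height_neg, height_neg, _root_.neg_neg]

lemma weight_add {j k l : S ⊕ Φ} (h : F.basis.repr ⁅F.basis j, F.basis k⁆ l ≠ 0) :
    F.weight l = F.weight j + F.weight k := F.wt_add j k l h

lemma height_add {j k l : S ⊕ Φ} (h : F.basis.repr ⁅F.basis j, F.basis k⁆ l ≠ 0) :
    F.height l = F.height j + F.height k := by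
  have : ((F.height l : ℤ) : ℂ) = ((F.height j + F.height k : ℤ) : ℂ) := by
    push_cast
    rw [F.height_eq, F.height_eq, F.height_eq, F.weight_add h, ← Finset.sum_add_distrib]
    exact Finset.sum_congr rfl fun i _ => by simp [mul_add]
  exact_mod_cast this

lemma lie_inl_inl (i j : S) : ⁅F.basis (Sum.inl i), F.basis (Sum.inl j)⁆ = 0 := by
  rw [F.lie_cartan]
  simp

lemma lie_inl_inr (i : S) (α : Φ) :
    ⁅F.basis (Sum.inl i), F.basis (Sum.inr α)⁆ = F.wt α i • F.basis (Sum.inr α) :=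
  F.lie_cartan i _

section

variable (R : Type*) [CommRing R] [Algebra ℂ R]

/-- The basis of `R ⊗ 𝔤` given by a root frame. -/
abbrev rb : Module.Basis (S ⊕ Φ) R (R ⊗[ℂ] 𝔤) := F.basis.baseChange R

variable {R}

lemma lie_rb (j k : S ⊕ Φ) :
    ⁅F.rb R j, F.rb R k⁆ = (1 : R) ⊗ₜ[ℂ] ⁅F.basis j, F.basis k⁆ := by
  simp [Module.Basis.baseChange_apply, LieAlgebra.ExtendScalars.bracket_tmul]

lemma repr_lie_rb (j k l : S ⊕ Φ) : (F.rb R).repr ⁅F.rb R j, F.rb R k⁆ l =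
    algebraMap ℂ R (F.basis.repr ⁅F.basis j, F.basis k⁆ l) := by
  rw [lie_rb, Module.Basis.baseChange_repr_tmul, Algebra.algebraMap_eq_smul_one]

/-- The bracket in coordinates. -/
lemma lie_eq_sum (x y : R ⊗[ℂ] 𝔤) : ⁅x, y⁆ = ∑ j, ∑ k,
    ((F.rb R).repr x j * (F.rb R).repr y k) • ⁅F.rb R j, F.rb R k⁆ := by
  have h : ∀ (r : R) (v w : R ⊗[ℂ] 𝔤), ⁅r • v, w⁆ = r • ⁅v, w⁆ := fun r v w => smul_lie r v w
  have h' : ∀ (r : R) (v w : R ⊗[ℂ] 𝔤), ⁅v, r • w⁆ = r • ⁅v, w⁆ := fun r v w => lie_smul r v w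
  conv_lhs => rw [← (F.rb R).sum_repr x, ← (F.rb R).sum_repr y]
  simp only [sum_lie, lie_sum, h, h', Finset.smul_sum, smul_smul]
  rw [Finset.sum_comm]
  simp only [mul_comm]

variable (R)

/-- The sum of the root spaces of the roots with generic height in `s`, and of the Cartan
subalgebra if `0 ∈ s`, over `R`. For `s = Set.Ici 0` it is the Borel subalgebra, for
`s = Set.Ioi 0` its nilradical. -/
def gr (s : Set ℤ) : Submodule R (R ⊗[ℂ] 𝔤) where
  carrier := {x | ∀ k, F.height k ∉ s → (F.rb R).repr x k = 0}
  add_mem' := fun hx hy k hk => by simp [hx k hk, hy k hk]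
  zero_mem' := fun k _ => by simp
  smul_mem' := fun r x hx k hk => by simp [hx k hk]

variable {R}

lemma gr_mono {s t : Set ℤ} (h : s ⊆ t) : F.gr R s ≤ F.gr R t :=
  fun _ hx k hk => hx k fun h' => hk (h h')

lemma rb_mem_gr {s : Set ℤ} {k : S ⊕ Φ} (h : F.height k ∈ s) : F.rb R k ∈ F.gr R s := by
  classical
  intro l hl
  rw [Module.Basis.repr_self, Finsupp.single_apply, if_neg]
  rintro rfl
  exact hl h

lemma gr_eq_span (s : Set ℤ) :
    F.gr R s = Submodule.span R {x | ∃ k, F.height k ∈ s ∧ x = F.rb R k} := by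
  refine le_antisymm (fun x hx => ?_) (Submodule.span_le.mpr ?_)
  · rw [← (F.rb R).sum_repr x]
    refine Submodule.sum_mem _ fun k _ => ?_
    by_cases h : F.height k ∈ s
    · exact Submodule.smul_mem _ _ (Submodule.subset_span ⟨k, h, rfl⟩)
    · rw [hx k h, zero_smul]
      exact zero_mem _
  · rintro _ ⟨k, hk, rfl⟩
    exact F.rb_mem_gr hk

lemma lie_rb_mem_gr {s : Set ℤ} {j k : S ⊕ Φ} (h : F.height j + F.height k ∈ s) :
    ⁅F.rb R j, F.rb R k⁆ ∈ F.gr R s := by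
  intro l hl
  rw [repr_lie_rb]
  by_contra h0
  refine hl ?_
  rw [F.height_add (j := j) (k := k) fun h' => h0 (by rw [h', map_zero])]
  exact h

lemma lie_mem_gr {s t u : Set ℤ} (h : ∀ a ∈ s, ∀ b ∈ t, a + b ∈ u) {x y : R ⊗[ℂ] 𝔤}
    (hx : x ∈ F.gr R s) (hy : y ∈ F.gr R t) : ⁅x, y⁆ ∈ F.gr R u := by
  rw [F.lie_eq_sum]
  refine Submodule.sum_mem _ fun j _ => Submodule.sum_mem _ fun k _ => ?_
  by_cases hj : F.height j ∈ s
  · by_cases hk : F.height k ∈ t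
    · exact Submodule.smul_mem _ _ (F.lie_rb_mem_gr (h _ hj _ hk))
    · rw [hy k hk, mul_zero, zero_smul]; exact zero_mem _
  · rw [hx j hj, zero_mul, zero_smul]; exact zero_mem _

/-- The Borel subalgebra has its derived subalgebra in the nilradical. -/
lemma lie_mem_gr_pos {x y : R ⊗[ℂ] 𝔤} (hx : x ∈ F.gr R (Set.Ici 0))
    (hy : y ∈ F.gr R (Set.Ici 0)) : ⁅x, y⁆ ∈ F.gr R (Set.Ioi 0) := by
  rw [F.lie_eq_sum]
  refine Submodule.sum_mem _ fun j _ => Submodule.sum_mem _ fun k _ => ?_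
  by_cases hj : F.height j ∈ Set.Ici 0
  · by_cases hk : F.height k ∈ Set.Ici 0
    · rcases j with i | α
      · rcases k with i' | β
        · rw [lie_rb, lie_inl_inl, TensorProduct.tmul_zero, smul_zero]; exact zero_mem _
        · refine Submodule.smul_mem _ _ (F.lie_rb_mem_gr ?_)
          have := F.deg_ne_zero β
          simp only [height_inl, height_inr, Set.mem_Ioi, Set.mem_Ici] at hk ⊢
          omega
      · refine Submodule.smul_mem _ _ (F.lie_rb_mem_gr ?_)
        have := F.deg_ne_zero α
        simp only [height_inr, Set.mem_Ioi, Set.mem_Ici] at hj hk ⊢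
        omega
    · rw [hy k hk, mul_zero, zero_smul]; exact zero_mem _
  · rw [hx j hj, zero_mul, zero_smul]; exact zero_mem _

/-- The Killing form of `R ⊗ 𝔤`. -/
abbrev kf (R : Type*) [CommRing R] [Algebra ℂ R] :
    LinearMap.BilinForm R (R ⊗[ℂ] 𝔤) := (killingForm ℂ 𝔤).baseChange R

lemma kf_tmul (r s : R) (x y : 𝔤) :
    kf R (r ⊗ₜ[ℂ] x) (s ⊗ₜ[ℂ] y) = killingForm ℂ 𝔤 x y • (r * s) := by
  simp [kf]

end

variable (R : Type*) [CommRing R] [Algebra ℂ R]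

/-- The coweight `∑ ht i • ω i`, whose adjoint action is the grading by generic height. -/
def grading : R ⊗[ℂ] 𝔤 := ∑ i, ((F.ht i : R)) • F.rb R (Sum.inl i)

variable {R}

lemma grading_lie_rb (k : S ⊕ Φ) : ⁅F.grading R, F.rb R k⁆ = ((F.height k : ℤ) : R) • F.rb R k := by
  have h : ∀ (r : R) (v w : R ⊗[ℂ] 𝔤), ⁅r • v, w⁆ = r • ⁅v, w⁆ := fun r v w => smul_lie r v w
  have e : ((F.height k : ℤ) : R) = algebraMap ℂ R (F.height k : ℤ) := by simp
  rw [grading, sum_lie, e, F.height_eq, map_sum, Finset.sum_smul]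
  refine Finset.sum_congr rfl fun i _ => ?_
  rw [h, lie_rb, F.lie_cartan, TensorProduct.tmul_smul, map_mul, map_intCast, mul_smul,
    algebraMap_smul, Module.Basis.baseChange_apply]
  rfl

lemma repr_grading_lie (x : R ⊗[ℂ] 𝔤) (k : S ⊕ Φ) :
    (F.rb R).repr ⁅F.grading R, x⁆ k = ((F.height k : ℤ) : R) * (F.rb R).repr x k := by
  classical
  have h' : ∀ (r : R) (v w : R ⊗[ℂ] 𝔤), ⁅v, r • w⁆ = r • ⁅v, w⁆ := fun r v w => lie_smul r v w
  conv_lhs => rw [← (F.rb R).sum_repr x]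
  rw [lie_sum, map_sum, Finsupp.finsetSum_apply, Finset.sum_eq_single k]
  · rw [h', grading_lie_rb, smul_smul, map_smul, Module.Basis.repr_self]
    simp [mul_comm]
  · intro l _ hl
    rw [h', grading_lie_rb, smul_smul, map_smul, Module.Basis.repr_self]
    simp [hl]
  · simp

lemma grading_mem : F.grading R ∈ F.gr R {0} :=
  Submodule.sum_mem _ fun _ _ => Submodule.smul_mem _ _ (F.rb_mem_gr (by simp))

end RootFrame

/-! ### Exponentials of nilpotent endomorphisms -/

section Exponential

variable {R M : Type*} [CommRing R] [Algebra ℂ R] [AddCommGroup M] [Module R M]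

/-- The exponential series of an endomorphism, cut off at `N`. -/
def expSum (T : Module.End R M) (N : ℕ) : Module.End R M :=
  ∑ n ∈ Finset.range N, algebraMap ℂ R ((n.factorial : ℂ)⁻¹) • T ^ n

lemma expSum_eq_exp {T : Module.End R M} {N : ℕ} (h : T ^ N = 0) :
    letI : Module ℚ (Module.End R M) :=
      Module.compHom _ ((algebraMap ℂ R).comp (algebraMap ℚ ℂ))
    expSum T N = IsNilpotent.exp T := by
  let : Module ℚ (Module.End R M) :=
      Module.compHom _ ((algebraMap ℂ R).comp (algebraMap ℚ ℂ))
  change expSum T N = IsNilpotent.exp T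
  rw [IsNilpotent.exp_eq_sum h]
  refine Finset.sum_congr rfl fun n _ => ?_
  change _ = algebraMap ℂ R (algebraMap ℚ ℂ _) • T ^ n
  simp

lemma expSum_mul_expSum_neg {T : Module.End R M} {N : ℕ} (h : T ^ N = 0) :
    expSum T N * expSum (-T) N = 1 := by
  have h' : (-T) ^ N = 0 := by rw [neg_pow, h, mul_zero]
  let : Module ℚ (Module.End R M) :=
      Module.compHom _ ((algebraMap ℂ R).comp (algebraMap ℚ ℂ))
  rw [expSum_eq_exp h, expSum_eq_exp h']
  exact IsNilpotent.exp_mul_exp_neg_self ⟨N, h⟩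

/-- The exponential of a nilpotent endomorphism, as an automorphism. -/
def expEquiv (T : Module.End R M) {N : ℕ} (h : T ^ N = 0) : M ≃ₗ[R] M :=
  LinearEquiv.ofLinearMap (expSum T N) (expSum (-T) N) (expSum_mul_expSum_neg h) (by
    have := expSum_mul_expSum_neg (T := -T) (N := N) (by rw [neg_pow, h, mul_zero])
    rwa [neg_neg] at this)

lemma expEquiv_apply (T : Module.End R M) {N : ℕ} (h : T ^ N = 0) (y : M) :
    expEquiv T h y =
      ∑ n ∈ Finset.range N, algebraMap ℂ R ((n.factorial : ℂ)⁻¹) • (T ^ n) y := by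
  change expSum T N y = _
  simp [expSum]

lemma expEquiv_inv_apply (T : Module.End R M) {N : ℕ} (h : T ^ N = 0) (y : M) :
    (expEquiv T h)⁻¹ y =
      ∑ n ∈ Finset.range N, algebraMap ℂ R ((n.factorial : ℂ)⁻¹) • ((-T) ^ n) y := by
  change expSum (-T) N y = _
  simp [expSum]

end Exponential

/-! ### Elements of the adjoint group -/

section AdjointGroup

variable {𝔤 : Type*} [LieRing 𝔤] [LieAlgebra ℂ 𝔤]

/-- The elements of the adjoint group are automorphisms of the Lie algebra. -/
lemma map_lie_of_mem_adjGroup {a : 𝔤 ≃ₗ[ℂ] 𝔤} (ha : a ∈ adjGroup 𝔤) (x y : 𝔤) :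
    a ⁅x, y⁆ = ⁅a x, a y⁆ := by
  induction ha using Subgroup.closure_induction generalizing x y with
  | mem g hg =>
    obtain ⟨z, N, hN, hg⟩ := hg
    let : Module ℚ 𝔤 := Module.compHom _ (algebraMap ℚ ℂ)
    let : LieAlgebra ℚ 𝔤 :=
      { lie_smul := fun q x y => lie_smul (algebraMap ℚ ℂ q) x y }
    have hN' : (LieDerivation.ad ℂ 𝔤 z).toLinearMap ^ N = 0 := by
      rw [LieDerivation.coe_ad_apply_eq_ad_apply, hN]
    have hnil : IsNilpotent (LieDerivation.ad ℂ 𝔤 z).toLinearMap := ⟨N, hN'⟩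
    have key : ∀ y, g y = LieDerivation.exp (LieDerivation.ad ℂ 𝔤 z) hnil y := by
      intro y
      rw [hg, LieDerivation.exp_map_apply, IsNilpotent.exp_eq_sum hN', LinearMap.sum_apply]
      refine Finset.sum_congr rfl fun n _ => ?_
      rw [LinearMap.smul_apply]
      change _ = algebraMap ℚ ℂ _ • (_ : 𝔤)
      simp only [map_inv₀, map_natCast]
      rw [LieDerivation.coe_ad_apply_eq_ad_apply]
    simp only [key, LieEquiv.map_lie]
  | one => simp
  | mul g h _ _ hg hh => simp only [LinearEquiv.mul_apply, hg, hh]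
  | inv g _ hg =>
    apply g.injective
    have e : ∀ z, g (g⁻¹ z) = z := g.apply_symm_apply
    rw [hg, e, e, e]

/-- The polynomials in `s` which give the coordinates of `exp (s • ad x)`. -/
def expCoord (x : 𝔤) (N : ℕ) : CoordIdx 𝔤 → Polynomial ℂ :=
  Sum.elim
    (fun c => ∑ n ∈ Finset.range N, Polynomial.C ((n.factorial : ℂ)⁻¹ *
      c.2 ((LieAlgebra.ad ℂ 𝔤 x ^ n) c.1)) * Polynomial.X ^ n)
    (fun c => ∑ n ∈ Finset.range N, Polynomial.C ((n.factorial : ℂ)⁻¹ *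
      c.2 ((LieAlgebra.ad ℂ 𝔤 x ^ n) c.1)) * (-Polynomial.X) ^ n)

lemma expEquiv_smul_inv_apply {R M : Type*} [CommRing R] [Algebra ℂ R] [AddCommGroup M]
    [Module R M] (r : R) (T : Module.End R M) {N : ℕ} (h : (r • T) ^ N = 0) (y : M) :
    (expEquiv (r • T) h)⁻¹ y = ∑ n ∈ Finset.range N,
      algebraMap ℂ R ((n.factorial : ℂ)⁻¹) • (-r) ^ n • (T ^ n) y := by
  rw [expEquiv_inv_apply, ← neg_smul]
  simp only [smul_pow, LinearMap.smul_apply]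

lemma smul_ad_pow {x : 𝔤} {N : ℕ} (h : LieAlgebra.ad ℂ 𝔤 x ^ N = 0) (s : ℂ) :
    (s • LieAlgebra.ad ℂ 𝔤 x) ^ N = 0 := by
  rw [smul_pow, h, smul_zero]

lemma expEquiv_mem_adjGroup {x : 𝔤} {N : ℕ} (h : LieAlgebra.ad ℂ 𝔤 x ^ N = 0) (s : ℂ) :
    expEquiv (s • LieAlgebra.ad ℂ 𝔤 x) (smul_ad_pow h s) ∈ adjGroup 𝔤 := by
  refine Subgroup.subset_closure ⟨s • x, N, ?_, fun y => ?_⟩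
  · rw [map_smul, smul_ad_pow h]
  · rw [expEquiv_apply, map_smul]
    rfl

lemma coordC_expEquiv {x : 𝔤} {N : ℕ} (h : LieAlgebra.ad ℂ 𝔤 x ^ N = 0) (s : ℂ)
    (c : CoordIdx 𝔤) :
    coordC (expEquiv (s • LieAlgebra.ad ℂ 𝔤 x) (smul_ad_pow h s)) c =
      (expCoord x N c).eval s := by
  rcases c with c | c
  · simp only [coordC, Sum.elim_inl, expEquiv_apply, expCoord, map_sum, Polynomial.eval_finsetSum,
      smul_pow, map_smul, LinearMap.smul_apply]
    refine Finset.sum_congr rfl fun n _ => ?_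
    simp
    ring
  · simp only [coordC, Sum.elim_inr, expEquiv_smul_inv_apply, expCoord, map_sum,
      Polynomial.eval_finsetSum, map_smul]
    refine Finset.sum_congr rfl fun n _ => ?_
    simp
    ring

section Points

variable {R : Type*} [CommRing R] [Algebra ℂ R]

lemma baseChange_pow_apply_tmul (T : Module.End ℂ 𝔤) (n : ℕ) (y : 𝔤) :
    ((T.baseChange R) ^ n) ((1 : R) ⊗ₜ[ℂ] y) = 1 ⊗ₜ (T ^ n) y := by
  induction n generalizing y with
  | zero => simp
  | succ n ih => rw [pow_succ, pow_succ, Module.End.mul_apply, LinearMap.baseChange_tmul, ih,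
      Module.End.mul_apply]

lemma smul_baseChange_pow {T : Module.End ℂ 𝔤} {N : ℕ} (h : T ^ N = 0) (r : R) :
    (r • T.baseChange R) ^ N = 0 := by
  rw [smul_pow]
  have : (T.baseChange R) ^ N = 0 := by
    ext y
    simp [baseChange_pow_apply_tmul, h]
  rw [this, smul_zero]

lemma coord_expEquiv {x : 𝔤} {N : ℕ} (h : LieAlgebra.ad ℂ 𝔤 x ^ N = 0) (r : R)
    (c : CoordIdx 𝔤) :
    coord (expEquiv (r • (LieAlgebra.ad ℂ 𝔤 x).baseChange R) (smul_baseChange_pow h r)) c =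
      Polynomial.aeval r (expCoord x N c) := by
  rcases c with c | c
  · simp only [coord, Sum.elim_inl, expEquiv_apply, expCoord, map_sum,
      smul_pow, map_smul, LinearMap.smul_apply, baseChange_pow_apply_tmul]
    refine Finset.sum_congr rfl fun n _ => ?_
    simp [Algebra.smul_def]
    ring
  · simp only [coord, Sum.elim_inr, expEquiv_smul_inv_apply, expCoord, map_sum,
      map_smul, baseChange_pow_apply_tmul]
    refine Finset.sum_congr rfl fun n _ => ?_
    simp [Algebra.smul_def]
    ring

/-- For `x` with `ad x` nilpotent, `exp (r • ad x)` is an `R`-point of the adjoint group: an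
equation of the group gives a polynomial in `r` that vanishes at all complex numbers. -/
lemma expEquiv_mem_adjPoints [FiniteDimensional ℂ 𝔤] {x : 𝔤} {N : ℕ}
    (h : LieAlgebra.ad ℂ 𝔤 x ^ N = 0) (r : R) :
    expEquiv (r • (LieAlgebra.ad ℂ 𝔤 x).baseChange R) (smul_baseChange_pow h r) ∈
      adjPoints 𝔤 R := by
  intro p hp
  have e : coord (expEquiv (r • (LieAlgebra.ad ℂ 𝔤 x).baseChange R) (smul_baseChange_pow h r)) =
      fun c => Polynomial.aeval r (expCoord x N c) := funext (coord_expEquiv h r)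
  have hz : MvPolynomial.aeval (expCoord x N) p = 0 := by
    refine Polynomial.funext fun s => ?_
    have h1 := hp _ (expEquiv_mem_adjGroup h s)
    have e2 : coordC (expEquiv (s • LieAlgebra.ad ℂ 𝔤 x) (smul_ad_pow h s)) =
        fun c => Polynomial.aeval s (expCoord x N c) := by
      funext c
      rw [coordC_expEquiv h, Polynomial.coe_aeval_eq_eval]
    rw [e2] at h1
    have h2 := MvPolynomial.comp_aeval_apply (expCoord x N) (Polynomial.aeval s) p
    rw [h1, Polynomial.coe_aeval_eq_eval] at h2
    simpa using h2
  have h2 := MvPolynomial.comp_aeval_apply (expCoord x N) (Polynomial.aeval r) p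
  rw [hz, map_zero] at h2
  rw [e]
  exact h2.symm

end Points

/-- Every element of the adjoint group is joined to the identity by a polynomial curve. -/
lemma exists_curve [FiniteDimensional ℂ 𝔤] {a : 𝔤 ≃ₗ[ℂ] 𝔤} (ha : a ∈ adjGroup 𝔤) :
    ∃ (γ : ℂ → 𝔤 ≃ₗ[ℂ] 𝔤) (P : CoordIdx 𝔤 → Polynomial ℂ), (∀ s, γ s ∈ adjGroup 𝔤) ∧
      γ 0 = 1 ∧ γ 1 = a ∧ ∀ s c, coordC (γ s) c = (P c).eval s := by
  induction ha using Subgroup.closure_induction with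
  | mem g hg =>
    obtain ⟨x, N, hN, hg⟩ := hg
    refine ⟨fun s => expEquiv (s • LieAlgebra.ad ℂ 𝔤 x) (smul_ad_pow hN s), expCoord x N,
      expEquiv_mem_adjGroup hN, ?_, ?_, coordC_expEquiv hN⟩
    · ext y
      -- for `N = 0`, the hypothesis `ad x ^ 0 = 0` means that `𝔤` is zero
      rcases N with _ | N
      · have h0 : ∀ z : 𝔤, z = 0 := fun z => by
          have := LinearMap.congr_fun hN z
          simpa using this
        rw [h0 y, map_zero, map_zero]
      · simp [expEquiv_apply, Finset.sum_range_succ']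
    · ext y
      rw [hg, expEquiv_apply]
      simp
  | one =>
    exact ⟨fun _ => 1, fun c => Polynomial.C (coordC 1 c), fun _ => one_mem _, rfl, rfl,
      fun s c => by simp⟩
  | mul g h _ _ hg hh =>
    obtain ⟨γ, P, h1, h2, h3, h4⟩ := hg
    obtain ⟨γ', P', h1', h2', h3', h4'⟩ := hh
    let e := Module.finBasis ℂ 𝔤
    refine ⟨fun s => γ s * γ' s, Sum.elim
      (fun c => ∑ j, P' (Sum.inl (c.1, e.coord j)) * P (Sum.inl (e j, c.2)))
      (fun c => ∑ j, P (Sum.inr (c.1, e.coord j)) * P' (Sum.inr (e j, c.2))),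
      fun s => mul_mem (h1 s) (h1' s), ?_, ?_, fun s c => ?_⟩
    · change γ 0 * γ' 0 = 1
      rw [h2, h2', one_mul]
    · change γ 1 * γ' 1 = _
      rw [h3, h3']
    · rcases c with c | c
      · simp only [Sum.elim_inl, Polynomial.eval_finsetSum, Polynomial.eval_mul, ← h4, ← h4']
        simp only [coordC, Sum.elim_inl, LinearEquiv.mul_apply]
        conv_lhs => rw [← e.sum_repr (γ' s c.1)]
        simp only [map_sum, map_smul, smul_eq_mul, Module.Basis.coord_apply]
      · simp only [Sum.elim_inr, Polynomial.eval_finsetSum, Polynomial.eval_mul, ← h4, ← h4']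
        simp only [coordC, Sum.elim_inr, mul_inv_rev, LinearEquiv.mul_apply]
        conv_lhs => rw [← e.sum_repr ((γ s)⁻¹ c.1)]
        simp only [map_sum, map_smul, smul_eq_mul, Module.Basis.coord_apply]
  | inv g _ hg =>
    obtain ⟨γ, P, h1, h2, h3, h4⟩ := hg
    refine ⟨fun s => (γ s)⁻¹, fun c => P c.swap, fun s => inv_mem (h1 s), ?_, ?_, fun s c => ?_⟩
    · change (γ 0)⁻¹ = 1
      rw [h2, inv_one]
    · change (γ 1)⁻¹ = _
      rw [h3]
    · rw [← h4]
      rcases c with c | c <;> simp [coordC]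

end AdjointGroup

namespace RootFrame

variable {𝔤 : Type*} [LieRing 𝔤] [LieAlgebra ℂ 𝔤] {S Φ : Type*} [Fintype S] [Fintype Φ]
  (F : RootFrame 𝔤 S Φ) {R : Type*} [CommRing R] [Algebra ℂ R]

lemma baseChange_coord (k : S ⊕ Φ) (w : R ⊗[ℂ] 𝔤) :
    Module.Dual.baseChange R (F.basis.coord k) w = (F.rb R).repr w k := by
  induction w using TensorProduct.induction_on with
  | zero => simp
  | tmul r x => simp [Module.Basis.baseChange_repr_tmul]
  | add x y hx hy => simp only [map_add, hx, hy, Finsupp.add_apply]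

include F in
/-- The `R`-points of the adjoint group are automorphisms of the Lie algebra `R ⊗ 𝔤`. -/
lemma map_lie_of_mem_adjPoints [FiniteDimensional ℂ 𝔤] {g : (R ⊗[ℂ] 𝔤) ≃ₗ[R] (R ⊗[ℂ] 𝔤)}
    (hg : g ∈ adjPoints 𝔤 R) (v w : R ⊗[ℂ] 𝔤) : g ⁅v, w⁆ = ⁅g v, g w⁆ := by
  have key : ∀ x y : 𝔤, g ((1 : R) ⊗ₜ ⁅x, y⁆) = ⁅g (1 ⊗ₜ x), g (1 ⊗ₜ y)⁆ := by
    intro x y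
    refine (F.rb R).ext_elem fun l => ?_
    -- compatibility with the bracket is, coordinate by coordinate, an equation of the group
    let p : MvPolynomial (CoordIdx 𝔤) ℂ := MvPolynomial.X (Sum.inl (⁅x, y⁆, F.basis.coord l)) -
      ∑ j, ∑ k, MvPolynomial.X (Sum.inl (x, F.basis.coord j)) *
        MvPolynomial.X (Sum.inl (y, F.basis.coord k)) *
        MvPolynomial.C (F.basis.repr ⁅F.basis j, F.basis k⁆ l)
    have hp : IsEquation p := by
      intro a ha
      simp only [p, map_sub, MvPolynomial.aeval_X, map_sum, map_mul, MvPolynomial.aeval_C, coordC,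
        Sum.elim_inl, map_lie_of_mem_adjGroup ha, Module.Basis.coord_apply]
      conv_lhs =>
        enter [1]
        rw [← F.basis.sum_repr (a x), ← F.basis.sum_repr (a y)]
      simp only [sum_lie, lie_sum, smul_lie, lie_smul, map_sum, map_smul, Finsupp.finsetSum_apply,
        Finsupp.smul_apply, smul_eq_mul, Finset.mul_sum]
      rw [sub_eq_zero, Finset.sum_comm]
      refine Finset.sum_congr rfl fun j _ => Finset.sum_congr rfl fun k _ => ?_
      simp
      ring
    have h := hg p hp
    simp only [p, map_sub, MvPolynomial.aeval_X, map_sum, map_mul, MvPolynomial.aeval_C, coord,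
        Sum.elim_inl, baseChange_coord] at h
    rw [sub_eq_zero] at h
    rw [h, F.lie_eq_sum]
    simp only [map_sum, Finsupp.finsetSum_apply, map_smul, Finsupp.smul_apply, repr_lie_rb,
      smul_eq_mul]
  have hl : ∀ (r : R) (v w : R ⊗[ℂ] 𝔤), ⁅r • v, w⁆ = r • ⁅v, w⁆ := fun r v w => smul_lie r v w
  have hr : ∀ (r : R) (v w : R ⊗[ℂ] 𝔤), ⁅v, r • w⁆ = r • ⁅v, w⁆ := fun r v w => lie_smul r v w
  have ht : ∀ (r : R) (x : 𝔤), r ⊗ₜ[ℂ] x = r • ((1 : R) ⊗ₜ[ℂ] x) := fun r x => by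
    simp [TensorProduct.smul_tmul']
  induction v using TensorProduct.induction_on with
  | zero => simp
  | tmul r x =>
    induction w using TensorProduct.induction_on with
    | zero => simp
    | tmul s y =>
      have e : ⁅r ⊗ₜ[ℂ] x, s ⊗ₜ[ℂ] y⁆ = (r * s) • ((1 : R) ⊗ₜ[ℂ] ⁅x, y⁆) := by
        rw [LieAlgebra.ExtendScalars.bracket_tmul, ht]
      rw [e, map_smul, key, ht r x, ht s y, map_smul, map_smul, hl, hr, smul_smul]
    | add y z hy hz => rw [lie_add, map_add, hy, hz, map_add, lie_add]
  | add y z hy hz => rw [add_lie, map_add, hy, hz, map_add, add_lie]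

include F in
/-- The `R`-points of the adjoint group preserve the Killing form. -/
lemma kf_of_mem_adjPoints [FiniteDimensional ℂ 𝔤] {g : (R ⊗[ℂ] 𝔤) ≃ₗ[R] (R ⊗[ℂ] 𝔤)}
    (hg : g ∈ adjPoints 𝔤 R) (v w : R ⊗[ℂ] 𝔤) : kf R (g v) (g w) = kf R v w := by
  let e : (R ⊗[ℂ] 𝔤) ≃ₗ⁅R⁆ (R ⊗[ℂ] 𝔤) :=
    { g with map_lie' := fun {v w} => F.map_lie_of_mem_adjPoints hg v w }
  have h1 := LieAlgebra.killingForm_of_equiv_apply e v w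
  have h2 : killingForm R (R ⊗[ℂ] 𝔤) = kf R := LieModule.traceForm_baseChange ℂ 𝔤 𝔤 R
  rw [h2] at h1
  exact h1

end RootFrame

namespace RootFrame

variable {𝔤 : Type*} [LieRing 𝔤] [LieAlgebra ℂ 𝔤] {S Φ : Type*} [Fintype S] [Fintype Φ]
  (F : RootFrame 𝔤 S Φ) {R : Type*} [CommRing R] [Algebra ℂ R]

/-! ### Eigenvalues of the elements of a Borel subalgebra -/

/-- The value of the weight of `k` on the Cartan component of `y`. -/
def ev (y : R ⊗[ℂ] 𝔤) (k : S ⊕ Φ) : R :=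
  ∑ i, (F.rb R).repr y (Sum.inl i) * algebraMap ℂ R (F.weight k i)

lemma repr_lie_inl (i : S) (x : R ⊗[ℂ] 𝔤) (l : S ⊕ Φ) :
    (F.rb R).repr ⁅F.rb R (Sum.inl i), x⁆ l =
      algebraMap ℂ R (F.weight l i) * (F.rb R).repr x l := by
  classical
  have h' : ∀ (r : R) (v w : R ⊗[ℂ] 𝔤), ⁅v, r • w⁆ = r • ⁅v, w⁆ := fun r v w => lie_smul r v w
  have e : ∀ k, (F.rb R).repr ⁅F.rb R (Sum.inl i), F.rb R k⁆ l =
      if k = l then algebraMap ℂ R (F.weight l i) else 0 := by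
    intro k
    rw [repr_lie_rb, F.lie_cartan]
    by_cases hk : k = l
    · subst hk
      simp [weight]
    · simp [hk]
  conv_lhs => rw [← (F.rb R).sum_repr x]
  simp only [lie_sum, h', map_sum, map_smul, Finsupp.finsetSum_apply, Finsupp.smul_apply, e,
    smul_eq_mul, mul_ite, mul_zero, Finset.sum_ite_eq', Finset.mem_univ, if_true]
  exact mul_comm _ _

/-- The Cartan component of a vector. -/
def cartanPart (y : R ⊗[ℂ] 𝔤) : R ⊗[ℂ] 𝔤 :=
  ∑ i, (F.rb R).repr y (Sum.inl i) • F.rb R (Sum.inl i)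

lemma repr_cartanPart_lie (y x : R ⊗[ℂ] 𝔤) (l : S ⊕ Φ) :
    (F.rb R).repr ⁅F.cartanPart y, x⁆ l = F.ev y l * (F.rb R).repr x l := by
  have h : ∀ (r : R) (v w : R ⊗[ℂ] 𝔤), ⁅r • v, w⁆ = r • ⁅v, w⁆ := fun r v w => smul_lie r v w
  simp only [cartanPart, sum_lie, h, map_sum, map_smul, Finsupp.finsetSum_apply,
    Finsupp.smul_apply, repr_lie_inl, smul_eq_mul, ev, Finset.sum_mul, mul_assoc]

lemma cartanPart_mem (y : R ⊗[ℂ] 𝔤) : F.cartanPart y ∈ F.gr R {0} :=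
  Submodule.sum_mem _ fun _ _ => Submodule.smul_mem _ _ (F.rb_mem_gr (by simp))

lemma repr_cartanPart_inl (y : R ⊗[ℂ] 𝔤) (i : S) :
    (F.rb R).repr (F.cartanPart y) (Sum.inl i) = (F.rb R).repr y (Sum.inl i) := by
  classical
  simp [cartanPart, Finsupp.single_apply]

lemma sub_cartanPart_mem {y : R ⊗[ℂ] 𝔤} {s : Set ℤ} (hy : y ∈ F.gr R s) :
    y - F.cartanPart y ∈ F.gr R (s \ {0}) := by
  intro k hk
  rcases k with i | α
  · rw [map_sub, Finsupp.sub_apply, repr_cartanPart_inl, sub_self]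
  · have h0 : F.height (Sum.inr α) ∉ ({0} : Set ℤ) := F.deg_ne_zero α
    rw [map_sub, Finsupp.sub_apply, F.cartanPart_mem y _ h0, sub_zero]
    exact hy _ fun h => hk ⟨h, h0⟩

lemma repr_lie_of_lowest {y x : R ⊗[ℂ] 𝔤} {l : S ⊕ Φ} (hy : y ∈ F.gr R (Set.Ici 0))
    (hx : x ∈ F.gr R (Set.Ici (F.height l))) :
    (F.rb R).repr ⁅y, x⁆ l = F.ev y l * (F.rb R).repr x l := by
  have e : ⁅y, x⁆ = ⁅F.cartanPart y, x⁆ + ⁅y - F.cartanPart y, x⁆ := by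
    rw [← add_lie, add_sub_cancel]
  have h : ⁅y - F.cartanPart y, x⁆ ∈ F.gr R (Set.Ioi (F.height l)) := by
    refine F.lie_mem_gr ?_ (F.sub_cartanPart_mem hy) hx
    rintro a ⟨ha, ha'⟩ c hc
    simp only [Set.mem_Ici, Set.mem_singleton_iff, Set.mem_Ioi] at *
    omega
  rw [e, map_add, Finsupp.add_apply, repr_cartanPart_lie, h l (by simp), add_zero]

lemma repr_lie_of_highest {y x : R ⊗[ℂ] 𝔤} {l : S ⊕ Φ} (hy : y ∈ F.gr R (Set.Iic 0))
    (hx : x ∈ F.gr R (Set.Iic (F.height l))) :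
    (F.rb R).repr ⁅y, x⁆ l = F.ev y l * (F.rb R).repr x l := by
  have e : ⁅y, x⁆ = ⁅F.cartanPart y, x⁆ + ⁅y - F.cartanPart y, x⁆ := by
    rw [← add_lie, add_sub_cancel]
  have h : ⁅y - F.cartanPart y, x⁆ ∈ F.gr R (Set.Iio (F.height l)) := by
    refine F.lie_mem_gr ?_ (F.sub_cartanPart_mem hy) hx
    rintro a ⟨ha, ha'⟩ c hc
    simp only [Set.mem_Iic, Set.mem_singleton_iff, Set.mem_Iio] at *
    omega
  rw [e, map_add, Finsupp.add_apply, repr_cartanPart_lie, h l (by simp), add_zero]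

/-- The eigenvalues of an element of the Borel subalgebra are the values of the weights on its
Cartan component. -/
lemma exists_eq_ev {y x : ℂ ⊗[ℂ] 𝔤} {c : ℂ} (hy : y ∈ F.gr ℂ (Set.Ici 0)) (hx : x ≠ 0)
    (h : ⁅y, x⁆ = c • x) : ∃ k, c = F.ev y k := by
  classical
  let s := Finset.univ.filter fun k => (F.rb ℂ).repr x k ≠ 0
  have hs : s.Nonempty := by
    by_contra hs
    refine hx ((F.rb ℂ).ext_elem fun k => ?_)
    by_contra hk
    exact hs ⟨k, by simpa [s] using hk⟩
  obtain ⟨l, hl, hmin⟩ := s.exists_min_image F.height hs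
  have hxl : x ∈ F.gr ℂ (Set.Ici (F.height l)) := by
    intro k hk
    by_contra h0
    exact hk (hmin k (by simpa [s] using h0))
  have h1 := F.repr_lie_of_lowest hy hxl
  rw [h, map_smul, Finsupp.smul_apply, smul_eq_mul] at h1
  exact ⟨l, mul_right_cancel₀ (by simpa [s] using hl) h1⟩

/-- The values of the weights on the Cartan component of an element of the opposite Borel
subalgebra are eigenvalues of this element. -/
lemma exists_lie_eq_ev_smul [FiniteDimensional ℂ 𝔤] {y : ℂ ⊗[ℂ] 𝔤} (hy : y ∈ F.gr ℂ (Set.Iic 0))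
    (l : S ⊕ Φ) : ∃ x : ℂ ⊗[ℂ] 𝔤, x ≠ 0 ∧ ⁅y, x⁆ = F.ev y l • x := by
  let V := F.gr ℂ (Set.Iic (F.height l))
  let T : Module.End ℂ (ℂ ⊗[ℂ] 𝔤) := LieAlgebra.ad ℂ (ℂ ⊗[ℂ] 𝔤) y - F.ev y l • 1
  have hT : ∀ x ∈ V, T x ∈ V := fun x hx => by
    refine sub_mem ?_ (Submodule.smul_mem _ _ hx)
    refine F.lie_mem_gr ?_ hy hx
    intro a ha c hc
    simp only [Set.mem_Iic] at *
    omega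
  by_contra! hcon
  have hinj : Function.Injective (T.restrict hT) := by
    rw [← LinearMap.ker_eq_bot, Submodule.eq_bot_iff]
    rintro ⟨x, hx⟩ hx0
    rw [LinearMap.mem_ker, Subtype.ext_iff] at hx0
    by_contra hne
    refine hcon x (fun h => hne (Subtype.ext h)) ?_
    have : ⁅y, x⁆ - F.ev y l • x = 0 := hx0
    exact sub_eq_zero.mp this
  obtain ⟨⟨x, hx⟩, hx'⟩ := LinearMap.injective_iff_surjective.mp hinj
    ⟨F.rb ℂ l, F.rb_mem_gr (by simp)⟩
  have h1 : ⁅y, x⁆ - F.ev y l • x = F.rb ℂ l := congrArg Subtype.val hx'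
  have h2 := congrArg (fun z => (F.rb ℂ).repr z l) h1
  simp only [map_sub, Finsupp.sub_apply, F.repr_lie_of_highest hy hx, map_smul,
    Finsupp.smul_apply, smul_eq_mul, sub_self, Module.Basis.repr_self,
    Finsupp.single_eq_same] at h2
  exact zero_ne_one h2

/-! ### The torus part of a Borel point is trivial on the Cartan subalgebra

On the big cell of the adjoint group, an element `a` determines an automorphism of the Cartan
subalgebra: to `h` it assigns the Cartan component `h'` of the unique `a (h + n)`, `n` in the
nilradical of the Borel subalgebra, which lies in the opposite Borel subalgebra. As `h` and `h'`
have the same eigenvalues, this automorphism takes finitely many values, so it is constant along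
polynomial curves and hence trivial. Cramer's rule turns this into a polynomial equation of the
adjoint group. -/

section Cramer

variable {A : Type*} [CommRing A]

/-- The positive roots. -/
abbrev Pos : Type _ := {α : Φ // 0 < F.deg α}

variable (y : CoordIdx 𝔤 → A)

/-- The block of a group element on the nilradical of the Borel subalgebra. -/
def block : Matrix F.Pos F.Pos A :=
  Matrix.of fun β γ => y (Sum.inl (F.basis (Sum.inr γ), F.basis.coord (Sum.inr β)))

open Classical in
/-- The determinant of the block on the nilradical; the big cell is where it is invertible. -/
def cellDet : A := (F.block y).det

open Classical in
/-- The matrix coefficients of the automorphism of the Cartan subalgebra, multiplied by the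
determinant `cellDet`. -/
def cellNum (i j : S) : A :=
  F.cellDet y * y (Sum.inl (F.basis (Sum.inl i), F.basis.coord (Sum.inl j))) -
    ∑ β : F.Pos, y (Sum.inl (F.basis (Sum.inr β), F.basis.coord (Sum.inl j))) *
      ∑ γ : F.Pos, (F.block y).adjugate β γ *
        y (Sum.inl (F.basis (Sum.inl i), F.basis.coord (Sum.inr γ)))

variable {B : Type*} [CommRing B] (φ : A →+* B)

lemma map_block : (F.block y).map φ = F.block (φ ∘ y) := rfl

lemma map_cellDet : φ (F.cellDet y) = F.cellDet (φ ∘ y) := by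
  classical
  rw [cellDet, RingHom.map_det]
  rfl

lemma map_cellNum (i j : S) : φ (F.cellNum y i j) = F.cellNum (φ ∘ y) i j := by
  classical
  have h : ∀ β γ, φ ((F.block y).adjugate β γ) = (F.block (φ ∘ y)).adjugate β γ := by
    intro β γ
    rw [← map_block, ← RingHom.mapMatrix_apply, ← RingHom.map_adjugate]
    rfl
  simp only [cellNum, map_sub, map_mul, map_sum, map_cellDet, Function.comp_apply]
  congr 1
  refine Finset.sum_congr rfl fun β _ => ?_
  congr 1
  refine Finset.sum_congr rfl fun γ _ => ?_
  congr 1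
  convert! h β γ

end Cramer

lemma baseChange_map_lie [FiniteDimensional ℂ 𝔤] {a : 𝔤 ≃ₗ[ℂ] 𝔤} (ha : a ∈ adjGroup 𝔤) :
    (∀ x y, a.baseChange ℂ R 𝔤 𝔤 ⁅x, y⁆ = ⁅a.baseChange ℂ R 𝔤 𝔤 x, a.baseChange ℂ R 𝔤 𝔤 y⁆) := by
  intro x y
  induction x using TensorProduct.induction_on with
  | zero => simp
  | tmul r x =>
    induction y using TensorProduct.induction_on with
    | zero => simp
    | tmul s y =>
      simp [LieAlgebra.ExtendScalars.bracket_tmul, map_lie_of_mem_adjGroup ha]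
    | add y z hy hz => rw [lie_add, map_add, hy, hz, map_add, lie_add]
  | add y z hy hz => rw [add_lie, map_add, hy, hz, map_add, add_lie]

lemma repr_baseChange (a : 𝔤 ≃ₗ[ℂ] 𝔤) (j k : S ⊕ Φ) :
    (F.rb ℂ).repr (a.baseChange ℂ ℂ 𝔤 𝔤 (F.rb ℂ k)) j =
      coordC a (Sum.inl (F.basis k, F.basis.coord j)) := by
  simp [Module.Basis.baseChange_apply, coordC]

lemma sum_eq_sum_pos {M : Type*} [AddCommMonoid M] (f : Φ → M) (hf : ∀ α, ¬ 0 < F.deg α → f α = 0) :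
    ∑ α, f α = ∑ α : F.Pos, f α.1 := by
  rw [← Finset.sum_filter_of_ne (p := fun α => 0 < F.deg α) (fun α _ h => by
    by_contra h0
    exact h (hf α h0))]
  exact Finset.sum_subtype _ (by simp) f

lemma sum_pos_smul_mem (f : F.Pos → R) :
    ∑ β : F.Pos, f β • F.rb R (Sum.inr β.1) ∈ F.gr R (Set.Ioi 0) :=
  Submodule.sum_mem _ fun β _ => Submodule.smul_mem _ _ (F.rb_mem_gr β.2)

/-- For an element `a` of the adjoint group, `D = cellDet` and the adjugate of the block provide a
vector `x = D • ω i - n` of the Borel subalgebra which `a` maps to the opposite Borel subalgebra. The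
`j`-th Cartan coordinate of `a x` is `cellNum` and also an eigenvalue of `ad (a x)`, hence of
`ad x`, so it is one of the numbers `D * weight k i`. -/
lemma exists_cellNum_eq [FiniteDimensional ℂ 𝔤] {a : 𝔤 ≃ₗ[ℂ] 𝔤} (ha : a ∈ adjGroup 𝔤)
    (i j : S) :
    ∃ k, F.cellNum (coordC a) i j = F.weight k i * F.cellDet (coordC a) := by
  classical
  set D := F.cellDet (coordC a) with hDdef
  set M := F.block (coordC a) with hM
  let g := a.baseChange ℂ ℂ 𝔤 𝔤
  let v : F.Pos → ℂ := fun γ => coordC a (Sum.inl (F.basis (Sum.inl i), F.basis.coord (Sum.inr γ)))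
  let c : F.Pos → ℂ := fun β => ∑ γ, M.adjugate β γ * v γ
  let x : ℂ ⊗[ℂ] 𝔤 := D • F.rb ℂ (Sum.inl i) - ∑ β : F.Pos, c β • F.rb ℂ (Sum.inr β.1)
  have hgx : ∀ l, (F.rb ℂ).repr (g x) l =
      D * coordC a (Sum.inl (F.basis (Sum.inl i), F.basis.coord l)) -
        ∑ β : F.Pos, c β * coordC a (Sum.inl (F.basis (Sum.inr β.1), F.basis.coord l)) := by
    intro l
    simp only [x, map_sub, map_smul, map_sum, Finsupp.sub_apply, Finsupp.smul_apply,
      Finsupp.finsetSum_apply, smul_eq_mul, g, repr_baseChange]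
  -- the choice of `c` removes the components of `g x` along the positive roots
  have hMc : M.mulVec c = D • v := by
    have : c = M.adjugate.mulVec v := rfl
    rw [this, Matrix.mulVec_mulVec, Matrix.mul_adjugate, Matrix.smul_mulVec, Matrix.one_mulVec]
    congr 1
  have hlow : g x ∈ F.gr ℂ (Set.Iic 0) := by
    intro l hl
    rcases l with l | α
    · simp at hl
    · have hα : 0 < F.deg α := by simpa using hl
      rw [hgx]
      have h1 := congrFun hMc ⟨α, hα⟩
      simp only [Matrix.mulVec, dotProduct, Pi.smul_apply, smul_eq_mul] at h1
      rw [sub_eq_zero]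
      refine h1.symm.trans (Finset.sum_congr rfl fun β _ => ?_)
      rw [mul_comm]
      rfl
  have hup : x ∈ F.gr ℂ (Set.Ici 0) := by
    refine sub_mem (Submodule.smul_mem _ _ (F.rb_mem_gr (by simp))) ?_
    exact F.gr_mono (fun m hm => le_of_lt (Set.mem_Ioi.mp hm)) (F.sum_pos_smul_mem c)
  have hnum : (F.rb ℂ).repr (g x) (Sum.inl j) = F.cellNum (coordC a) i j := by
    rw [hgx, cellNum, sub_right_inj]
    refine Finset.sum_congr rfl fun β _ => ?_
    rw [mul_comm]
  -- the root `α j` reads off the `j`-th Cartan coordinate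
  have hev : F.ev (g x) (Sum.inr (F.simple j)) = F.cellNum (coordC a) i j := by
    rw [ev, Finset.sum_eq_single j]
    · simp [F.wt_simple_self, hnum]
    · intro k _ hk
      simp [F.wt_simple_of_ne j k hk]
    · simp
  obtain ⟨w, hw, hw'⟩ := F.exists_lie_eq_ev_smul hlow (Sum.inr (F.simple j))
  rw [hev] at hw'
  have hw2 : ⁅x, g.symm w⁆ = F.cellNum (coordC a) i j • g.symm w := by
    apply g.injective
    rw [baseChange_map_lie ha, map_smul, LinearEquiv.apply_symm_apply]
    exact hw'
  obtain ⟨k, hk⟩ := F.exists_eq_ev hup (by simpa using hw) hw2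
  refine ⟨k, hk.trans ?_⟩
  have hxi : ∀ l, (F.rb ℂ).repr x (Sum.inl l) = if i = l then D else 0 := by
    intro l
    simp only [x, map_sub, map_smul, map_sum, Finsupp.sub_apply, Finsupp.smul_apply,
      Finsupp.finsetSum_apply, Module.Basis.repr_self]
    simp [Finsupp.single_apply]
  rw [ev, Finset.sum_eq_single i]
  · rw [hxi, if_pos rfl, mul_comm]
    rfl
  · intro l _ hl
    rw [hxi, if_neg (Ne.symm hl), zero_mul]
  · simp

/-- The automorphism of the Cartan subalgebra determined by an element of the adjoint group is
trivial: along a polynomial curve one of finitely many polynomial relations holds at every point,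
hence one of them holds identically, and the identity shows which one. -/
lemma cellNum_eq [FiniteDimensional ℂ 𝔤] {a : 𝔤 ≃ₗ[ℂ] 𝔤} (ha : a ∈ adjGroup 𝔤) (i j : S) :
    F.cellNum (coordC a) i j = F.basis.repr (F.basis (Sum.inl i)) (Sum.inl j) *
      F.cellDet (coordC a) := by
  classical
  obtain ⟨γ, P, h1, h2, h3, h4⟩ := exists_curve ha
  have hev : ∀ s, (Polynomial.evalRingHom s) ∘ P = coordC (γ s) := fun s =>
    funext fun c => (h4 s c).symm
  let Q := ∏ k, (F.cellNum P i j - Polynomial.C (F.weight k i) * F.cellDet P)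
  have hN : ∀ s, (F.cellNum P i j).eval s = F.cellNum (coordC (γ s)) i j := fun s => by
    rw [← hev, ← map_cellNum]; rfl
  have hD : ∀ s, (F.cellDet P).eval s = F.cellDet (coordC (γ s)) := fun s => by
    rw [← hev, ← map_cellDet]; rfl
  have hcoord : ∀ k l : S ⊕ Φ, coordC (1 : 𝔤 ≃ₗ[ℂ] 𝔤) (Sum.inl (F.basis k, F.basis.coord l)) =
      if k = l then 1 else 0 := by
    intro k l
    simp [coordC, Finsupp.single_apply]
  have hblock : F.block (coordC (1 : 𝔤 ≃ₗ[ℂ] 𝔤)) = 1 := by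
    ext β δ
    rw [block, Matrix.of_apply, hcoord, Matrix.one_apply]
    simp [Subtype.ext_iff, eq_comm]
  have hD0 : F.cellDet (coordC (1 : 𝔤 ≃ₗ[ℂ] 𝔤)) = 1 := by
    rw [cellDet, hblock, Matrix.det_one]
  have hN0 : F.cellNum (coordC (1 : 𝔤 ≃ₗ[ℂ] 𝔤)) i j =
      F.basis.repr (F.basis (Sum.inl i)) (Sum.inl j) := by
    rw [cellNum, hD0, one_mul, hcoord]
    simp [hcoord, Finsupp.single_apply]
  have hQ : Q = 0 := by
    refine Polynomial.funext fun s => ?_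
    obtain ⟨k, hk⟩ := F.exists_cellNum_eq (h1 s) i j
    rw [Polynomial.eval_zero, Polynomial.eval_prod]
    refine Finset.prod_eq_zero (Finset.mem_univ k) ?_
    rw [Polynomial.eval_sub, Polynomial.eval_mul, Polynomial.eval_C, hN, hD, hk, sub_self]
  obtain ⟨k, -, hk⟩ := Finset.prod_eq_zero_iff.mp hQ
  have e0 := hN 0
  rw [sub_eq_zero.mp hk, Polynomial.eval_mul, Polynomial.eval_C, hD, h2, hD0, hN0, mul_one] at e0
  rw [← h3, ← hN, ← hD, sub_eq_zero.mp hk, Polynomial.eval_mul, Polynomial.eval_C, e0]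

lemma aeval_cellNum_sub (y : CoordIdx 𝔤 → R) (i j : S) (c : ℂ) :
    MvPolynomial.aeval y (F.cellNum MvPolynomial.X i j - MvPolynomial.C c *
      F.cellDet MvPolynomial.X) = F.cellNum y i j - algebraMap ℂ R c * F.cellDet y := by
  have e : ((MvPolynomial.aeval y : MvPolynomial (CoordIdx 𝔤) ℂ →ₐ[ℂ] R) :
      MvPolynomial (CoordIdx 𝔤) ℂ →+* R) ∘ MvPolynomial.X = y := funext fun c => by simp
  rw [map_sub, map_mul, MvPolynomial.aeval_C]
  congr 1
  · conv_rhs => rw [← e]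
    rw [← map_cellNum]; rfl
  · congr 1
    conv_rhs => rw [← e]
    rw [← map_cellDet]; rfl

/-- The polynomial equation `cellNum_eq` of the adjoint group holds at its `R`-points. -/
lemma cellNum_eq_of_mem_adjPoints [FiniteDimensional ℂ 𝔤]
    {g : (R ⊗[ℂ] 𝔤) ≃ₗ[R] (R ⊗[ℂ] 𝔤)} (hg : g ∈ adjPoints 𝔤 R) (i j : S) :
    F.cellNum (coord g) i j =
      algebraMap ℂ R (F.basis.repr (F.basis (Sum.inl i)) (Sum.inl j)) * F.cellDet (coord g) := by
  have hp : IsEquation (F.cellNum MvPolynomial.X i j - MvPolynomial.C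
        (F.basis.repr (F.basis (Sum.inl i)) (Sum.inl j)) * F.cellDet MvPolynomial.X) := by
    intro a ha
    rw [aeval_cellNum_sub, F.cellNum_eq ha, Algebra.algebraMap_self, RingHom.id_apply, sub_self]
  have := hg _ hp
  rw [aeval_cellNum_sub] at this
  exact sub_eq_zero.mp this

lemma isUnit_intCast_deg (α : Φ) : IsUnit ((F.deg α : ℤ) : R) := by
  have : IsUnit ((F.deg α : ℤ) : ℂ) := by
    rw [isUnit_iff_ne_zero]; exact_mod_cast F.deg_ne_zero α
  simpa using this.map (algebraMap ℂ R)

/-- A point of the adjoint group that preserves the Borel subalgebra also preserves the nilradical,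
which is the commutator of the Borel subalgebra. -/
lemma map_mem_gr_pos [FiniteDimensional ℂ 𝔤] {g : (R ⊗[ℂ] 𝔤) ≃ₗ[R] (R ⊗[ℂ] 𝔤)}
    (hg : g ∈ adjPoints 𝔤 R) (hb : ∀ x ∈ F.gr R (Set.Ici 0), g x ∈ F.gr R (Set.Ici 0))
    {x : R ⊗[ℂ] 𝔤} (hx : x ∈ F.gr R (Set.Ioi 0)) : g x ∈ F.gr R (Set.Ioi 0) := by
  rw [gr_eq_span] at hx
  induction hx using Submodule.span_induction with
  | zero => rw [map_zero]; exact zero_mem _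
  | add x y _ _ hx hy => rw [map_add]; exact add_mem hx hy
  | smul r x _ hx => rw [map_smul]; exact Submodule.smul_mem _ _ hx
  | mem x hx =>
    obtain ⟨k, hk, rfl⟩ := hx
    rcases k with i | β
    · simp at hk
    · obtain ⟨u, hu⟩ := F.isUnit_intCast_deg (R := R) β
      have e : F.rb R (Sum.inr β) = (↑u⁻¹ : R) • ⁅F.grading R, F.rb R (Sum.inr β)⁆ := by
        rw [grading_lie_rb, smul_smul, height_inr, ← hu, Units.inv_mul, one_smul]
      rw [e, map_smul, F.map_lie_of_mem_adjPoints hg]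
      refine Submodule.smul_mem _ _ (F.lie_mem_gr_pos (hb _ ?_) (hb _ ?_))
      · exact F.gr_mono (by simp) F.grading_mem
      · exact F.rb_mem_gr (Set.mem_Ici.mpr (le_of_lt hk))

/-- A point of the adjoint group that preserves the Borel subalgebra acts trivially on the
quotient of the Borel subalgebra by its nilradical. -/
lemma map_cartan_sub_mem [FiniteDimensional ℂ 𝔤] {g : (R ⊗[ℂ] 𝔤) ≃ₗ[R] (R ⊗[ℂ] 𝔤)}
    (hg : g ∈ adjPoints 𝔤 R) (hb : ∀ x ∈ F.gr R (Set.Ici 0), g x ∈ F.gr R (Set.Ici 0))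
    (hb' : ∀ x ∈ F.gr R (Set.Ici 0), g⁻¹ x ∈ F.gr R (Set.Ici 0)) (i : S) :
    g (F.rb R (Sum.inl i)) - F.rb R (Sum.inl i) ∈ F.gr R (Set.Ioi 0) := by
  classical
  have hc : ∀ (h : (R ⊗[ℂ] 𝔤) ≃ₗ[R] (R ⊗[ℂ] 𝔤)) (k l : S ⊕ Φ),
      coord h (Sum.inl (F.basis k, F.basis.coord l)) = (F.rb R).repr (h (F.rb R k)) l := by
    intro h k l
    rw [coord, Sum.elim_inl, baseChange_coord, Module.Basis.baseChange_apply]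
  -- `g` restricts to an automorphism of the nilradical, so that `cellDet` is invertible at `g`
  have hprod : F.block (coord g) * F.block (coord g⁻¹) = 1 := by
    ext β δ
    have e : g (g⁻¹ (F.rb R (Sum.inr δ.1))) = F.rb R (Sum.inr δ.1) := g.apply_symm_apply _
    have hn := F.map_mem_gr_pos (inv_mem hg) hb' (F.rb_mem_gr (R := R) (k := Sum.inr δ.1) δ.2)
    have e2 : (F.rb R).repr (g (g⁻¹ (F.rb R (Sum.inr δ.1)))) (Sum.inr β.1) =
        (F.rb R).repr (F.rb R (Sum.inr δ.1)) (Sum.inr β.1) := by rw [e]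
    rw [← (F.rb R).sum_repr (g⁻¹ (F.rb R (Sum.inr δ.1)))] at e2
    rw [Fintype.sum_sum_type, Finset.sum_eq_zero (s := (Finset.univ : Finset S))
      (fun i _ => by rw [hn (Sum.inl i) (by simp), zero_smul]), zero_add,
      F.sum_eq_sum_pos _ (fun α h => by rw [hn (Sum.inr α) (by simpa using h), zero_smul])] at e2
    simp only [map_sum, map_smul, Finsupp.finsetSum_apply, Finsupp.smul_apply, smul_eq_mul] at e2
    rw [Matrix.mul_apply, Matrix.one_apply]
    simp only [block, Matrix.of_apply, hc]
    refine (Finset.sum_congr rfl fun α _ => mul_comm _ _).trans (e2.trans ?_)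
    rw [Module.Basis.repr_self, Finsupp.single_apply]
    simp [Subtype.ext_iff, eq_comm]
  have hDu : IsUnit (F.cellDet (coord g)) := by
    have := congrArg Matrix.det hprod
    rw [Matrix.det_mul, Matrix.det_one] at this
    exact IsUnit.of_mul_eq_one _ (by convert! this)
  intro l hl
  rw [map_sub, Finsupp.sub_apply]
  rcases l with j | α
  -- as `g` preserves the nilradical, the correction terms in `cellNum` vanish
  · have h := F.cellNum_eq_of_mem_adjPoints hg i j
    have hz : ∀ β : F.Pos, (F.rb R).repr (g (F.rb R (Sum.inr β.1))) (Sum.inl j) = 0 := fun β =>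
      F.map_mem_gr_pos hg hb (F.rb_mem_gr (k := Sum.inr β.1) β.2) _ (by simp)
    rw [cellNum] at h
    simp only [hc, hz, zero_mul, Finset.sum_const_zero, sub_zero] at h
    rw [mul_comm] at h
    have h2 := hDu.mul_right_cancel h
    rw [h2, Module.Basis.repr_self, Module.Basis.repr_self]
    by_cases hij : i = j <;> simp [hij]
  · rw [hb _ (F.rb_mem_gr (by simp)) _ (by
      have := F.deg_ne_zero α
      simp only [height_inr, Set.mem_Ioi, Set.mem_Ici] at hl ⊢
      omega)]
    simp

end RootFrame

namespace RootFrame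

variable {𝔤 : Type*} [LieRing 𝔤] [LieAlgebra ℂ 𝔤] {S Φ : Type*} [Fintype S] [Fintype Φ]
  (F : RootFrame 𝔤 S Φ) {R : Type*} [CommRing R] [Algebra ℂ R]

/-! ### Root subgroups -/

/-- A bound for the generic heights. -/
def heightBound : ℕ := ∑ k, (F.height k).natAbs

lemma natAbs_height_le (k : S ⊕ Φ) : (F.height k).natAbs ≤ F.heightBound :=
  Finset.single_le_sum (f := fun k => (F.height k).natAbs) (fun _ _ => Nat.zero_le _)
    (Finset.mem_univ k)

/-- Powers of the adjoint action of a root vector shift the generic height. -/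
lemma height_of_ad_pow {α : Φ} {n : ℕ} {k l : S ⊕ Φ}
    (h : F.basis.repr ((LieAlgebra.ad ℂ 𝔤 (F.basis (Sum.inr α)) ^ n) (F.basis k)) l ≠ 0) :
    F.height l = F.height k + n * F.deg α := by
  classical
  induction n generalizing l with
  | zero =>
    by_cases hkl : k = l
    · simp [hkl]
    · simp [hkl] at h
  | succ n ih =>
    rw [pow_succ', Module.End.mul_apply, LieAlgebra.ad_apply,
      ← F.basis.sum_repr ((LieAlgebra.ad ℂ 𝔤 (F.basis (Sum.inr α)) ^ n) (F.basis k)), lie_sum,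
      map_sum, Finsupp.finsetSum_apply] at h
    obtain ⟨m, -, hm⟩ := Finset.exists_ne_zero_of_sum_ne_zero h
    rw [lie_smul, map_smul, Finsupp.smul_apply, smul_eq_mul] at hm
    rw [F.height_add (right_ne_zero_of_mul hm), ih (left_ne_zero_of_mul hm), height_inr]
    push_cast
    ring

/-- An exponent that kills the adjoint action of all root vectors. -/
def nilBound : ℕ := 2 * F.heightBound + 2

/-- The heights of two basis vectors differ by at most `2 * heightBound`, and `ad (e α)` shifts the
height by the non-zero integer `deg α`. -/
lemma ad_pow_nilBound (α : Φ) : LieAlgebra.ad ℂ 𝔤 (F.basis (Sum.inr α)) ^ F.nilBound = 0 := by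
  refine F.basis.ext fun k => F.basis.ext_elem fun l => ?_
  by_contra h
  have h1 := F.height_of_ad_pow (by simpa using h)
  have h2 := F.natAbs_height_le k
  have h3 := F.natAbs_height_le l
  have h4 := F.deg_ne_zero α
  rw [nilBound] at h1
  have h5 : (1 : ℤ) ≤ |F.deg α| := Int.one_le_abs h4
  have h6 : |F.height l - F.height k| = ((2 * F.heightBound + 2 : ℕ) : ℤ) * |F.deg α| := by
    rw [h1, add_sub_cancel_left, abs_mul, Nat.abs_cast]
  have h7 : |F.height l - F.height k| ≤ 2 * F.heightBound := by
    rw [abs_le]; omega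
  rw [h6] at h7
  push_cast at h7
  nlinarith

/-- The element `exp (r • ad (e α))` of the root subgroup of `α`. -/
def rootExp (α : Φ) (r : R) : (R ⊗[ℂ] 𝔤) ≃ₗ[R] (R ⊗[ℂ] 𝔤) :=
  expEquiv (r • (LieAlgebra.ad ℂ 𝔤 (F.basis (Sum.inr α))).baseChange R)
    (smul_baseChange_pow (F.ad_pow_nilBound α) r)

lemma rootExp_mem [FiniteDimensional ℂ 𝔤] (α : Φ) (r : R) : F.rootExp α r ∈ adjPoints 𝔤 R :=
  expEquiv_mem_adjPoints (F.ad_pow_nilBound α) r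

lemma smul_ad_baseChange (α : Φ) (r : R) :
    r • (LieAlgebra.ad ℂ 𝔤 (F.basis (Sum.inr α))).baseChange R =
      LieAlgebra.ad R (R ⊗[ℂ] 𝔤) (r • F.rb R (Sum.inr α)) := by
  have h : ∀ (r : R) (v w : R ⊗[ℂ] 𝔤), ⁅r • v, w⁆ = r • ⁅v, w⁆ := fun r v w => smul_lie r v w
  refine LinearMap.ext fun x => ?_
  rw [LieAlgebra.ad_apply, h, LinearMap.smul_apply]
  congr 1
  induction x using TensorProduct.induction_on with
  | zero => simp
  | tmul s x =>
    rw [Module.Basis.baseChange_apply, LieAlgebra.ExtendScalars.bracket_tmul, one_mul,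
      LinearMap.baseChange_tmul, LieAlgebra.ad_apply]
  | add x y hx hy => rw [map_add, lie_add, hx, hy]

lemma rootExp_apply (α : Φ) (r : R) (x : R ⊗[ℂ] 𝔤) :
    F.rootExp α r x = ∑ n ∈ Finset.range F.nilBound, algebraMap ℂ R ((n.factorial : ℂ)⁻¹) •
      (LieAlgebra.ad R (R ⊗[ℂ] 𝔤) (r • F.rb R (Sum.inr α)) ^ n) x := by
  rw [rootExp, expEquiv_apply, smul_ad_baseChange]

lemma rootExp_inv_apply (α : Φ) (r : R) (x : R ⊗[ℂ] 𝔤) :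
    (F.rootExp α r)⁻¹ x = F.rootExp α (-r) x := by
  rw [rootExp, rootExp, expEquiv_smul_inv_apply, expEquiv_apply]
  simp only [smul_pow, LinearMap.smul_apply]

lemma ad_pow_mem (α : Φ) (r : R) {m : ℤ} {x : R ⊗[ℂ] 𝔤} (hx : x ∈ F.gr R (Set.Iic m)) (n : ℕ) :
    (LieAlgebra.ad R (R ⊗[ℂ] 𝔤) (r • F.rb R (Sum.inr α)) ^ n) x ∈
      F.gr R (Set.Iic (m + n * F.deg α)) := by
  induction n with
  | zero => simpa using hx
  | succ n ih =>
    rw [pow_succ', Module.End.mul_apply, LieAlgebra.ad_apply]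
    refine F.lie_mem_gr (s := {F.deg α}) ?_ (Submodule.smul_mem _ _ (F.rb_mem_gr (by simp))) ih
    intro a ha c hc
    simp only [Set.mem_singleton_iff, Set.mem_Iic] at *
    push_cast
    subst ha
    linarith

/-- The second order expansion of the action of a root subgroup of a negative root. -/
lemma rootExp_sub_sub_mem {α : Φ} (hα : F.deg α < 0) (r : R) {m : ℤ} {x : R ⊗[ℂ] 𝔤}
    (hx : x ∈ F.gr R (Set.Iic m)) :
    F.rootExp α r x - x - r • ⁅F.rb R (Sum.inr α), x⁆ ∈ F.gr R (Set.Iic (m + 2 * F.deg α)) := by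
  have h : ∀ (r : R) (v w : R ⊗[ℂ] 𝔤), ⁅r • v, w⁆ = r • ⁅v, w⁆ := fun r v w => smul_lie r v w
  rw [rootExp_apply, nilBound, Finset.sum_range_succ', Finset.sum_range_succ']
  have e : ∀ a : R ⊗[ℂ] 𝔤, a + algebraMap ℂ R (((0 + 1).factorial : ℂ)⁻¹) •
      (LieAlgebra.ad R (R ⊗[ℂ] 𝔤) (r • F.rb R (Sum.inr α)) ^ (0 + 1)) x +
      algebraMap ℂ R ((Nat.factorial 0 : ℂ)⁻¹) •
      (LieAlgebra.ad R (R ⊗[ℂ] 𝔤) (r • F.rb R (Sum.inr α)) ^ 0) x - x -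
      r • ⁅F.rb R (Sum.inr α), x⁆ = a := by
    intro a
    simp
  rw [e]
  refine Submodule.sum_mem _ fun n _ => Submodule.smul_mem _ _ ?_
  refine F.gr_mono ?_ (F.ad_pow_mem α r hx (n + 1 + 1))
  intro a ha
  simp only [Set.mem_Iic] at *
  push_cast at ha
  nlinarith

lemma rootExp_mem_gr_neg {α : Φ} (hα : F.deg α < 0) (r : R) {x : R ⊗[ℂ] 𝔤}
    (hx : x ∈ F.gr R (Set.Iio 0)) : F.rootExp α r x ∈ F.gr R (Set.Iio 0) := by
  have e : Set.Iio (0 : ℤ) = Set.Iic (-1) := by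
    ext a; simp only [Set.mem_Iio, Set.mem_Iic]; omega
  rw [e] at hx ⊢
  rw [rootExp_apply]
  refine Submodule.sum_mem _ fun n _ => Submodule.smul_mem _ _ ?_
  refine F.gr_mono ?_ (F.ad_pow_mem α r hx n)
  intro a ha
  simp only [Set.mem_Iic] at *
  nlinarith

/-- Elements of the coset `grading + 𝔫⁻` of the opposite nilradical are conjugate to `grading`
under the opposite unipotent group: the components are removed one root at a time. -/
lemma exists_conj_grading [FiniteDimensional ℂ 𝔤] {x : R ⊗[ℂ] 𝔤}
    (hx : x - F.grading R ∈ F.gr R (Set.Iio 0)) :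
    ∃ u ∈ adjPoints 𝔤 R, (∀ y ∈ F.gr R (Set.Iio 0), u⁻¹ y ∈ F.gr R (Set.Iio 0)) ∧
      u x = F.grading R := by
  have h' : ∀ (r : R) (v w : R ⊗[ℂ] 𝔤), ⁅v, r • w⁆ = r • ⁅v, w⁆ := fun r v w => lie_smul r v w
  -- induction on the largest `n` such that `x - grading` has only components of height at most `-n`
  suffices H : ∀ (k : ℕ) (n : ℤ), 1 ≤ n → n + k = F.heightBound + 1 →
      ∀ x : R ⊗[ℂ] 𝔤, x - F.grading R ∈ F.gr R (Set.Iic (-n)) →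
      ∃ u ∈ adjPoints 𝔤 R, (∀ y ∈ F.gr R (Set.Iio 0), u⁻¹ y ∈ F.gr R (Set.Iio 0)) ∧
        u x = F.grading R by
    refine H F.heightBound 1 le_rfl (by ring) x (F.gr_mono ?_ hx)
    intro a ha
    simp only [Set.mem_Iio, Set.mem_Iic] at *
    omega
  intro k
  induction k with
  | zero =>
    intro n _ hn x hx
    refine ⟨1, one_mem _, fun y hy => by simpa using hy, ?_⟩
    have h0 : x - F.grading R = 0 := by
      refine (F.rb R).ext_elem fun k => ?_
      rw [hx k, map_zero, Finsupp.zero_apply]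
      have := F.natAbs_height_le k
      simp only [Set.mem_Iic]
      omega
    exact sub_eq_zero.mp h0
  | succ k ih =>
    intro n hn1 hn x hx
    by_cases hβ : ∃ β, F.deg β = -n
    · obtain ⟨β, hβ⟩ := hβ
      obtain ⟨d, hd⟩ := F.isUnit_intCast_deg (R := R) β
      set c := (F.rb R).repr (x - F.grading R) (Sum.inr β) with hc
      -- since `⁅e β, grading⁆ = -deg β • e β`, this parameter cancels the component along `e β`
      let r : R := c * (↑d⁻¹ : R)
      have hneg : F.deg β < 0 := by omega
      have hx0 : x ∈ F.gr R (Set.Iic 0) := by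
        rw [← sub_add_cancel x (F.grading R)]
        refine add_mem (F.gr_mono ?_ hx) (F.gr_mono (by simp) F.grading_mem)
        intro a ha
        simp only [Set.mem_Iic] at *
        omega
      have h1 := F.rootExp_sub_sub_mem hneg r hx0
      have h2 : r • ⁅F.rb R (Sum.inr β), F.grading R⁆ = -(c • F.rb R (Sum.inr β)) := by
        rw [← lie_skew, grading_lie_rb, smul_neg, smul_smul, height_inr, ← hd]
        simp [r]
      have h3 : ⁅F.rb R (Sum.inr β), x - F.grading R⁆ ∈ F.gr R (Set.Iic (-(n + 1))) := by
        refine F.lie_mem_gr (s := {F.deg β}) ?_ (F.rb_mem_gr (by simp)) hx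
        intro a ha b hb
        simp only [Set.mem_singleton_iff, Set.mem_Iic] at *
        omega
      have h4 : x - F.grading R - c • F.rb R (Sum.inr β) ∈ F.gr R (Set.Iic (-(n + 1))) := by
        classical
        intro l hl
        rw [map_sub, Finsupp.sub_apply, map_smul, Finsupp.smul_apply, Module.Basis.repr_self,
          Finsupp.single_apply]
        by_cases hlβ : Sum.inr β = l
        · rw [if_pos hlβ, ← hlβ, ← hc, smul_eq_mul, mul_one, sub_self]
        · rw [if_neg hlβ, smul_zero, sub_zero]
          refine hx l fun hl' => ?_
          simp only [Set.mem_Iic] at hl hl'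
          rcases l with i | γ
          · simp at hl'; omega
          · refine hlβ (congrArg Sum.inr (F.deg_injective ?_))
            simp only [height_inr] at hl hl'
            omega
      have h5 : F.rootExp β r x - F.grading R ∈ F.gr R (Set.Iic (-(n + 1))) := by
        have e : F.rootExp β r x - F.grading R =
            (F.rootExp β r x - x - r • ⁅F.rb R (Sum.inr β), x⁆) +
            r • ⁅F.rb R (Sum.inr β), x - F.grading R⁆ +
            (x - F.grading R - c • F.rb R (Sum.inr β)) := by
          rw [lie_sub, smul_sub, h2]
          abel
        rw [e]
        refine add_mem (add_mem (F.gr_mono ?_ h1) (Submodule.smul_mem _ _ h3)) h4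
        intro a ha
        simp only [Set.mem_Iic] at *
        omega
      obtain ⟨u, hu, hu', hux⟩ := ih (n + 1) (by omega) (by push_cast at hn; omega) _ h5
      refine ⟨u * F.rootExp β r, mul_mem hu (F.rootExp_mem β r), fun y hy => ?_, hux⟩
      rw [mul_inv_rev, LinearEquiv.mul_apply, rootExp_inv_apply]
      exact F.rootExp_mem_gr_neg hneg _ (hu' y hy)
    · refine ih (n + 1) (by omega) (by push_cast at hn; omega) x fun l hl => ?_
      refine hx l fun hl' => ?_
      simp only [Set.mem_Iic] at hl hl'
      rcases l with i | γ
      · simp at hl'; omega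
      · exact hβ ⟨γ, by simp only [height_inr] at hl hl'; omega⟩

/-! ### Simple reflections -/

/-- The exponential series of a vector killed by the third power of a root vector. -/
lemma rootExp_apply_of_sq (α : Φ) (r : R) {x : R ⊗[ℂ] 𝔤}
    (h : ⁅F.rb R (Sum.inr α), ⁅F.rb R (Sum.inr α), ⁅F.rb R (Sum.inr α), x⁆⁆⁆ = 0) :
    F.rootExp α r x = x + r • ⁅F.rb R (Sum.inr α), x⁆ +
      algebraMap ℂ R 2⁻¹ • r ^ 2 • ⁅F.rb R (Sum.inr α), ⁅F.rb R (Sum.inr α), x⁆⁆ := by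
  have hl : ∀ (r : R) (v w : R ⊗[ℂ] 𝔤), ⁅r • v, w⁆ = r • ⁅v, w⁆ := fun r v w => smul_lie r v w
  have hr : ∀ (r : R) (v w : R ⊗[ℂ] 𝔤), ⁅v, r • w⁆ = r • ⁅v, w⁆ := fun r v w => lie_smul r v w
  have h3 : (LieAlgebra.ad R (R ⊗[ℂ] 𝔤) (r • F.rb R (Sum.inr α)) ^ 3) x = 0 := by
    simp only [pow_succ, pow_zero, one_mul, Module.End.mul_apply, LieAlgebra.ad_apply, hl, hr, h,
      smul_zero]
  have hz : ∀ n, 3 ≤ n → (LieAlgebra.ad R (R ⊗[ℂ] 𝔤) (r • F.rb R (Sum.inr α)) ^ n) x = 0 := by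
    intro n hn
    obtain ⟨m, rfl⟩ := Nat.exists_eq_add_of_le' hn
    rw [pow_add, Module.End.mul_apply, h3, map_zero]
  have hlast : F.rootExp α r x = ∑ n ∈ Finset.range 3, algebraMap ℂ R ((n.factorial : ℂ)⁻¹) •
      (LieAlgebra.ad R (R ⊗[ℂ] 𝔤) (r • F.rb R (Sum.inr α)) ^ n) x := by
    have h0 : (LieAlgebra.ad R (R ⊗[ℂ] 𝔤) (r • F.rb R (Sum.inr α)) ^ F.nilBound) x = 0 := by
      rw [← smul_ad_baseChange, smul_baseChange_pow (F.ad_pow_nilBound α) r, LinearMap.zero_apply]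
    rw [rootExp_apply]
    rcases le_total 3 F.nilBound with hN | hN
    · refine (Finset.sum_subset (Finset.range_mono hN) fun n _ hn => ?_).symm
      rw [hz n (by simpa using hn), smul_zero]
    · refine Finset.sum_subset (Finset.range_mono hN) fun n _ hn => ?_
      obtain ⟨m, rfl⟩ := Nat.exists_eq_add_of_le' (n := n) (m := F.nilBound) (by simpa using hn)
      rw [pow_add, Module.End.mul_apply, h0, map_zero, smul_zero]
  rw [hlast]
  simp only [Finset.sum_range_succ, Finset.sum_range_zero, zero_add, pow_succ, pow_zero, one_mul,
    Module.End.mul_apply, Module.End.one_apply, LieAlgebra.ad_apply, hl, hr, smul_smul]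
  simp [-Module.Basis.baseChange_apply]

/-- The simple coroot, whose coordinates with respect to the fundamental coweights are `cor i`. -/
def coroot (R : Type*) [CommRing R] [Algebra ℂ R] (i : S) : R ⊗[ℂ] 𝔤 :=
  1 ⊗ₜ[ℂ] ∑ j, F.cor i j • F.basis (Sum.inl j)

lemma sum_cor_mul_wt_simple (i : S) : ∑ k, F.cor i k * F.wt (F.simple i) k = 2 := by
  rw [Finset.sum_eq_single i, F.wt_simple_self, mul_one, F.cor_self]
  · intro k _ hk
    rw [F.wt_simple_of_ne i k hk, mul_zero]
  · simp

lemma coroot_lie_inr (i : S) (β : Φ) : ⁅F.coroot ℂ i, F.rb ℂ (Sum.inr β)⁆ =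
    (∑ k, F.cor i k * F.wt β k) • F.rb ℂ (Sum.inr β) := by
  rw [coroot, Module.Basis.baseChange_apply, LieAlgebra.ExtendScalars.bracket_tmul, sum_lie,
    one_mul]
  simp only [smul_lie, lie_inl_inr, smul_smul, ← Finset.sum_smul]
  rw [TensorProduct.tmul_smul]

lemma refl_refl (i : S) (β : Φ) : F.refl i (F.refl i β) = β := by
  apply F.wt_injective
  rw [F.wt_refl, F.wt_refl]
  have : ∑ k, F.cor i k * (F.wt β - (∑ k, F.cor i k * F.wt β k) • F.wt (F.simple i)) k =
      -∑ k, F.cor i k * F.wt β k := by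
    simp only [Pi.sub_apply, Pi.smul_apply, smul_eq_mul, mul_sub, Finset.sum_sub_distrib]
    have e : ∑ x, F.cor i x * ((∑ k, F.cor i k * F.wt β k) * F.wt (F.simple i) x) =
        (∑ k, F.cor i k * F.wt β k) * ∑ x, F.cor i x * F.wt (F.simple i) x := by
      rw [Finset.mul_sum]
      exact Finset.sum_congr rfl fun x _ => by ring
    rw [e, sum_cor_mul_wt_simple]
    ring
  rw [this, neg_smul]
  abel

lemma refl_neg_simple (i : S) : F.refl i (F.neg (F.simple i)) = F.simple i := by
  apply F.wt_injective
  rw [F.wt_refl, F.wt_neg]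
  have : ∑ k, F.cor i k * (-F.wt (F.simple i)) k = -2 := by
    simp only [Pi.neg_apply, mul_neg, Finset.sum_neg_distrib, sum_cor_mul_wt_simple]
  rw [this]
  module

/-- The simple reflections lift to the adjoint group. -/
lemma exists_simple_reflection [FiniteDimensional ℂ 𝔤] (i : S) : ∃ θ ∈ adjPoints 𝔤 ℂ,
    ∀ j, θ (F.rb ℂ (Sum.inl j)) = F.rb ℂ (Sum.inl j) - F.wt (F.simple i) j • F.coroot ℂ i := by
  obtain ⟨c, hc⟩ := F.exists_lie_eq_cor i
  set e := F.rb ℂ (Sum.inr (F.simple i)) with he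
  set f' := F.rb ℂ (Sum.inr (F.neg (F.simple i))) with hf'
  have hlie : ∀ j (β : Φ), ⁅F.rb ℂ (Sum.inl j), F.rb ℂ (Sum.inr β)⁆ =
      F.wt β j • F.rb ℂ (Sum.inr β) := by
    intro j β
    rw [lie_rb, lie_inl_inr, TensorProduct.tmul_smul, Module.Basis.baseChange_apply]
  have hef : c • ⁅e, f'⁆ = F.coroot ℂ i := by
    rw [he, hf', lie_rb, ← TensorProduct.tmul_smul, ← lie_smul, hc]
    rfl
  have hHe : ⁅F.coroot ℂ i, e⁆ = (2 : ℂ) • e := by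
    rw [he, coroot_lie_inr, sum_cor_mul_wt_simple]
  have hHf : ⁅F.coroot ℂ i, f'⁆ = (-2 : ℂ) • f' := by
    rw [hf', coroot_lie_inr, F.wt_neg]
    simp only [Pi.neg_apply, mul_neg, Finset.sum_neg_distrib, sum_cor_mul_wt_simple]
  -- the usual representative `exp e * exp (-f) * exp e` in `SL₂`, where `f = c • f'`
  refine ⟨F.rootExp (F.simple i) 1 * F.rootExp (F.neg (F.simple i)) (-c) *
    F.rootExp (F.simple i) 1, mul_mem (mul_mem (F.rootExp_mem _ _) (F.rootExp_mem _ _))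
    (F.rootExp_mem _ _), fun j => ?_⟩
  set w := F.wt (F.simple i) j with hw
  set h := F.rb ℂ (Sum.inl j) with hh
  have heh : ⁅e, h⁆ = -(w • e) := by rw [← lie_skew, he, hh, hlie]
  have hfh : ⁅f', h⁆ = w • f' := by
    rw [← lie_skew, hf', hh, hlie, F.wt_neg, Pi.neg_apply, neg_smul, _root_.neg_neg]
  have hfe : c • ⁅f', e⁆ = -F.coroot ℂ i := by rw [← lie_skew, smul_neg, hef]
  have s1 : F.rootExp (F.simple i) (1 : ℂ) h = h - w • e := by
    rw [rootExp_apply_of_sq] <;> rw [← he]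
    · rw [heh]
      simp [sub_eq_add_neg]
    · rw [heh]
      simp
  have s1e : F.rootExp (F.simple i) (1 : ℂ) e = e := by
    rw [rootExp_apply_of_sq] <;> rw [← he] <;> simp
  have heH : ⁅e, F.coroot ℂ i⁆ = (-2 : ℂ) • e := by
    rw [← lie_skew, hHe]; module
  have hfH : ⁅f', F.coroot ℂ i⁆ = (2 : ℂ) • f' := by
    rw [← lie_skew, hHf]; module
  have s1H : F.rootExp (F.simple i) (1 : ℂ) (F.coroot ℂ i) = F.coroot ℂ i - (2 : ℂ) • e := by
    rw [rootExp_apply_of_sq] <;> rw [← he, heH]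
    · simp [sub_eq_add_neg]
    · simp
  have s2h : F.rootExp (F.neg (F.simple i)) (-c) h = h - (c * w) • f' := by
    rw [rootExp_apply_of_sq] <;> rw [← hf', hfh]
    · simp only [lie_smul, lie_self, smul_zero, add_zero]
      module
    · simp
  have hffe : c • ⁅f', ⁅f', e⁆⁆ = (-2 : ℂ) • f' := by
    rw [← lie_smul, hfe, lie_neg, hfH]; module
  have hc0 : c ≠ 0 := by
    rintro rfl
    rw [zero_smul] at hef
    rw [← hef, zero_lie] at hHe
    have h2 := congrArg (fun z => (F.rb ℂ).repr z (Sum.inr (F.simple i))) hHe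
    simp [he] at h2
  have s2e : F.rootExp (F.neg (F.simple i)) (-c) e = e + F.coroot ℂ i - c • f' := by
    rw [rootExp_apply_of_sq] <;> rw [← hf']
    · have e1 : (-c) • ⁅f', e⁆ = F.coroot ℂ i := by rw [neg_smul, hfe, _root_.neg_neg]
      have e2 : ((-c) ^ 2) • ⁅f', ⁅f', e⁆⁆ = (-2 * c) • f' := by
        rw [neg_sq, sq, mul_smul, hffe, smul_smul, mul_comm]
      rw [e1, e2, Algebra.algebraMap_self, RingHom.id_apply, smul_smul]
      have : (2 : ℂ)⁻¹ * (-2 * c) = -c := by ring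
      rw [this, neg_smul, sub_eq_add_neg]
    · have e3 : ⁅f', ⁅f', e⁆⁆ = (c⁻¹ * -2) • f' := by
        rw [mul_smul, ← hffe, smul_smul, inv_mul_cancel₀ hc0, one_smul]
      rw [e3, lie_smul, lie_self, smul_zero]
  rw [LinearEquiv.mul_apply, LinearEquiv.mul_apply, s1, map_sub, map_smul, s2h, s2e]
  have e4 : h - (c * w) • f' - w • (e + F.coroot ℂ i - c • f') = h - w • e - w • F.coroot ℂ i := by
    module
  rw [e4, map_sub, map_sub, map_smul, map_smul, s1, s1e, s1H]
  module

end RootFrame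

namespace RootFrame

variable {𝔤 : Type*} [LieRing 𝔤] [LieAlgebra ℂ 𝔤] {S Φ : Type*} [Fintype S] [Fintype Φ]
  (F : RootFrame 𝔤 S Φ) {R : Type*} [CommRing R] [Algebra ℂ R]
  {K : Type*} [Field K] [Algebra ℂ K]

/-! ### Subalgebras of the size of a Borel subalgebra -/

include F in
lemma kf_lie (x y z : R ⊗[ℂ] 𝔤) : kf R ⁅x, y⁆ z = kf R x ⁅y, z⁆ := by
  have : Module.Free ℂ 𝔤 := Module.Free.of_basis F.basis
  have : Module.Finite ℂ 𝔤 := Module.Finite.of_basis F.basis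
  have h2 : killingForm R (R ⊗[ℂ] 𝔤) = kf R := LieModule.traceForm_baseChange ℂ 𝔤 𝔤 R
  rw [← h2]
  exact LieModule.traceForm_apply_lie_apply R (R ⊗[ℂ] 𝔤) (R ⊗[ℂ] 𝔤) x y z

lemma height_add_eq_zero_of_kf {j k : S ⊕ Φ} (h : kf ℂ (F.rb ℂ j) (F.rb ℂ k) ≠ 0) :
    F.height j + F.height k = 0 := by
  have h1 := F.kf_lie (F.rb ℂ j) (F.grading ℂ) (F.rb ℂ k)
  rw [← lie_skew, grading_lie_rb, grading_lie_rb, map_neg, LinearMap.neg_apply, map_smul,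
    LinearMap.smul_apply, map_smul, smul_eq_mul, smul_eq_mul, ← neg_mul] at h1
  have h2 := mul_right_cancel₀ h h1
  have h3 : ((F.height j + F.height k : ℤ) : ℂ) = 0 := by push_cast; linear_combination -h2
  exact_mod_cast h3

lemma kf_eq_zero {s t : Set ℤ} (h : ∀ a ∈ s, ∀ b ∈ t, a + b ≠ 0) {x y : R ⊗[ℂ] 𝔤}
    (hx : x ∈ F.gr R s) (hy : y ∈ F.gr R t) : kf R x y = 0 := by
  have e : ∀ j k, kf R (F.rb R j) (F.rb R k) =
      algebraMap ℂ R (kf ℂ (F.rb ℂ j) (F.rb ℂ k)) := by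
    intro j k
    simp only [Module.Basis.baseChange_apply, kf_tmul]
    simp [Algebra.smul_def]
  rw [← (F.rb R).sum_repr x, ← (F.rb R).sum_repr y]
  simp only [map_sum, LinearMap.sum_apply, map_smul, LinearMap.smul_apply, Finset.smul_sum]
  refine Finset.sum_eq_zero fun k _ => Finset.sum_eq_zero fun j _ => ?_
  by_cases hj : F.height j ∈ s
  · by_cases hk : F.height k ∈ t
    · by_cases h0 : kf ℂ (F.rb ℂ j) (F.rb ℂ k) = 0
      · rw [e, h0, map_zero, smul_zero, smul_zero]
      · exact (h _ hj _ hk (F.height_add_eq_zero_of_kf h0)).elim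
    · rw [hy k hk, zero_smul]
  · rw [hx j hj, zero_smul, smul_zero]

lemma finrank_gr (s : Set ℤ) :
    Module.finrank K (F.gr K s) = Nat.card {k : S ⊕ Φ // F.height k ∈ s} := by
  classical
  have e : F.gr K s = Submodule.span K (Set.range fun k : {k : S ⊕ Φ // F.height k ∈ s} =>
      F.rb K k.1) := by
    rw [gr_eq_span]
    congr 1
    ext x
    simp [eq_comm]
  rw [e, finrank_span_eq_card, Nat.card_eq_fintype_card]
  exact (F.rb K).linearIndependent.comp _ Subtype.val_injective

/-- A vector splits off its component along a root vector of maximal height. -/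
lemma sub_smul_rb_mem {α : Φ} {x : R ⊗[ℂ] 𝔤} (hx : x ∈ F.gr R (Set.Iic (F.deg α))) :
    x - (F.rb R).repr x (Sum.inr α) • F.rb R (Sum.inr α) ∈ F.gr R (Set.Iio (F.deg α)) := by
  classical
  intro l hl
  rw [map_sub, Finsupp.sub_apply, map_smul, Finsupp.smul_apply, Module.Basis.repr_self,
    Finsupp.single_apply]
  by_cases hlα : Sum.inr α = l
  · rw [if_pos hlα, ← hlα, smul_eq_mul, mul_one, sub_self]
  · rw [if_neg hlα, smul_zero, sub_zero]
    refine hx l fun hl' => ?_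
    simp only [Set.mem_Iic, Set.mem_Iio] at hl hl'
    have := F.deg_ne_zero α
    rcases l with i | γ
    · simp only [height_inl] at hl hl'; omega
    · refine hlα (congrArg Sum.inr (F.deg_injective ?_))
      simp only [height_inr] at hl hl'
      omega

/-- The properties of the Borel subalgebras that survive the reduction modulo `t` of a lattice:
they are subalgebras of sufficiently large dimension all of whose commutators are isotropic for the
Killing form. -/
structure IsBorelLike (V : Submodule ℂ (ℂ ⊗[ℂ] 𝔤)) : Prop where
  lie_mem : ∀ x ∈ V, ∀ y ∈ V, ⁅x, y⁆ ∈ V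
  kf_lie_self : ∀ x ∈ V, ∀ y ∈ V, kf ℂ ⁅x, y⁆ ⁅x, y⁆ = 0
  card_le : Nat.card {k : S ⊕ Φ // F.height k ∈ Set.Ici 0} ≤ Module.finrank ℂ V

variable {F} {V : Submodule ℂ (ℂ ⊗[ℂ] 𝔤)}

lemma IsBorelLike.map [FiniteDimensional ℂ 𝔤] (hV : F.IsBorelLike V)
    {g : (ℂ ⊗[ℂ] 𝔤) ≃ₗ[ℂ] (ℂ ⊗[ℂ] 𝔤)} (hg : g ∈ adjPoints 𝔤 ℂ) :
    F.IsBorelLike (V.map g.toLinearMap) where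
  lie_mem := by
    rintro _ ⟨x, hx, rfl⟩ _ ⟨y, hy, rfl⟩
    exact ⟨⁅x, y⁆, hV.lie_mem x hx y hy, F.map_lie_of_mem_adjPoints hg x y⟩
  kf_lie_self := by
    rintro _ ⟨x, hx, rfl⟩ _ ⟨y, hy, rfl⟩
    have h := F.map_lie_of_mem_adjPoints hg x y
    change kf ℂ ⁅g x, g y⁆ ⁅g x, g y⁆ = 0
    rw [← h, F.kf_of_mem_adjPoints hg, hV.kf_lie_self x hx y hy]
  card_le := by
    rw [LinearEquiv.finrank_map_eq]
    exact hV.card_le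

variable (F V) in
/-- `α` is the root of maximal height that occurs in some element of `V`. -/
def IsLeading (α : Φ) : Prop :=
  ∃ x ∈ V, x ∈ F.gr ℂ (Set.Iic (F.deg α)) ∧ (F.rb ℂ).repr x (Sum.inr α) ≠ 0

/-- Opposite roots cannot both be leading: the commutator of two elements with opposite leading
terms has the Cartan component of `⁅e α, e (-α)⁆`, which is not isotropic. -/
lemma IsBorelLike.not_isLeading_neg (hV : F.IsBorelLike V) {α : Φ} (hα : F.IsLeading V α) :
    ¬ F.IsLeading V (F.neg α) := by
  rintro ⟨y, hyV, hy, hy0⟩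
  obtain ⟨x, hxV, hx, hx0⟩ := hα
  have h : ∀ (r : ℂ) (v w : ℂ ⊗[ℂ] 𝔤), ⁅r • v, w⁆ = r • ⁅v, w⁆ := fun r v w => smul_lie r v w
  have h' : ∀ (r : ℂ) (v w : ℂ ⊗[ℂ] 𝔤), ⁅v, r • w⁆ = r • ⁅v, w⁆ := fun r v w => lie_smul r v w
  set c := (F.rb ℂ).repr x (Sum.inr α)
  set d := (F.rb ℂ).repr y (Sum.inr (F.neg α))
  set e := F.rb ℂ (Sum.inr α) with he
  set f := F.rb ℂ (Sum.inr (F.neg α)) with hf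
  have h1 := F.sub_smul_rb_mem hx
  have h2 := F.sub_smul_rb_mem hy
  have hem : e ∈ F.gr ℂ {F.deg α} := F.rb_mem_gr (by simp)
  have hfm : f ∈ F.gr ℂ {-F.deg α} := F.rb_mem_gr (by simp [height_neg])
  rw [height_neg] at h2 hy
  have hz : ⁅x, y⁆ - (c * d) • ⁅e, f⁆ ∈ F.gr ℂ (Set.Iio 0) := by
    have e1 : ⁅x, y⁆ - (c * d) • ⁅e, f⁆ = ⁅x - c • e, y⁆ + c • ⁅e, y - d • f⁆ := by
      rw [sub_lie, lie_sub, h, h', smul_sub, smul_smul]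
      abel
    rw [e1]
    refine add_mem (F.lie_mem_gr ?_ h1 hy) (Submodule.smul_mem _ _ (F.lie_mem_gr ?_ hem h2))
    · intro a ha b hb
      simp only [Set.mem_Iio, Set.mem_Iic] at *
      omega
    · intro a ha b hb
      simp only [Set.mem_Iio, Set.mem_singleton_iff] at *
      omega
  have hef : ⁅e, f⁆ ∈ F.gr ℂ {0} := F.lie_mem_gr (by
    intro a ha b hb
    simp only [Set.mem_singleton_iff] at *
    omega) hem hfm
  have hxy : ⁅x, y⁆ ∈ F.gr ℂ (Set.Iic 0) := F.lie_mem_gr (by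
    intro a ha b hb
    simp only [Set.mem_Iic] at *
    omega) hx hy
  have k1 : kf ℂ (⁅x, y⁆ - (c * d) • ⁅e, f⁆) ⁅x, y⁆ = 0 := F.kf_eq_zero (by
    intro a ha b hb
    simp only [Set.mem_Iic, Set.mem_Iio] at *
    omega) hz hxy
  have k2 : kf ℂ ⁅e, f⁆ (⁅x, y⁆ - (c * d) • ⁅e, f⁆) = 0 := F.kf_eq_zero (by
    intro a ha b hb
    simp only [Set.mem_singleton_iff, Set.mem_Iio] at *
    omega) hef hz
  rw [map_sub, LinearMap.sub_apply, hV.kf_lie_self x hxV y hyV, map_smul, LinearMap.smul_apply,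
    zero_sub, neg_eq_zero, smul_eq_mul] at k1
  rw [map_sub, map_smul, smul_eq_mul] at k2
  have hcd : c * d ≠ 0 := mul_ne_zero hx0 hy0
  have k3 : kf ℂ ⁅e, f⁆ ⁅e, f⁆ ≠ 0 := by
    rw [he, hf, lie_rb, kf_tmul]
    simpa using F.killing_ne_zero α
  rw [(mul_eq_zero.mp k1).resolve_left hcd, zero_sub, neg_eq_zero] at k2
  exact mul_ne_zero hcd k3 k2

variable (F) in
/-- The coordinates of the Cartan component. -/
def cartanCoord : (ℂ ⊗[ℂ] 𝔤) →ₗ[ℂ] (S → ℂ) :=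
  LinearMap.pi fun i => (F.rb ℂ).coord (Sum.inl i)

variable (F V) in
/-- The Cartan components of the elements of `V` in the opposite Borel subalgebra. -/
def leadingCartan : Submodule ℂ (S → ℂ) := (V ⊓ F.gr ℂ (Set.Iic 0)).map F.cartanCoord

variable (V) in
open Classical in
/-- The leading terms determine an upper bound for the dimension. -/
lemma finrank_le_card_isLeading : Module.finrank ℂ V ≤
    Fintype.card {α // F.IsLeading V α} + Module.finrank ℂ (F.leadingCartan V) := by
  obtain ⟨ρ, hρ⟩ := (F.leadingCartan V).subtype.exists_leftInverse_of_injective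
    (Submodule.ker_subtype _)
  let T : V →ₗ[ℂ] ({α // F.IsLeading V α} → ℂ) × F.leadingCartan V :=
    ((LinearMap.pi fun α => (F.rb ℂ).coord (Sum.inr α.1)).prod (ρ ∘ₗ F.cartanCoord)) ∘ₗ V.subtype
  have hT : Function.Injective T := by
    rw [← LinearMap.ker_eq_bot, Submodule.eq_bot_iff]
    rintro ⟨x, hxV⟩ hx
    by_contra hne
    have hx1 : ∀ α : {α // F.IsLeading V α}, (F.rb ℂ).repr x (Sum.inr α.1) = 0 := fun α =>
      congrFun (congrArg Prod.fst (LinearMap.mem_ker.mp hx)) α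
    have hx2 : ρ (F.cartanCoord x) = 0 := congrArg Prod.snd (LinearMap.mem_ker.mp hx)
    let s := Finset.univ.filter fun k => (F.rb ℂ).repr x k ≠ 0
    have hs : s.Nonempty := by
      by_contra hs
      refine hne (Subtype.ext ((F.rb ℂ).ext_elem fun k => ?_))
      by_contra hk
      exact hs ⟨k, by simpa [s] using hk⟩
    obtain ⟨l, hl, hmax⟩ := s.exists_max_image F.height hs
    have hl0 : (F.rb ℂ).repr x l ≠ 0 := by simpa [s] using hl
    have hxl : x ∈ F.gr ℂ (Set.Iic (F.height l)) := by
      intro k hk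
      by_contra h0
      exact hk (hmax k (by simpa [s] using h0))
    rcases l with i | α
    · have h3 := LinearMap.congr_fun hρ ⟨F.cartanCoord x, x, ⟨hxV, hxl⟩, rfl⟩
      have h4 : ρ (F.cartanCoord x) = ⟨F.cartanCoord x, x, ⟨hxV, hxl⟩, rfl⟩ := h3
      rw [hx2] at h4
      exact hl0 (congrFun (congrArg Subtype.val h4) i).symm
    · exact hl0 (hx1 ⟨α, x, hxV, hxl, hl0⟩)
  refine (LinearMap.finrank_le_finrank_of_injective hT).trans (le_of_eq ?_)
  rw [Module.finrank_prod, Module.finrank_fintype_fun_eq_card]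

variable (F) in
open Classical in
lemma card_height_nonneg : Nat.card {k : S ⊕ Φ // F.height k ∈ Set.Ici 0} =
    Fintype.card S + Fintype.card F.Pos := by
  rw [Nat.card_eq_fintype_card, ← Fintype.card_sum]
  refine Fintype.card_congr (Equiv.subtypeSum.trans (Equiv.sumCongr ?_ ?_))
  · exact Equiv.subtypeUnivEquiv fun i => by simp
  · refine Equiv.subtypeEquivRight fun α => ?_
    have := F.deg_ne_zero α
    simp only [height_inr, Set.mem_Ici]
    omega

/-- At most one root of each pair of opposite roots is leading, so by the bound on the dimension
exactly one is, and every Cartan component occurs. -/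
lemma IsBorelLike.isLeading_or (hV : F.IsBorelLike V) :
    F.leadingCartan V = ⊤ ∧ ∀ β, F.IsLeading V β ∨ F.IsLeading V (F.neg β) := by
  classical
  let r : {α // F.IsLeading V α} → F.Pos := fun α => if h : 0 < F.deg α.1 then ⟨α.1, h⟩ else
    ⟨F.neg α.1, by have := F.deg_ne_zero α.1; rw [height_neg]; omega⟩
  have hr1 : ∀ α, (r α).1 = α.1 ∨ (r α).1 = F.neg α.1 := by
    intro α
    by_cases h : 0 < F.deg α.1 <;> simp [r, h]
  have hr : Function.Injective r := by
    intro α β h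
    have h' : (r α).1 = (r β).1 := congrArg Subtype.val h
    rcases hr1 α with h1 | h1 <;> rcases hr1 β with h2 | h2
    · exact Subtype.ext (by rw [← h1, ← h2, h'])
    · refine (hV.not_isLeading_neg β.2 ?_).elim
      rw [← h2, ← h', h1]; exact α.2
    · refine (hV.not_isLeading_neg α.2 ?_).elim
      rw [← h1, h', h2]; exact β.2
    · refine Subtype.ext ?_
      rw [← F.neg_neg α.1, ← h1, h', h2, F.neg_neg]
  have h1 := hV.card_le
  rw [card_height_nonneg] at h1
  have h2 := finrank_le_card_isLeading (F := F) V
  have h3 := Fintype.card_le_of_injective r hr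
  have h4 := (F.leadingCartan V).finrank_le
  rw [Module.finrank_fintype_fun_eq_card] at h4
  refine ⟨Submodule.eq_top_of_finrank_eq ?_, fun β => ?_⟩
  · rw [Module.finrank_fintype_fun_eq_card]; omega
  · have hsurj : Function.Surjective r :=
      ((Fintype.bijective_iff_injective_and_card r).mpr ⟨hr, by omega⟩).2
    have key : ∀ β : F.Pos, F.IsLeading V β.1 ∨ F.IsLeading V (F.neg β.1) := by
      intro β
      obtain ⟨α, rfl⟩ := hsurj β
      rcases hr1 α with h | h
      · left; rw [h]; exact α.2
      · right; rw [h, F.neg_neg]; exact α.2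
    by_cases hβ : 0 < F.deg β
    · exact key ⟨β, hβ⟩
    · have := key ⟨F.neg β, by have := F.deg_ne_zero β; rw [height_neg]; omega⟩
      rw [F.neg_neg] at this
      exact this.symm

/-- An element of `V` with leading term `grading` is conjugate to `grading` under the opposite
unipotent group. -/
lemma IsBorelLike.exists_grading_mem [FiniteDimensional ℂ 𝔤] (hV : F.IsBorelLike V) :
    ∃ u ∈ adjPoints 𝔤 ℂ, F.grading ℂ ∈ V.map u.toLinearMap := by
  have h : F.cartanCoord (F.grading ℂ) ∈ F.leadingCartan V := by
    rw [hV.isLeading_or.1]; trivial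
  obtain ⟨x, ⟨hxV, hx⟩, hx'⟩ := h
  have hx2 : x - F.grading ℂ ∈ F.gr ℂ (Set.Iio 0) := by
    intro k hk
    rw [map_sub, Finsupp.sub_apply]
    rcases k with i | α
    · exact sub_eq_zero.mpr (congrFun hx' i)
    · have := F.deg_ne_zero α
      rw [hx _ (by simp only [height_inr, Set.mem_Iio, Set.mem_Iic] at *; omega),
        F.grading_mem _ (by simpa using this), sub_zero]
  obtain ⟨u, hu, -, hux⟩ := F.exists_conj_grading hx2
  exact ⟨u, hu, x, hxV, hux⟩

section Graded

variable {W : Submodule K (K ⊗[ℂ] 𝔤)}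

lemma repr_aeval_grading (p : Polynomial K) (x : K ⊗[ℂ] 𝔤) (k : S ⊕ Φ) :
    (F.rb K).repr (Polynomial.aeval (LieAlgebra.ad K (K ⊗[ℂ] 𝔤) (F.grading K)) p x) k =
      p.eval ((F.height k : ℤ) : K) * (F.rb K).repr x k := by
  induction p using Polynomial.induction_on' with
  | add p q hp hq => rw [map_add, LinearMap.add_apply, map_add, Finsupp.add_apply, hp, hq,
      Polynomial.eval_add, add_mul]
  | monomial n a =>
    rw [Polynomial.aeval_monomial, Module.End.mul_apply, Module.algebraMap_end_apply, map_smul,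
      Finsupp.smul_apply, Polynomial.eval_monomial, smul_eq_mul, mul_assoc]
    congr 1
    induction n with
    | zero => simp
    | succ n ih => rw [pow_succ', Module.End.mul_apply, LieAlgebra.ad_apply, repr_grading_lie, ih,
        pow_succ', mul_assoc]

lemma aeval_grading_mem (hW : ∀ x ∈ W, ⁅F.grading K, x⁆ ∈ W) (p : Polynomial K)
    {x : K ⊗[ℂ] 𝔤} (hx : x ∈ W) :
    Polynomial.aeval (LieAlgebra.ad K (K ⊗[ℂ] 𝔤) (F.grading K)) p x ∈ W := by
  induction p using Polynomial.induction_on' with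
  | add p q hp hq => rw [map_add, LinearMap.add_apply]; exact add_mem hp hq
  | monomial n a =>
    rw [Polynomial.aeval_monomial, Module.End.mul_apply, Module.algebraMap_end_apply]
    refine Submodule.smul_mem _ _ ?_
    induction n with
    | zero => simpa using hx
    | succ n ih => rw [pow_succ', Module.End.mul_apply, LieAlgebra.ad_apply]; exact hW _ ih

/-- A subspace stable under the grading contains the homogeneous components of its elements. -/
lemma component_mem (hW : ∀ x ∈ W, ⁅F.grading K, x⁆ ∈ W) {x : K ⊗[ℂ] 𝔤} (hx : x ∈ W) (m : ℤ) :
    ∃ y ∈ W, ∀ k, (F.rb K).repr y k = if F.height k = m then (F.rb K).repr x k else 0 := by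
  classical
  have hchar : CharZero K := (RingHom.charZero_iff (algebraMap ℂ K).injective).mp inferInstance
  let A : Finset ℤ := (Finset.univ.image F.height).erase m
  let p : Polynomial K := ∏ a ∈ A, (Polynomial.X - Polynomial.C (a : K))
  have hp : p.eval (m : K) ≠ 0 := by
    rw [Polynomial.eval_prod, Finset.prod_ne_zero_iff]
    intro a ha
    rw [Polynomial.eval_sub, Polynomial.eval_X, Polynomial.eval_C, sub_ne_zero]
    exact_mod_cast (Finset.ne_of_mem_erase ha).symm
  refine ⟨(p.eval (m : K))⁻¹ • Polynomial.aeval (LieAlgebra.ad K (K ⊗[ℂ] 𝔤) (F.grading K)) p x,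
    Submodule.smul_mem _ _ (aeval_grading_mem hW p hx), fun k => ?_⟩
  rw [map_smul, Finsupp.smul_apply, repr_aeval_grading]
  split_ifs with h
  · rw [h, smul_eq_mul, inv_mul_cancel_left₀ hp]
  · have : p.eval ((F.height k : ℤ) : K) = 0 := by
      rw [Polynomial.eval_prod]
      exact Finset.prod_eq_zero (i := F.height k)
        (Finset.mem_erase.mpr ⟨h, Finset.mem_image_of_mem _ (Finset.mem_univ _)⟩) (by simp)
    rw [this, zero_mul, smul_zero]

/-- As distinct roots have distinct heights, a subspace stable under the grading contains the root
vectors that occur in its elements. -/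
lemma rb_mem_of_repr_ne_zero (hW : ∀ x ∈ W, ⁅F.grading K, x⁆ ∈ W) {x : K ⊗[ℂ] 𝔤} (hx : x ∈ W)
    {α : Φ} (h : (F.rb K).repr x (Sum.inr α) ≠ 0) : F.rb K (Sum.inr α) ∈ W := by
  classical
  obtain ⟨y, hy, hy'⟩ := component_mem hW hx (F.deg α)
  have e : F.rb K (Sum.inr α) = ((F.rb K).repr x (Sum.inr α))⁻¹ • y := by
    refine (F.rb K).ext_elem fun k => ?_
    rw [map_smul, Finsupp.smul_apply, hy', Module.Basis.repr_self, Finsupp.single_apply]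
    split_ifs with h1 h2 h2
    · subst h1; rw [smul_eq_mul, inv_mul_cancel₀ h]
    · subst h1; simp at h2
    · rcases k with i | β
      · exact (F.deg_ne_zero α (by simpa using h2.symm)).elim
      · exact (h1 (congrArg Sum.inr (F.deg_injective h2.symm))).elim
    · rw [smul_zero]
  rw [e]
  exact Submodule.smul_mem _ _ hy

end Graded

lemma IsBorelLike.rb_inl_mem (hV : F.IsBorelLike V) (hg : F.grading ℂ ∈ V) (i : S) :
    F.rb ℂ (Sum.inl i) ∈ V := by
  classical
  have h : F.cartanCoord (F.rb ℂ (Sum.inl i)) ∈ F.leadingCartan V := by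
    rw [hV.isLeading_or.1]; trivial
  obtain ⟨x, ⟨hxV, hx⟩, hx'⟩ := h
  obtain ⟨y, hy, hy'⟩ := component_mem (fun x hx => hV.lie_mem _ hg x hx) hxV 0
  have e : F.rb ℂ (Sum.inl i) = y := by
    refine (F.rb ℂ).ext_elem fun k => ?_
    rw [hy']
    rcases k with j | α
    · rw [if_pos (by simp)]
      exact (congrFun hx' j).symm
    · rw [if_neg (by simpa using F.deg_ne_zero α)]
      simp [-Module.Basis.baseChange_apply]
  rw [e]
  exact hy

lemma IsBorelLike.mem_or_neg_mem (hV : F.IsBorelLike V) (hg : F.grading ℂ ∈ V) (β : Φ) :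
    F.rb ℂ (Sum.inr β) ∈ V ∨ F.rb ℂ (Sum.inr (F.neg β)) ∈ V := by
  have key : ∀ β, F.IsLeading V β → F.rb ℂ (Sum.inr β) ∈ V := by
    rintro β ⟨x, hx, -, hx0⟩
    exact rb_mem_of_repr_ne_zero (fun x hx => hV.lie_mem _ hg x hx) hx hx0
  exact (hV.isLeading_or.2 β).imp (key _) (key _)

lemma IsBorelLike.neg_notMem (hV : F.IsBorelLike V) {β : Φ} (h : F.rb ℂ (Sum.inr β) ∈ V) :
    F.rb ℂ (Sum.inr (F.neg β)) ∉ V := by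
  have key : ∀ β, F.rb ℂ (Sum.inr β) ∈ V → F.IsLeading V β := fun β h =>
    ⟨_, h, F.rb_mem_gr (by simp), by rw [Module.Basis.repr_self]; simp⟩
  exact fun h' => hV.not_isLeading_neg (key _ h) (key _ h')

/-- The lift of a simple reflection permutes the root spaces. -/
lemma simple_reflection_rb [FiniteDimensional ℂ 𝔤] {i : S} {θ : (ℂ ⊗[ℂ] 𝔤) ≃ₗ[ℂ] (ℂ ⊗[ℂ] 𝔤)}
    (hθ : θ ∈ adjPoints 𝔤 ℂ) (h : ∀ j, θ (F.rb ℂ (Sum.inl j)) =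
      F.rb ℂ (Sum.inl j) - F.wt (F.simple i) j • F.coroot ℂ i) :
    (∀ j, θ (θ (F.rb ℂ (Sum.inl j))) = F.rb ℂ (Sum.inl j)) ∧
    ∀ β, ∃ c : ℂ, c ≠ 0 ∧ θ (F.rb ℂ (Sum.inr β)) = c • F.rb ℂ (Sum.inr (F.refl i β)) := by
  have hc : F.coroot ℂ i = ∑ j, F.cor i j • F.rb ℂ (Sum.inl j) := by
    rw [coroot, TensorProduct.tmul_sum]
    refine Finset.sum_congr rfl fun j _ => ?_
    rw [TensorProduct.tmul_smul, Module.Basis.baseChange_apply]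
  have hθc : θ (F.coroot ℂ i) = -F.coroot ℂ i := by
    conv_lhs => rw [hc]
    simp only [map_sum, map_smul, h, smul_sub, Finset.sum_sub_distrib, smul_smul]
    rw [← Finset.sum_smul, sum_cor_mul_wt_simple, ← hc]
    module
  have hθθ : ∀ j, θ (θ (F.rb ℂ (Sum.inl j))) = F.rb ℂ (Sum.inl j) := by
    intro j
    rw [h, map_sub, map_smul, hθc, h]
    module
  refine ⟨hθθ, fun β => ?_⟩
  have hsl : ∀ (r : ℂ) (v w : ℂ ⊗[ℂ] 𝔤), ⁅r • v, w⁆ = r • ⁅v, w⁆ := fun r v w => smul_lie r v w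
  have h1 : ∀ j, ⁅F.rb ℂ (Sum.inl j), θ (F.rb ℂ (Sum.inr β))⁆ =
      F.wt (F.refl i β) j • θ (F.rb ℂ (Sum.inr β)) := by
    intro j
    have e : ⁅θ (F.rb ℂ (Sum.inl j)), F.rb ℂ (Sum.inr β)⁆ =
        F.wt (F.refl i β) j • F.rb ℂ (Sum.inr β) := by
      rw [h, sub_lie, hsl, coroot_lie_inr, lie_rb, lie_inl_inr, TensorProduct.tmul_smul,
        ← Module.Basis.baseChange_apply, F.wt_refl, smul_smul, ← sub_smul]
      congr 1
      simp only [Pi.sub_apply, Pi.smul_apply, smul_eq_mul]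
      ring
    conv_lhs => rw [← hθθ j]
    rw [← F.map_lie_of_mem_adjPoints hθ, e, map_smul]
  have h2 : ∀ k, k ≠ Sum.inr (F.refl i β) → (F.rb ℂ).repr (θ (F.rb ℂ (Sum.inr β))) k = 0 := by
    intro k hk
    by_contra h0
    have h3 : F.weight k = F.wt (F.refl i β) := by
      funext j
      have := congrArg (fun z => (F.rb ℂ).repr z k) (h1 j)
      simp only [repr_lie_inl, map_smul, Finsupp.smul_apply, smul_eq_mul] at this
      exact mul_right_cancel₀ h0 this
    rcases k with j | γ
    · have h4 := F.deg_eq (F.refl i β)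
      rw [← h3] at h4
      simp only [weight_inl, Pi.zero_apply, mul_zero, Finset.sum_const_zero] at h4
      exact F.deg_ne_zero _ (by exact_mod_cast h4)
    · exact hk (congrArg Sum.inr (F.wt_injective h3))
  have h3 : θ (F.rb ℂ (Sum.inr β)) = (F.rb ℂ).repr (θ (F.rb ℂ (Sum.inr β)))
      (Sum.inr (F.refl i β)) • F.rb ℂ (Sum.inr (F.refl i β)) := by
    conv_lhs => rw [← (F.rb ℂ).sum_repr (θ (F.rb ℂ (Sum.inr β)))]
    refine Finset.sum_eq_single _ (fun k _ hk => ?_) (by simp)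
    rw [h2 k hk, zero_smul]
  refine ⟨_, fun h0 => ?_, h3⟩
  rw [h0, zero_smul] at h3
  exact (F.rb ℂ).ne_zero _ ((LinearEquiv.map_eq_zero_iff θ).mp h3)

/-- If `V` contains the simple root vectors, it contains no negative root vector: by induction on
the height, its bracket with a suitable simple root vector would be a negative root vector in `V` of
smaller absolute height, or a Cartan vector, in which case `V` contains opposite root vectors. -/
lemma IsBorelLike.neg_notMem_of_simple (hV : F.IsBorelLike V) (hg : F.grading ℂ ∈ V)
    (hs : ∀ i, F.rb ℂ (Sum.inr (F.simple i)) ∈ V) {β : Φ} (hβ : 0 < F.deg β) :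
    F.rb ℂ (Sum.inr (F.neg β)) ∉ V := by
  obtain ⟨n, hn⟩ : ∃ n : ℕ, F.deg β ≤ n := ⟨(F.deg β).toNat, by omega⟩
  induction n generalizing β with
  | zero => omega
  | succ n ih =>
    intro h
    obtain ⟨i, hi⟩ := F.exists_lie_simple_ne_zero β hβ
    have h1 := hV.lie_mem _ (hs i) _ h
    obtain ⟨l, hl⟩ : ∃ l, F.basis.repr ⁅F.basis (Sum.inr (F.simple i)),
        F.basis (Sum.inr (F.neg β))⁆ l ≠ 0 := by
      by_contra! hcon
      exact hi (F.basis.ext_elem fun l => by simpa using hcon l)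
    have hw := F.weight_add hl
    rw [weight_inr, weight_inr, F.wt_neg] at hw
    rcases l with j | γ
    · have : F.wt β = F.wt (F.simple i) := by
        rw [weight_inl] at hw
        exact (sub_eq_zero.mp (by rw [hw]; abel)).symm
      rw [F.wt_injective this] at h
      exact hV.neg_notMem (hs i) h
    · have hw' : F.wt (F.neg γ) = F.wt β - F.wt (F.simple i) := by
        rw [F.wt_neg, ← weight_inr, hw]; abel
      have hpos := F.deg_sub_simple_pos i β _ hβ hw'
      have hd := F.height_add hl
      simp only [height_inr, height_neg] at hd hpos
      have hsi := F.deg_simple_pos i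
      refine ih (β := F.neg γ) (by rw [height_neg]; exact hpos) (by rw [height_neg]; omega) ?_
      rw [F.neg_neg]
      refine rb_mem_of_repr_ne_zero (fun x hx => hV.lie_mem _ hg x hx) h1 ?_
      rwa [repr_lie_rb]

/-- A subalgebra with the properties of a Borel subalgebra is conjugate to one that meets the
opposite nilradical trivially. -/
lemma IsBorelLike.exists_map_disjoint [FiniteDimensional ℂ 𝔤] (hV : F.IsBorelLike V) :
    ∃ a ∈ adjPoints 𝔤 ℂ, ∀ x ∈ V, a x ∈ F.gr ℂ (Set.Iio 0) → x = 0 := by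
  classical
  -- induction on the number of roots that are not positive roots of `V`
  suffices H : ∀ (n : ℕ) (V : Submodule ℂ (ℂ ⊗[ℂ] 𝔤)), F.IsBorelLike V → F.grading ℂ ∈ V →
      Fintype.card Φ ≤ n +
        (Finset.univ.filter fun β => 0 < F.deg β ∧ F.rb ℂ (Sum.inr β) ∈ V).card →
      ∃ a ∈ adjPoints 𝔤 ℂ, ∀ x ∈ V, a x ∈ F.gr ℂ (Set.Iio 0) → x = 0 by
    obtain ⟨u, hu, hg⟩ := hV.exists_grading_mem
    obtain ⟨a, ha, h⟩ := H (Fintype.card Φ) _ (hV.map hu) hg (Nat.le_add_right _ _)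
    refine ⟨a * u, mul_mem ha hu, fun x hx hax => ?_⟩
    exact (LinearEquiv.map_eq_zero_iff u).mp (h (u x) (Submodule.mem_map_of_mem hx) hax)
  intro n
  induction n with
  | zero =>
    intro V hV hg hcard
    have hall : ∀ β, 0 < F.deg β := by
      intro β
      have h1 := Finset.eq_univ_of_card _ (le_antisymm (Finset.card_le_univ _)
        (by rwa [zero_add] at hcard))
      exact (Finset.mem_filter.mp (h1 ▸ Finset.mem_univ β)).2.1
    refine ⟨1, one_mem _, fun x _ hx => (F.rb ℂ).ext_elem fun k => ?_⟩
    rw [map_zero, Finsupp.zero_apply]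
    refine hx k ?_
    rcases k with i | α
    · simp
    · have := hall α
      simp only [height_inr, Set.mem_Iio]
      omega
  | succ n ih =>
    intro V hV hg hcard
    by_cases hs : ∀ i, F.rb ℂ (Sum.inr (F.simple i)) ∈ V
    · refine ⟨1, one_mem _, fun x hxV hx => (F.rb ℂ).ext_elem fun k => ?_⟩
      by_contra h0
      rcases k with i | α
      · exact h0 (hx _ (by simp))
      · have hα : F.deg α < 0 := by
          by_contra h1
          exact h0 (hx _ (by simpa using h1))
        refine hV.neg_notMem_of_simple hg hs (β := F.neg α) (by rw [height_neg]; omega) ?_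
        rw [F.neg_neg]
        exact rb_mem_of_repr_ne_zero (fun x hx => hV.lie_mem _ hg x hx) hxV h0
    · push Not at hs
      obtain ⟨i, hi⟩ := hs
      -- a simple reflection for a simple root vector outside `V` permutes the other positive roots and
      -- adds the simple root, so it increases the number of positive roots of `V`
      obtain ⟨θ, hθ, hθh⟩ := F.exists_simple_reflection i
      obtain ⟨hθθ, hθr⟩ := simple_reflection_rb hθ hθh
      have hinl := hV.rb_inl_mem hg
      have hc : F.coroot ℂ i ∈ V := by
        rw [coroot, TensorProduct.tmul_sum]
        refine Submodule.sum_mem _ fun j _ => ?_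
        rw [TensorProduct.tmul_smul, ← Module.Basis.baseChange_apply]
        exact Submodule.smul_mem _ _ (hinl j)
      have hg' : F.grading ℂ ∈ V.map θ.toLinearMap := by
        refine Submodule.sum_mem _ fun j _ => Submodule.smul_mem _ _ ?_
        refine ⟨θ (F.rb ℂ (Sum.inl j)), ?_, hθθ j⟩
        rw [hθh]
        exact sub_mem (hinl j) (Submodule.smul_mem _ _ hc)
      have hmem : ∀ β, F.rb ℂ (Sum.inr β) ∈ V →
          F.rb ℂ (Sum.inr (F.refl i β)) ∈ V.map θ.toLinearMap := by
        intro β hβ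
        obtain ⟨c, hc0, hcβ⟩ := hθr β
        refine ⟨c⁻¹ • F.rb ℂ (Sum.inr β), Submodule.smul_mem _ _ hβ, ?_⟩
        change θ (c⁻¹ • F.rb ℂ (Sum.inr β)) = _
        rw [map_smul, hcβ, smul_smul, inv_mul_cancel₀ hc0, one_smul]
      obtain ⟨a, ha, h⟩ := ih _ (hV.map hθ) hg' (by
        set A := Finset.univ.filter fun β => 0 < F.deg β ∧ F.rb ℂ (Sum.inr β) ∈ V with hA
        have hni : F.simple i ∉ A.image (F.refl i) := by
          intro hmemi
          obtain ⟨β, hβ, hβi⟩ := Finset.mem_image.mp hmemi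
          have : β = F.neg (F.simple i) := by
            rw [← F.refl_refl i β, hβi, ← F.refl_neg_simple i, F.refl_refl, F.refl_neg_simple]
          have h1 := (Finset.mem_filter.mp hβ).2.1
          rw [this, height_neg] at h1
          have := F.deg_simple_pos i
          omega
        have hsub : insert (F.simple i) (A.image (F.refl i)) ⊆ Finset.univ.filter fun β =>
            0 < F.deg β ∧ F.rb ℂ (Sum.inr β) ∈ V.map θ.toLinearMap := by
          intro γ hγ
          rw [Finset.mem_filter]
          refine ⟨Finset.mem_univ _, ?_⟩
          rcases Finset.mem_insert.mp hγ with rfl | hγ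
          · refine ⟨F.deg_simple_pos i, ?_⟩
            rw [← F.refl_neg_simple i]
            exact hmem _ ((hV.mem_or_neg_mem hg (F.simple i)).resolve_left hi)
          · obtain ⟨β, hβ, rfl⟩ := Finset.mem_image.mp hγ
            obtain ⟨-, hβ1, hβ2⟩ := Finset.mem_filter.mp hβ
            refine ⟨F.deg_refl_pos i β hβ1 ?_, hmem _ hβ2⟩
            rintro rfl
            exact hi hβ2
        have h1 := Finset.card_le_card hsub
        rw [Finset.card_insert_of_notMem hni, Finset.card_image_of_injective _
          (Function.LeftInverse.injective (F.refl_refl i))] at h1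
        omega)
      refine ⟨a * θ, mul_mem ha hθ, fun x hx hax => ?_⟩
      exact (LinearEquiv.map_eq_zero_iff θ).mp (h (θ x) (Submodule.mem_map_of_mem hx) hax)

end RootFrame

namespace RootFrame

variable {𝔤 : Type*} [LieRing 𝔤] [LieAlgebra ℂ 𝔤] {S Φ : Type*} [Fintype S] [Fintype Φ]
  (F : RootFrame 𝔤 S Φ) {R : Type*} [CommRing R] [Algebra ℂ R]
  {R' : Type*} [CommRing R'] [Algebra ℂ R']

/-! ### Extension of scalars in coordinates -/

lemma repr_extVec (j : R →ₐ[ℂ] R') (x : R ⊗[ℂ] 𝔤) (k : S ⊕ Φ) :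
    (F.rb R').repr (extVec j x) k = j ((F.rb R).repr x k) := by
  induction x using TensorProduct.induction_on with
  | zero => simp
  | tmul r x => simp [Module.Basis.baseChange_repr_tmul]
  | add x y hx hy => simp only [map_add, Finsupp.add_apply, hx, hy]

lemma extVec_rb (j : R →ₐ[ℂ] R') (k : S ⊕ Φ) : extVec j (F.rb R k) = F.rb R' k := by
  simp [Module.Basis.baseChange_apply]

lemma extVec_mem_gr (j : R →ₐ[ℂ] R') {s : Set ℤ} {x : R ⊗[ℂ] 𝔤} (hx : x ∈ F.gr R s) :
    extVec j x ∈ F.gr R' s := fun k hk => by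
  rw [repr_extVec, hx k hk, map_zero]

/-- The filtration is compatible with injective extensions of scalars. -/
lemma mem_gr_of_extVec_mem {j : R →ₐ[ℂ] R'} (hj : Function.Injective j) {s : Set ℤ}
    {x : R ⊗[ℂ] 𝔤} (hx : extVec j x ∈ F.gr R' s) : x ∈ F.gr R s := fun k hk => by
  apply hj
  rw [map_zero, ← F.repr_extVec, hx k hk]

include F in
lemma extVec_injective {j : R →ₐ[ℂ] R'} (hj : Function.Injective j) :
    Function.Injective (extVec (𝔤 := 𝔤) j) := fun x y h => by
  refine (F.rb R).ext_elem fun k => hj ?_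
  rw [← F.repr_extVec, ← F.repr_extVec, h]

end RootFrame

section ExtVec

variable {𝔤 : Type*} [LieRing 𝔤] [LieAlgebra ℂ 𝔤] {R : Type*} [CommRing R] [Algebra ℂ R]
  {R' : Type*} [CommRing R'] [Algebra ℂ R'] {R'' : Type*} [CommRing R''] [Algebra ℂ R'']

lemma extVec_lie (j : R →ₐ[ℂ] R') (x y : R ⊗[ℂ] 𝔤) :
    extVec j ⁅x, y⁆ = ⁅extVec j x, extVec j y⁆ :=
  LieHom.map_lie (LieAlgebra.ExtendScalars.map j (LieHom.id : 𝔤 →ₗ⁅ℂ⁆ 𝔤)) x y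

lemma kf_extVec (j : R →ₐ[ℂ] R') (x y : R ⊗[ℂ] 𝔤) :
    RootFrame.kf R' (extVec j x) (extVec j y) = j (RootFrame.kf R x y) := by
  induction x using TensorProduct.induction_on with
  | zero => simp
  | tmul r x =>
    induction y using TensorProduct.induction_on with
    | zero => simp
    | tmul s y => simp
    | add y z hy hz => simp only [map_add, hy, hz]
  | add x z hx hz => simp only [map_add, LinearMap.add_apply, hx, hz]

lemma extVec_extVec (j : R →ₐ[ℂ] R') (j' : R' →ₐ[ℂ] R'') (x : R ⊗[ℂ] 𝔤) :
    extVec j' (extVec j x) = extVec (j'.comp j) x := by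
  induction x using TensorProduct.induction_on with
  | zero => simp
  | tmul r x => simp
  | add x y hx hy => simp only [map_add, hx, hy]

lemma extVec_id (x : R ⊗[ℂ] 𝔤) : extVec (AlgHom.id ℂ R) x = x := by
  induction x using TensorProduct.induction_on with
  | zero => simp
  | tmul r x => simp
  | add x y hx hy => simp only [map_add, hx, hy]

lemma extGL_mul (j : R →ₐ[ℂ] R') (g h : (R ⊗[ℂ] 𝔤) ≃ₗ[R] (R ⊗[ℂ] 𝔤)) :
    extGL j (g * h) = extGL j g * extGL j h := by
  refine LinearEquiv.ext fun x => ?_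
  induction x using TensorProduct.induction_on with
  | zero => simp
  | tmul s x =>
    rw [extGL_tmul, LinearEquiv.mul_apply, LinearEquiv.mul_apply, extGL_tmul, map_smul,
      extGL_extVec]
  | add x y hx hy => rw [map_add, hx, hy, map_add]

/-- An element of `GL(𝔤)` that is extended along `ℂ → R` specializes to itself. -/
lemma extGL_extGL_ofId (ε : R →ₐ[ℂ] ℂ) (a : (ℂ ⊗[ℂ] 𝔤) ≃ₗ[ℂ] (ℂ ⊗[ℂ] 𝔤)) :
    extGL ε (extGL (Algebra.ofId ℂ R) a) = a := by
  have e : ε.comp (Algebra.ofId ℂ R) = AlgHom.id ℂ ℂ := Subsingleton.elim _ _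
  refine LinearEquiv.ext fun x => ?_
  induction x using TensorProduct.induction_on with
  | zero => simp
  | tmul s x =>
    rw [extGL_tmul, extGL_tmul, one_smul, extVec_extVec, e, extVec_id, ← map_smul,
      TensorProduct.smul_tmul', smul_eq_mul, mul_one]
  | add x y hx hy => rw [map_add, hx, hy, map_add]

/-- The specialization `t = 0`. -/
def evalZero : ℂ⟦X⟧ →ₐ[ℂ] ℂ :=
  { PowerSeries.constantCoeff (R := ℂ) with
    commutes' := fun r => by
      change PowerSeries.constantCoeff (algebraMap ℂ ℂ⟦X⟧ r) = r
      rw [PowerSeries.algebraMap_apply]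
      simp }

lemma evalZero_apply (p : ℂ⟦X⟧) : evalZero p = PowerSeries.constantCoeff p := rfl

lemma toLaurent_injective : Function.Injective toLaurent := HahnSeries.ofPowerSeries_injective

lemma coeff_toLaurent (p : ℂ⟦X⟧) (n : ℕ) : (toLaurent p).coeff n = PowerSeries.coeff n p :=
  LaurentSeries.coeff_coe_powerSeries p n

lemma coeff_toLaurent_of_neg (p : ℂ⟦X⟧) {n : ℤ} (hn : n < 0) : (toLaurent p).coeff n = 0 := by
  rw [toLaurent_apply, PowerSeries.coeff_coe, if_pos hn]

lemma exists_toLaurent_eq {a : ℂ⸨X⸩} (h : ∀ n < 0, a.coeff n = 0) : ∃ p, toLaurent p = a := by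
  refine ⟨PowerSeries.mk fun n => a.coeff n, ?_⟩
  ext n
  rcases lt_or_ge n 0 with hn | hn
  · rw [coeff_toLaurent_of_neg _ hn, h n hn]
  · obtain ⟨m, rfl⟩ := Int.eq_ofNat_of_zero_le hn
    rw [coeff_toLaurent, PowerSeries.coeff_mk]

end ExtVec

namespace RootFrame

variable {𝔤 : Type*} [LieRing 𝔤] [LieAlgebra ℂ 𝔤] {S Φ : Type*} [Fintype S] [Fintype Φ]
  (F : RootFrame 𝔤 S Φ)

/-- Vectors of `𝔤((t))` without coefficients of negative index lie in `𝔤[[t]]`. -/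
lemma exists_extVec_eq {x : ℂ⸨X⸩ ⊗[ℂ] 𝔤}
    (h : ∀ k, ∀ n < 0, ((F.rb ℂ⸨X⸩).repr x k).coeff n = 0) :
    ∃ y : ℂ⟦X⟧ ⊗[ℂ] 𝔤, extVec toLaurent y = x := by
  choose p hp using fun k => exists_toLaurent_eq (h k)
  refine ⟨∑ k, p k • F.rb ℂ⟦X⟧ k, ?_⟩
  rw [map_sum, ← (F.rb ℂ⸨X⸩).sum_repr x]
  refine Finset.sum_congr rfl fun k _ => ?_
  rw [extVec_smul, hp, extVec_rb]

include F in
/-- A non-zero vector of `𝔤((t))` is the product of a power of `t` and a vector of `𝔤[[t]]` with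
non-zero constant term. -/
lemma exists_primitive {x : ℂ⸨X⸩ ⊗[ℂ] 𝔤} (hx : x ≠ 0) : ∃ (n : ℤ) (y : ℂ⟦X⟧ ⊗[ℂ] 𝔤),
    extVec toLaurent y = (HahnSeries.single n (1 : ℂ) : ℂ⸨X⸩) • x ∧ extVec evalZero y ≠ 0 := by
  classical
  let s := Finset.univ.filter fun k => (F.rb ℂ⸨X⸩).repr x k ≠ 0
  have hs : s.Nonempty := by
    by_contra hs
    refine hx ((F.rb ℂ⸨X⸩).ext_elem fun k => ?_)
    by_contra hk
    exact hs ⟨k, by simpa [s] using hk⟩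
  obtain ⟨l, hl, hmin⟩ := s.exists_min_image (fun k => ((F.rb ℂ⸨X⸩).repr x k).order) hs
  set m := ((F.rb ℂ⸨X⸩).repr x l).order with hm
  have hl0 : (F.rb ℂ⸨X⸩).repr x l ≠ 0 := by simpa [s] using hl
  have hc : ∀ k (n : ℤ), ((F.rb ℂ⸨X⸩).repr ((HahnSeries.single (-m) (1 : ℂ) : ℂ⸨X⸩) • x) k).coeff n
      = ((F.rb ℂ⸨X⸩).repr x k).coeff (n + m) := by
    intro k n
    rw [map_smul, Finsupp.smul_apply, smul_eq_mul, HahnSeries.coeff_single_mul, one_mul,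
      sub_neg_eq_add]
  obtain ⟨y, hy⟩ := F.exists_extVec_eq
      (x := (HahnSeries.single (-m) (1 : ℂ) : ℂ⸨X⸩) • x) (by
    intro k n hn
    rw [hc]
    by_cases hk : (F.rb ℂ⸨X⸩).repr x k = 0
    · rw [hk]; rfl
    · refine HahnSeries.coeff_eq_zero_of_lt_order ?_
      have := hmin k (by simpa [s] using hk)
      omega)
  refine ⟨-m, y, hy, fun h0 => ?_⟩
  have h1 := F.repr_extVec evalZero y l
  rw [h0, map_zero, Finsupp.zero_apply, evalZero_apply, ← PowerSeries.coeff_zero_eq_constantCoeff,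
    ← coeff_toLaurent, ← repr_extVec, hy, hc] at h1
  simp only [Nat.cast_zero, zero_add] at h1
  rw [hm] at h1
  exact (HahnSeries.coeff_order_eq_zero.not.mpr hl0) h1.symm

variable {F}

/-! ### Reduction modulo `t` of a lattice -/

/-- The reduction modulo `t` of the intersection of `M` with the lattice `𝔤[[t]]`. -/
def reduction (M : Submodule ℂ⸨X⸩ (ℂ⸨X⸩ ⊗[ℂ] 𝔤)) : Submodule ℂ (ℂ ⊗[ℂ] 𝔤) where
  carrier := {x | ∃ y : ℂ⟦X⟧ ⊗[ℂ] 𝔤, extVec toLaurent y ∈ M ∧ extVec evalZero y = x}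
  zero_mem' := ⟨0, by simp, by simp⟩
  add_mem' := by
    rintro _ _ ⟨y, hy, rfl⟩ ⟨z, hz, rfl⟩
    exact ⟨y + z, by rw [map_add]; exact add_mem hy hz, by rw [map_add]⟩
  smul_mem' := by
    rintro c _ ⟨y, hy, rfl⟩
    refine ⟨algebraMap ℂ ℂ⟦X⟧ c • y, ?_, ?_⟩
    · rw [extVec_smul]; exact Submodule.smul_mem _ _ hy
    · rw [extVec_smul, AlgHom.commutes]; rfl

/-- A subspace on which `r` linear forms have no common zero except `0` has dimension at most `r`. -/
lemma finrank_le_of_forall {K : Type*} [Field K] [Algebra ℂ K] (M : Submodule K (K ⊗[ℂ] 𝔤))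
    {r : ℕ} (c : Fin r → S ⊕ Φ → ℂ)
    (h : ∀ x ∈ M, (∀ i, ∑ k, algebraMap ℂ K (c i k) * (F.rb K).repr x k = 0) → x = 0) :
    Module.finrank K M ≤ r := by
  have : Module.Finite K (K ⊗[ℂ] 𝔤) := Module.Finite.of_basis (F.rb K)
  let T : M →ₗ[K] (Fin r → K) :=
    (LinearMap.pi fun i => ∑ k, algebraMap ℂ K (c i k) • (F.rb K).coord k) ∘ₗ M.subtype
  have hT : Function.Injective T := by
    rw [← LinearMap.ker_eq_bot, Submodule.eq_bot_iff]
    rintro ⟨x, hxM⟩ hx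
    refine Subtype.ext (h x hxM fun i => ?_)
    have := congrFun (LinearMap.mem_ker.mp hx) i
    simpa only [T, LinearMap.comp_apply, LinearMap.pi_apply, LinearMap.sum_apply,
      LinearMap.smul_apply, Module.Basis.coord_apply, smul_eq_mul, Submodule.subtype_apply,
      Pi.zero_apply] using this
  refine (LinearMap.finrank_le_finrank_of_injective hT).trans (le_of_eq ?_)
  rw [Module.finrank_fintype_fun_eq_card, Fintype.card_fin]

variable (F) in
include F in
/-- The reduction does not lower the dimension (in fact it preserves it). -/
lemma finrank_le_finrank_reduction (M : Submodule ℂ⸨X⸩ (ℂ⸨X⸩ ⊗[ℂ] 𝔤)) :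
    Module.finrank ℂ⸨X⸩ M ≤ Module.finrank ℂ (reduction M) := by
  have : Module.Finite ℂ (ℂ ⊗[ℂ] 𝔤) := Module.Finite.of_basis (F.rb ℂ)
  let W := reduction M
  let e := Module.finBasis ℂ W
  obtain ⟨ρ, hρ⟩ := W.subtype.exists_leftInverse_of_injective (Submodule.ker_subtype _)
  let c : Fin (Module.finrank ℂ W) → S ⊕ Φ → ℂ := fun i k => e.repr (ρ (F.rb ℂ k)) i
  -- the retraction onto the reduction, read over `ℂ((t))`, is injective on `M`
  refine finrank_le_of_forall (F := F) M c fun x hxM h1 => ?_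
  by_contra hne
  obtain ⟨n, y, hy, hy0⟩ := F.exists_primitive hne
  have hyW : extVec evalZero y ∈ W :=
    ⟨y, by rw [hy]; exact Submodule.smul_mem _ _ hxM, rfl⟩
  have h2 : ∀ i, ∑ k, algebraMap ℂ ℂ⟦X⟧ (c i k) * (F.rb ℂ⟦X⟧).repr y k = 0 := by
    intro i
    apply toLaurent_injective
    rw [map_zero, map_sum]
    have h3 : ∀ k, toLaurent (algebraMap ℂ ℂ⟦X⟧ (c i k) * (F.rb ℂ⟦X⟧).repr y k) =
        (HahnSeries.single n (1 : ℂ) : ℂ⸨X⸩) *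
          (algebraMap ℂ ℂ⸨X⸩ (c i k) * (F.rb ℂ⸨X⸩).repr x k) := by
      intro k
      rw [map_mul, AlgHom.commutes, ← F.repr_extVec, hy, map_smul, Finsupp.smul_apply,
        smul_eq_mul, mul_left_comm]
    simp only [h3]
    rw [← Finset.mul_sum, h1, mul_zero]
  have h4 : ρ (extVec evalZero y) = 0 := by
    refine e.ext_elem fun i => ?_
    rw [map_zero, Finsupp.zero_apply, ← (F.rb ℂ).sum_repr (extVec evalZero y)]
    simp only [map_sum, map_smul, Finsupp.finsetSum_apply, Finsupp.smul_apply, smul_eq_mul,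
      repr_extVec]
    have h5 := congrArg evalZero (h2 i)
    rw [map_zero, map_sum] at h5
    refine Eq.trans (Finset.sum_congr rfl fun k _ => ?_) h5
    rw [map_mul, AlgHom.commutes, mul_comm]
    rfl
  have h6 : ρ (extVec evalZero y) = ⟨extVec evalZero y, hyW⟩ :=
    LinearMap.congr_fun hρ ⟨extVec evalZero y, hyW⟩
  rw [h4] at h6
  exact hy0 (congrArg Subtype.val h6).symm

variable (F) in
/-- The conjugate `g⁻¹ 𝔟((t))` of the Borel subalgebra. -/
def conjBorel (g : (ℂ⸨X⸩ ⊗[ℂ] 𝔤) ≃ₗ[ℂ⸨X⸩] (ℂ⸨X⸩ ⊗[ℂ] 𝔤)) :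
    Submodule ℂ⸨X⸩ (ℂ⸨X⸩ ⊗[ℂ] 𝔤) :=
  (F.gr ℂ⸨X⸩ (Set.Ici 0)).comap g.toLinearMap

lemma mem_conjBorel {g : (ℂ⸨X⸩ ⊗[ℂ] 𝔤) ≃ₗ[ℂ⸨X⸩] (ℂ⸨X⸩ ⊗[ℂ] 𝔤)} {x : ℂ⸨X⸩ ⊗[ℂ] 𝔤} :
    x ∈ F.conjBorel g ↔ g x ∈ F.gr ℂ⸨X⸩ (Set.Ici 0) := Iff.rfl

lemma finrank_conjBorel (g : (ℂ⸨X⸩ ⊗[ℂ] 𝔤) ≃ₗ[ℂ⸨X⸩] (ℂ⸨X⸩ ⊗[ℂ] 𝔤)) :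
    Module.finrank ℂ⸨X⸩ (F.conjBorel g) = Nat.card {k : S ⊕ Φ // F.height k ∈ Set.Ici 0} := by
  rw [conjBorel, Submodule.comap_equiv_eq_map_symm, LinearEquiv.finrank_map_eq, finrank_gr]

/-- The three properties hold for each conjugate of the Borel subalgebra over `ℂ((t))`, and they
specialize to `t = 0`. -/
lemma isBorelLike_reduction [FiniteDimensional ℂ 𝔤]
    {g : (ℂ⸨X⸩ ⊗[ℂ] 𝔤) ≃ₗ[ℂ⸨X⸩] (ℂ⸨X⸩ ⊗[ℂ] 𝔤)} (hg : g ∈ adjPoints 𝔤 ℂ⸨X⸩) :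
    F.IsBorelLike (reduction (F.conjBorel g)) where
  lie_mem := by
    rintro _ ⟨x, hx, rfl⟩ _ ⟨y, hy, rfl⟩
    refine ⟨⁅x, y⁆, ?_, extVec_lie _ _ _⟩
    rw [mem_conjBorel, extVec_lie, F.map_lie_of_mem_adjPoints hg]
    exact F.gr_mono Set.Ioi_subset_Ici_self (F.lie_mem_gr_pos hx hy)
  kf_lie_self := by
    rintro _ ⟨x, hx, rfl⟩ _ ⟨y, hy, rfl⟩
    have h : kf ℂ⟦X⟧ ⁅x, y⁆ ⁅x, y⁆ = 0 := by
      apply toLaurent_injective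
      rw [map_zero, ← kf_extVec, ← F.kf_of_mem_adjPoints hg, extVec_lie,
        F.map_lie_of_mem_adjPoints hg]
      have := F.lie_mem_gr_pos hx hy
      refine F.kf_eq_zero (s := Set.Ioi 0) (t := Set.Ioi 0) (fun a ha b hb => ?_) this this
      simp only [Set.mem_Ioi] at ha hb
      omega
    rw [← extVec_lie, kf_extVec, h, map_zero]
  card_le := (finrank_conjBorel g).symm.le.trans (F.finrank_le_finrank_reduction _)

/-! ### The Iwasawa decomposition -/

/-- Points over `R` that map one step of the filtration to another one still do so after an
extension of scalars. -/
lemma extGL_mem_gr {R R' : Type*} [CommRing R] [Algebra ℂ R] [CommRing R'] [Algebra ℂ R']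
    (j : R →ₐ[ℂ] R') {g : (R ⊗[ℂ] 𝔤) ≃ₗ[R] (R ⊗[ℂ] 𝔤)} {s t : Set ℤ}
    (hg : ∀ x ∈ F.gr R s, g x ∈ F.gr R t) {x : R' ⊗[ℂ] 𝔤} (hx : x ∈ F.gr R' s) :
    extGL j g x ∈ F.gr R' t := by
  rw [← (F.rb R').sum_repr x, map_sum]
  refine Submodule.sum_mem _ fun k _ => ?_
  rw [map_smul]
  by_cases hk : F.height k ∈ s
  · refine Submodule.smul_mem _ _ ?_
    rw [← F.extVec_rb j, extGL_extVec]
    exact F.extVec_mem_gr j (hg _ (F.rb_mem_gr hk))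
  · rw [hx k hk, zero_smul]; exact zero_mem _

/-- A subspace of the dimension of the Borel subalgebra which meets the opposite nilradical
trivially contains an element of the coset `grading + 𝔫⁻`. -/
lemma exists_sub_grading_mem {K : Type*} [Field K] [Algebra ℂ K]
    {M : Submodule K (K ⊗[ℂ] 𝔤)}
    (hd : Module.finrank K M = Nat.card {k : S ⊕ Φ // F.height k ∈ Set.Ici 0})
    (h : ∀ x ∈ M, x ∈ F.gr K (Set.Iio 0) → x = 0) :
    ∃ x ∈ M, x - F.grading K ∈ F.gr K (Set.Iio 0) := by
  classical
  have : Module.Finite K (K ⊗[ℂ] 𝔤) := Module.Finite.of_basis (F.rb K)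
  let T : M →ₗ[K] ({k : S ⊕ Φ // F.height k ∈ Set.Ici 0} → K) :=
    (LinearMap.pi fun k => (F.rb K).coord k.1) ∘ₗ M.subtype
  have hT : Function.Injective T := by
    rw [← LinearMap.ker_eq_bot, Submodule.eq_bot_iff]
    rintro ⟨x, hxM⟩ hx
    refine Subtype.ext (h x hxM fun k hk => ?_)
    exact congrFun (LinearMap.mem_ker.mp hx) ⟨k, by simpa using hk⟩
  have hsurj := (LinearMap.injective_iff_surjective_of_finrank_eq_finrank (by
    rw [Module.finrank_fintype_fun_eq_card, hd, Nat.card_eq_fintype_card])).mp hT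
  obtain ⟨⟨x, hxM⟩, hx⟩ := hsurj fun k => (F.rb K).repr (F.grading K) k.1
  refine ⟨x, hxM, fun k hk => ?_⟩
  rw [map_sub, Finsupp.sub_apply]
  exact sub_eq_zero.mpr (congrFun hx ⟨k, by simpa using hk⟩)

/-- The Iwasawa decomposition `G((t)) = B((t)) G[[t]]`: each conjugate of the Borel subalgebra
under `G((t))` is conjugate to the Borel subalgebra under `G[[t]]`. -/
theorem exists_conjBorel_eq [FiniteDimensional ℂ 𝔤]
    {g : (ℂ⸨X⸩ ⊗[ℂ] 𝔤) ≃ₗ[ℂ⸨X⸩] (ℂ⸨X⸩ ⊗[ℂ] 𝔤)} (hg : g ∈ adjPoints 𝔤 ℂ⸨X⸩) :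
    ∃ k ∈ adjPoints 𝔤 ℂ⟦X⟧,
      F.conjBorel (g * extGL toLaurent k⁻¹) = F.gr ℂ⸨X⸩ (Set.Ici 0) := by
  -- a constant group element moves the reduction of `g⁻¹ 𝔟((t))` away from `𝔫⁻`
  obtain ⟨a₀, ha₀, hdisj⟩ := (isBorelLike_reduction (F := F) hg).exists_map_disjoint
  set a : (ℂ⟦X⟧ ⊗[ℂ] 𝔤) ≃ₗ[ℂ⟦X⟧] (ℂ⟦X⟧ ⊗[ℂ] 𝔤) := extGL (Algebra.ofId ℂ ℂ⟦X⟧) a₀ with ha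
  have haO : a ∈ adjPoints 𝔤 ℂ⟦X⟧ := extGL_mem_adjPoints _ ha₀
  have happ : ∀ (h : (ℂ⟦X⟧ ⊗[ℂ] 𝔤) ≃ₗ[ℂ⟦X⟧] (ℂ⟦X⟧ ⊗[ℂ] 𝔤)) x, h (h⁻¹ x) = x := fun h x =>
    h.apply_symm_apply x
  -- integral vectors of `a g⁻¹ 𝔟((t))` that lie in `𝔫⁻` modulo `t` are divisible by `t`
  have key : ∀ y : ℂ⟦X⟧ ⊗[ℂ] 𝔤, extVec toLaurent y ∈ F.conjBorel (g * extGL toLaurent a⁻¹) →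
      extVec evalZero y ∈ F.gr ℂ (Set.Iio 0) → extVec evalZero y = 0 := by
    intro y hy hy'
    have h1 : extVec evalZero (a⁻¹ y) ∈ reduction (F.conjBorel g) := by
      refine ⟨a⁻¹ y, ?_, rfl⟩
      rw [mem_conjBorel, LinearEquiv.mul_apply, extGL_extVec] at hy
      exact hy
    have h2 : a₀ (extVec evalZero (a⁻¹ y)) = extVec evalZero y := by
      conv_lhs => rw [← extGL_extGL_ofId evalZero a₀, ← ha, extGL_extVec, happ]
    have h3 := hdisj _ h1 (by rw [h2]; exact hy')
    rw [← h2, h3, map_zero]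
  -- hence `a g⁻¹ 𝔟((t))` itself meets `𝔫⁻((t))` trivially, and it has an element `grading + ν` with
  -- `ν` in `𝔫⁻((t))`
  have hM : ∀ x ∈ F.conjBorel (g * extGL toLaurent a⁻¹), x ∈ F.gr ℂ⸨X⸩ (Set.Iio 0) → x = 0 := by
    intro x hxM hx
    by_contra hne
    obtain ⟨n, y, hy, hy0⟩ := F.exists_primitive hne
    refine hy0 (key y (by rw [hy]; exact Submodule.smul_mem _ _ hxM) ?_)
    refine F.extVec_mem_gr _ (F.mem_gr_of_extVec_mem toLaurent_injective ?_)
    rw [hy]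
    exact Submodule.smul_mem _ _ hx
  obtain ⟨x, hxM, hx⟩ := exists_sub_grading_mem (finrank_conjBorel _) hM
  -- this element is integral: otherwise its primitive multiple would lie in `𝔫⁻` modulo `t`
  have hxO : ∃ y : ℂ⟦X⟧ ⊗[ℂ] 𝔤, extVec toLaurent y = x := by
    by_cases hx0 : x = 0
    · exact ⟨0, by rw [hx0, map_zero]⟩
    obtain ⟨n, y, hy, hy0⟩ := F.exists_primitive hx0
    rcases le_or_gt n 0 with hn | hn
    · obtain ⟨m, rfl⟩ : ∃ m : ℕ, n = -m := ⟨(-n).toNat, by omega⟩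
      refine ⟨(PowerSeries.X ^ m : ℂ⟦X⟧) • y, ?_⟩
      rw [extVec_smul, hy, toLaurent_apply, HahnSeries.ofPowerSeries_X_pow]
      refine (mul_smul (HahnSeries.single (m : ℤ) (1 : ℂ) : ℂ⸨X⸩)
        (HahnSeries.single (-m : ℤ) (1 : ℂ) : ℂ⸨X⸩) x).symm.trans ?_
      rw [HahnSeries.single_mul_single, add_neg_cancel, mul_one]
      exact one_smul ℂ⸨X⸩ x
    · exfalso
      refine hy0 (key y (by rw [hy]; exact Submodule.smul_mem _ _ hxM) fun k hk => ?_)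
      have h1 : (F.rb ℂ⸨X⸩).repr x k = (F.rb ℂ⸨X⸩).repr (F.grading ℂ⸨X⸩) k := by
        have := hx k hk
        rw [map_sub, Finsupp.sub_apply] at this
        exact sub_eq_zero.mp this
      have h2 : F.grading ℂ⸨X⸩ = extVec toLaurent (F.grading ℂ⟦X⟧) := by
        simp only [grading, map_sum, extVec_smul, extVec_rb, map_intCast]
      rw [repr_extVec, evalZero_apply, ← PowerSeries.coeff_zero_eq_constantCoeff,
        ← coeff_toLaurent, ← F.repr_extVec, hy, map_smul, Finsupp.smul_apply, smul_eq_mul,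
        HahnSeries.coeff_single_mul, h1, h2, repr_extVec, one_mul]
      exact coeff_toLaurent_of_neg _ (by simpa using hn)
  obtain ⟨y, rfl⟩ := hxO
  have hgr : extVec toLaurent (F.grading ℂ⟦X⟧) = F.grading ℂ⸨X⸩ := by
    simp only [grading, map_sum, extVec_smul, extVec_rb, map_intCast]
  rw [← hgr, ← map_sub] at hx
  -- an integral unipotent element takes it to `grading`, so that the conjugate is a sum of weight
  -- spaces, none of which is a negative root space
  obtain ⟨u, hu, hu', huy⟩ := F.exists_conj_grading (F.mem_gr_of_extVec_mem toLaurent_injective hx)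
  refine ⟨u * a, mul_mem hu haO, ?_⟩
  have hmem : ∀ z, z ∈ F.conjBorel (g * extGL toLaurent (u * a)⁻¹) ↔
      extGL toLaurent u⁻¹ z ∈ F.conjBorel (g * extGL toLaurent a⁻¹) := by
    intro z
    rw [mem_conjBorel, mem_conjBorel, mul_inv_rev, extGL_mul]
    rfl
  have hgm : F.grading ℂ⸨X⸩ ∈ F.conjBorel (g * extGL toLaurent (u * a)⁻¹) := by
    rw [hmem, ← hgr, extGL_extVec, ← huy]
    have : u⁻¹ (u y) = y := u.symm_apply_apply y
    rw [this]
    exact hxM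
  have hk : g * extGL toLaurent (u * a)⁻¹ ∈ adjPoints 𝔤 ℂ⸨X⸩ :=
    mul_mem hg (extGL_mem_adjPoints _ (inv_mem (mul_mem hu haO)))
  have hlie : ∀ z ∈ F.conjBorel (g * extGL toLaurent (u * a)⁻¹),
      ⁅F.grading ℂ⸨X⸩, z⁆ ∈ F.conjBorel (g * extGL toLaurent (u * a)⁻¹) := by
    intro z hz
    rw [mem_conjBorel, F.map_lie_of_mem_adjPoints hk]
    exact F.gr_mono Set.Ioi_subset_Ici_self (F.lie_mem_gr_pos hgm hz)
  have : Module.Finite ℂ⸨X⸩ (ℂ⸨X⸩ ⊗[ℂ] 𝔤) := Module.Finite.of_basis (F.rb ℂ⸨X⸩)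
  refine Submodule.eq_of_le_of_finrank_eq (?_ : _ ≤ F.gr ℂ⸨X⸩ (Set.Ici 0))
    (by rw [finrank_conjBorel, finrank_gr])
  intro z hz l hl
  by_contra h0
  rcases l with i | α
  · simp at hl
  · have h1 := rb_mem_of_repr_ne_zero hlie hz h0
    have h2 : F.rb ℂ⸨X⸩ (Sum.inr α) ∈ F.gr ℂ⸨X⸩ (Set.Iio 0) := F.rb_mem_gr (by simpa using hl)
    have h3 := hM _ ((hmem _).mp h1) (extGL_mem_gr _ hu' h2)
    exact (F.rb ℂ⸨X⸩).ne_zero (Sum.inr α) ((LinearEquiv.map_eq_zero_iff _).mp h3)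

end RootFrame

namespace RootFrame

variable {𝔤 : Type*} [LieRing 𝔤] [LieAlgebra ℂ 𝔤] {S Φ : Type*} [Fintype S] [Fintype Φ]
  (F : RootFrame 𝔤 S Φ) {R : Type*} [CommRing R] [Algebra ℂ R]

/-! ### Connections in oper form -/

lemma simple_injective : Function.Injective F.simple := by
  intro i j h
  by_contra hij
  have h1 := F.wt_simple_self i
  rw [h, F.wt_simple_of_ne j i hij] at h1
  exact zero_ne_one h1

/-- The negative simple root vectors. -/
abbrev negRoot (i : S) : S ⊕ Φ := Sum.inr (F.neg (F.simple i))

lemma height_negRoot_neg (i : S) : F.height (F.negRoot i) < 0 := by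
  have := F.deg_simple_pos i
  rw [height_inr, height_neg]
  omega

lemma negRoot_notMem (i : S) : F.height (F.negRoot i) ∉ Set.Ici 0 := by
  simpa using F.height_negRoot_neg i

lemma negRoot_injective : Function.Injective F.negRoot := by
  intro i j h
  apply F.simple_injective
  rw [← F.neg_neg (F.simple i), Sum.inr_injective h, F.neg_neg]

/-- `A` has the form `∑ ψ i • e (-α i) + v` with `v` in the Borel subalgebra. -/
def HasSymbol (A : R ⊗[ℂ] 𝔤) (ψ : S → R) : Prop :=
  A - ∑ i, ψ i • F.rb R (F.negRoot i) ∈ F.gr R (Set.Ici 0)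

variable {F}

lemma lie_negRoot_mem (i : S) {x : R ⊗[ℂ] 𝔤} (hx : x ∈ F.gr R (Set.Ioi 0)) :
    ⁅F.rb R (F.negRoot i), x⁆ ∈ F.gr R (Set.Ici 0) := by
  have h' : ∀ (r : R) (v w : R ⊗[ℂ] 𝔤), ⁅v, r • w⁆ = r • ⁅v, w⁆ := fun r v w => lie_smul r v w
  rw [← (F.rb R).sum_repr x, lie_sum]
  refine Submodule.sum_mem _ fun k _ => ?_
  rw [h']
  by_cases hk : F.height k ∈ Set.Ioi 0
  · refine Submodule.smul_mem _ _ fun l hl => ?_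
    rw [repr_lie_rb]
    by_contra h0
    have h1 := F.weight_add (fun h => h0 (by rw [h, map_zero]))
    rcases k with j | β
    · simp at hk
    rcases l with j | γ
    · simp at hl
    rw [weight_inr, weight_inr, weight_inr, F.wt_neg] at h1
    have := F.deg_sub_simple_pos i β γ (by simpa using hk) (by rw [h1]; abel)
    simp only [height_inr, Set.mem_Ici] at hl
    omega
  · rw [hx k hk, zero_smul]; exact zero_mem _

lemma HasSymbol.lie_mem {A : R ⊗[ℂ] 𝔤} {ψ : S → R} (h : F.HasSymbol A ψ) {x : R ⊗[ℂ] 𝔤}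
    (hx : x ∈ F.gr R (Set.Ioi 0)) : ⁅A, x⁆ ∈ F.gr R (Set.Ici 0) := by
  have hl : ∀ (r : R) (v w : R ⊗[ℂ] 𝔤), ⁅r • v, w⁆ = r • ⁅v, w⁆ := fun r v w => smul_lie r v w
  rw [← sub_add_cancel A (∑ i, ψ i • F.rb R (F.negRoot i)), add_lie, sum_lie]
  refine add_mem ?_ (Submodule.sum_mem _ fun i _ => ?_)
  · exact F.gr_mono Set.Ioi_subset_Ici_self
      (F.lie_mem_gr_pos h (F.gr_mono Set.Ioi_subset_Ici_self hx))
  · rw [hl]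
    exact Submodule.smul_mem _ _ (lie_negRoot_mem i hx)

/-- Modulo the Borel subalgebra, the fundamental coweight `ω i` isolates the `i`-th component. -/
lemma HasSymbol.lie_rb_inl {A : R ⊗[ℂ] 𝔤} {ψ : S → R} (h : F.HasSymbol A ψ) (i : S) :
    ⁅A, F.rb R (Sum.inl i)⁆ - ψ i • F.rb R (F.negRoot i) ∈ F.gr R (Set.Ici 0) := by
  have hl : ∀ (r : R) (v w : R ⊗[ℂ] 𝔤), ⁅r • v, w⁆ = r • ⁅v, w⁆ := fun r v w => smul_lie r v w
  have h1 : ∀ j, ⁅F.rb R (F.negRoot j), F.rb R (Sum.inl i)⁆ =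
      algebraMap ℂ R (F.wt (F.simple j) i) • F.rb R (F.negRoot j) := by
    intro j
    rw [← lie_skew, lie_rb, lie_inl_inr, F.wt_neg, TensorProduct.tmul_smul, Pi.neg_apply, neg_smul,
      _root_.neg_neg, algebraMap_smul, Module.Basis.baseChange_apply]
  have h2 : ⁅∑ j, ψ j • F.rb R (F.negRoot j), F.rb R (Sum.inl i)⁆ = ψ i • F.rb R (F.negRoot i) := by
    rw [sum_lie, Finset.sum_eq_single i]
    · rw [hl, h1, F.wt_simple_self, map_one, one_smul]
    · intro j _ hj
      rw [hl, h1, F.wt_simple_of_ne j i (Ne.symm hj), map_zero, zero_smul, smul_zero]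
    · simp
  rw [← h2, ← sub_lie]
  exact F.gr_mono Set.Ioi_subset_Ici_self (F.lie_mem_gr_pos h (F.rb_mem_gr (by simp)))

lemma repr_rTensor (d : R →ₗ[ℂ] R) (x : R ⊗[ℂ] 𝔤) (k : S ⊕ Φ) :
    (F.rb R).repr (LinearMap.rTensor 𝔤 d x) k = d ((F.rb R).repr x k) := by
  induction x using TensorProduct.induction_on with
  | zero => simp
  | tmul r x => simp [Module.Basis.baseChange_repr_tmul]
  | add x y hx hy => simp only [map_add, Finsupp.add_apply, hx, hy]

lemma rTensor_mem_gr (d : R →ₗ[ℂ] R) {s : Set ℤ} {x : R ⊗[ℂ] 𝔤} (hx : x ∈ F.gr R s) :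
    LinearMap.rTensor 𝔤 d x ∈ F.gr R s := fun k hk => by
  rw [repr_rTensor, hx k hk, map_zero]

/-- A gauge transformation by a point of the Borel subgroup multiplies the symbol by functions. The
proof evaluates the connections on the fundamental coweight `ω i`, which isolates the `i`-th component
of the symbol and which `g` fixes modulo the nilradical. -/
lemma HasSymbol.dvd [FiniteDimensional ℂ 𝔤] {d : R →ₗ[ℂ] R}
    {g : (R ⊗[ℂ] 𝔤) ≃ₗ[R] (R ⊗[ℂ] 𝔤)} (hg : g ∈ adjPoints 𝔤 R)
    (hb : ∀ x ∈ F.gr R (Set.Ici 0), g x ∈ F.gr R (Set.Ici 0))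
    (hb' : ∀ x ∈ F.gr R (Set.Ici 0), g⁻¹ x ∈ F.gr R (Set.Ici 0)) {A A' : R ⊗[ℂ] 𝔤}
    (h : IsGauge d g A A') {ψ ψ' : S → R} (hA : F.HasSymbol A ψ) (hA' : F.HasSymbol A' ψ')
    (i : S) : ψ i ∣ ψ' i := by
  refine ⟨(F.rb R).repr (g (F.rb R (F.negRoot i))) (F.negRoot i), ?_⟩
  have hx := h (F.rb R (Sum.inl i))
  have hn := F.map_cartan_sub_mem hg hb hb' i
  have hω : F.rb R (Sum.inl i) ∈ F.gr R (Set.Ici 0) := F.rb_mem_gr (by simp)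
  have h1 : g (LinearMap.rTensor 𝔤 d (F.rb R (Sum.inl i)) + ⁅A, F.rb R (Sum.inl i)⁆) -
      ψ i • g (F.rb R (F.negRoot i)) ∈ F.gr R (Set.Ici 0) := by
    rw [← map_smul, ← map_sub, add_sub_assoc]
    exact hb _ (add_mem (rTensor_mem_gr d hω) (hA.lie_rb_inl i))
  have h2 : LinearMap.rTensor 𝔤 d (g (F.rb R (Sum.inl i))) + ⁅A', g (F.rb R (Sum.inl i))⁆ -
      ψ' i • F.rb R (F.negRoot i) ∈ F.gr R (Set.Ici 0) := by
    have e : ⁅A', g (F.rb R (Sum.inl i))⁆ = ⁅A', F.rb R (Sum.inl i)⁆ +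
        ⁅A', g (F.rb R (Sum.inl i)) - F.rb R (Sum.inl i)⁆ := by
      rw [← lie_add, add_sub_cancel]
    rw [e, add_sub_assoc, add_sub_right_comm]
    exact add_mem (rTensor_mem_gr d (hb _ hω)) (add_mem (hA'.lie_rb_inl i) (hA'.lie_mem hn))
  rw [hx] at h1
  have h3 := sub_mem h1 h2 _ (F.negRoot_notMem i)
  rw [sub_sub_sub_cancel_left, map_sub, Finsupp.sub_apply, map_smul, Finsupp.smul_apply, map_smul,
    Finsupp.smul_apply, Module.Basis.repr_self, Finsupp.single_eq_same, smul_eq_mul, smul_eq_mul,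
    mul_one] at h3
  exact sub_eq_zero.mp h3

/-- Modulo the Borel subalgebra, the vectors that map the nilradical to the Borel subalgebra are
combinations of the negative simple root vectors: for a negative root `α` which is not simple, a
suitable simple root vector detects the component along `e α`. -/
lemma hasSymbol_of_lie_mem {A : R ⊗[ℂ] 𝔤}
    (h : ∀ x ∈ F.gr R (Set.Ioi 0), ⁅A, x⁆ ∈ F.gr R (Set.Ici 0)) :
    F.HasSymbol A fun i => (F.rb R).repr A (F.negRoot i) := by
  classical
  have hl : ∀ (r : R) (v w : R ⊗[ℂ] 𝔤), ⁅r • v, w⁆ = r • ⁅v, w⁆ := fun r v w => smul_lie r v w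
  intro k hk
  rw [map_sub, Finsupp.sub_apply, map_sum, Finsupp.finsetSum_apply]
  have e : ∀ i, (F.rb R).repr ((F.rb R).repr A (F.negRoot i) • F.rb R (F.negRoot i)) k =
      if F.negRoot i = k then (F.rb R).repr A (F.negRoot i) else 0 := by
    intro i
    rw [map_smul, Finsupp.smul_apply, Module.Basis.repr_self, Finsupp.single_apply]
    simp
  simp only [e]
  by_cases hs : ∃ i, F.negRoot i = k
  · obtain ⟨i, rfl⟩ := hs
    rw [Finset.sum_eq_single i]
    · rw [if_pos rfl, sub_self]
    · intro j _ hj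
      rw [if_neg fun h => hj (F.negRoot_injective h)]
    · simp
  · push Not at hs
    rw [Finset.sum_eq_zero fun i _ => if_neg (hs i), sub_zero]
    rcases k with j | α
    · simp at hk
    have hα : 0 < F.deg (F.neg α) := by
      rw [height_neg]
      simp only [height_inr, Set.mem_Ici] at hk
      omega
    obtain ⟨i, hi⟩ := F.exists_lie_simple_ne_zero _ hα
    rw [F.neg_neg] at hi
    obtain ⟨l, hl'⟩ : ∃ l, F.basis.repr ⁅F.basis (Sum.inr (F.simple i)),
        F.basis (Sum.inr α)⁆ l ≠ 0 := by
      by_contra! hcon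
      exact hi (F.basis.ext_elem fun l => by simpa using hcon l)
    have hw := F.weight_add hl'
    rcases l with j | γ
    · refine (hs i ?_).elim
      rw [weight_inl, weight_inr, weight_inr] at hw
      refine congrArg Sum.inr (F.wt_injective ?_)
      rw [F.wt_neg]
      exact neg_eq_of_add_eq_zero_right hw.symm
    rw [weight_inr, weight_inr, weight_inr] at hw
    have hγ := F.deg_sub_simple_pos i (F.neg α) (F.neg γ) hα (by
      rw [F.wt_neg, F.wt_neg, hw]; abel)
    rw [height_neg] at hγ
    have h1 := h (F.rb R (Sum.inr (F.simple i))) (F.rb_mem_gr (F.deg_simple_pos i))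
      (Sum.inr γ) (by simp only [height_inr, Set.mem_Ici]; omega)
    rw [← (F.rb R).sum_repr A, sum_lie, map_sum, Finsupp.finsetSum_apply,
      Finset.sum_eq_single (Sum.inr α)] at h1
    · rw [hl, ← lie_skew, map_smul, Finsupp.smul_apply, map_neg, Finsupp.neg_apply, repr_lie_rb,
        smul_eq_mul, mul_neg, neg_eq_zero] at h1
      exact ((isUnit_iff_ne_zero.mpr hl').map (algebraMap ℂ R)).mul_left_eq_zero.mp h1
    · intro k _ hk'
      rw [hl, map_smul, Finsupp.smul_apply, repr_lie_rb]
      by_cases h0 : F.basis.repr ⁅F.basis k, F.basis (Sum.inr (F.simple i))⁆ (Sum.inr γ) = 0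
      · rw [h0, map_zero, smul_zero]
      · exfalso
        have h2 := F.weight_add h0
        rw [weight_inr, weight_inr, hw, add_comm] at h2
        have h3 : F.wt α = F.weight k := add_right_cancel h2
        rcases k with j | β
        · have h4 := F.deg_eq α
          rw [h3] at h4
          simp only [weight_inl, Pi.zero_apply, mul_zero, Finset.sum_const_zero] at h4
          exact F.deg_ne_zero _ (by exact_mod_cast h4)
        · exact hk' (congrArg Sum.inr (F.wt_injective h3).symm)
    · simp

end RootFrame

/-! ### Integrality of gauge transformations between integral connections -/

/-- The solutions of a linear differential equation with regular coefficients are regular: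
comparing the coefficients of `t ^ (n - 1)` shows that there is no first non-zero coefficient with a
negative index `n`. -/
lemma coeff_eq_zero_of_dLaurent {ι : Type*} [Fintype ι] {y : ι → ℂ⸨X⸩}
    (h : ∀ i, ∃ c : ι → ℂ⟦X⟧, dLaurent (y i) = ∑ j, toLaurent (c j) * y j)
    (i : ι) {n : ℤ} (hn : n < 0) : (y i).coeff n = 0 := by
  suffices H : ∀ (k : ℕ) (n : ℤ), n < 0 → n < (k : ℤ) + -∑ i, |(y i).order| →
      ∀ i, (y i).coeff n = 0 from
    H (n + ∑ i, |(y i).order| + 1).toNat n hn (by omega) i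
  intro k
  induction k with
  | zero =>
    intro n _ hn i
    refine HahnSeries.coeff_eq_zero_of_lt_order ?_
    have h1 : |(y i).order| ≤ ∑ i, |(y i).order| :=
      Finset.single_le_sum (f := fun i => |(y i).order|) (fun _ _ => abs_nonneg _)
        (Finset.mem_univ i)
    have h2 := neg_abs_le (y i).order
    push_cast at hn
    omega
  | succ k ih =>
    intro n hn hnk i
    obtain ⟨c, hc⟩ := h i
    have h1 := congrArg (fun a => a.coeff (n - 1)) hc
    simp only [dLaurent_coeff, sub_add_cancel, HahnSeries.coeff_sum] at h1
    rw [Finset.sum_eq_zero] at h1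
    · have : ((n - 1 : ℤ) : ℂ) + 1 ≠ 0 := by
        push_cast
        rw [sub_add_cancel]
        exact_mod_cast hn.ne
      exact (mul_eq_zero.mp h1).resolve_left this
    · intro j _
      rw [HahnSeries.coeff_mul]
      refine Finset.sum_eq_zero fun p hp => ?_
      obtain ⟨hp1, hp2, hp3⟩ := Finset.mem_antidiagonal.mp hp
      rcases lt_or_ge p.1 0 with h0 | h0
      · rw [coeff_toLaurent_of_neg _ h0, zero_mul]
      · rw [ih p.2 (by omega) (by push_cast at hnk; omega) j, mul_zero]

lemma coeff_eq_zero_of_dLaurent_matrix {ι : Type*} [Fintype ι] {B : ι → ι → ℂ⸨X⸩}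
    (a a' : ι → ι → ℂ⟦X⟧) (h : ∀ k l, dLaurent (B k l) =
      ∑ m, toLaurent (a k m) * B m l - ∑ m, toLaurent (a' l m) * B k m) (k l : ι) {n : ℤ}
    (hn : n < 0) : (B k l).coeff n = 0 := by
  classical
  refine coeff_eq_zero_of_dLaurent (y := fun p : ι × ι => B p.1 p.2) (fun p => ?_) (k, l) hn
  refine ⟨fun q => (if q.2 = p.2 then a p.1 q.1 else 0) -
    (if q.1 = p.1 then a' p.2 q.2 else 0), ?_⟩
  rw [h, Fintype.sum_prod_type]
  simp only [map_sub, sub_mul, Finset.sum_sub_distrib, apply_ite toLaurent, map_zero, ite_mul,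
    zero_mul]
  congr 1
  · simp
  · rw [Finset.sum_comm]
    simp

/-- Membership in `G(R)` can be tested over an extension of `R`. -/
lemma mem_adjPoints_of_extGL {𝔤 : Type*} [LieRing 𝔤] [LieAlgebra ℂ 𝔤] [FiniteDimensional ℂ 𝔤]
    {R R' : Type*} [CommRing R] [Algebra ℂ R] [CommRing R'] [Algebra ℂ R'] {j : R →ₐ[ℂ] R'}
    (hj : Function.Injective j) {g : (R ⊗[ℂ] 𝔤) ≃ₗ[R] (R ⊗[ℂ] 𝔤)}
    (hg : extGL j g ∈ adjPoints 𝔤 R') : g ∈ adjPoints 𝔤 R := by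
  intro p hp
  have h : coord (extGL j g) = fun c => j (coord g c) := funext (coord_extGL j g)
  have h2 := MvPolynomial.comp_aeval_apply (coord g) j p
  apply hj
  rw [map_zero]
  refine h2.trans ?_
  rw [← h]
  exact hg p hp

section

variable {𝔤 : Type*} [LieRing 𝔤] [LieAlgebra ℂ 𝔤] {R : Type*} [CommRing R] [Algebra ℂ R]

lemma IsGauge.symm {d : R →ₗ[ℂ] R} {g : (R ⊗[ℂ] 𝔤) ≃ₗ[R] (R ⊗[ℂ] 𝔤)} {A A' : R ⊗[ℂ] 𝔤}
    (h : IsGauge d g A A') : IsGauge d g⁻¹ A' A := by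
  intro x
  have hx := h (g⁻¹ x)
  have hgx : ∀ y, g (g⁻¹ y) = y := fun y => g.apply_symm_apply y
  rw [hgx] at hx
  rw [← hx]
  exact g.symm_apply_apply _

lemma IsGauge.trans {d : R →ₗ[ℂ] R} {g g' : (R ⊗[ℂ] 𝔤) ≃ₗ[R] (R ⊗[ℂ] 𝔤)}
    {A A' A'' : R ⊗[ℂ] 𝔤} (h : IsGauge d g A A') (h' : IsGauge d g' A' A'') :
    IsGauge d (g' * g) A A'' := by
  intro x
  rw [LinearEquiv.mul_apply, h x, h' (g x)]
  rfl

lemma rTensor_dLaurent_extVec (w : ℂ⟦X⟧ ⊗[ℂ] 𝔤) : LinearMap.rTensor 𝔤 dLaurent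
    (extVec toLaurent w) = extVec toLaurent (LinearMap.rTensor 𝔤 dPower w) := by
  rw [← LinearMap.rTensor_comp_apply, ← LinearMap.rTensor_comp_apply]
  congr 2
  exact LinearMap.ext dLaurent_toLaurent

end

namespace RootFrame

variable {𝔤 : Type*} [LieRing 𝔤] [LieAlgebra ℂ 𝔤] {S Φ : Type*} [Fintype S] [Fintype Φ]
  {F : RootFrame 𝔤 S Φ}

/-- The linear differential equation for the matrix coefficients of a gauge transformation. -/
lemma repr_of_isGauge {R : Type*} [CommRing R] [Algebra ℂ R] {d : R →ₗ[ℂ] R} (hd : d 1 = 0)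
    {b : (R ⊗[ℂ] 𝔤) ≃ₗ[R] (R ⊗[ℂ] 𝔤)} {A A' : R ⊗[ℂ] 𝔤} (h : IsGauge d b A A') (k l : S ⊕ Φ) :
    d ((F.rb R).repr (b (F.rb R k)) l) =
      ∑ m, (F.rb R).repr ⁅A, F.rb R k⁆ m * (F.rb R).repr (b (F.rb R m)) l -
      ∑ m, (F.rb R).repr ⁅A', F.rb R m⁆ l * (F.rb R).repr (b (F.rb R k)) m := by
  have h' : ∀ (r : R) (v w : R ⊗[ℂ] 𝔤), ⁅v, r • w⁆ = r • ⁅v, w⁆ := fun r v w => lie_smul r v w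
  have h1 := h (F.rb R k)
  have hd : LinearMap.rTensor 𝔤 d (F.rb R k) = 0 := by
    rw [Module.Basis.baseChange_apply, LinearMap.rTensor_tmul, hd, TensorProduct.zero_tmul]
  rw [hd, zero_add] at h1
  have h2 := congrArg (fun z => (F.rb R).repr z l) h1
  simp only [map_add, Finsupp.add_apply, repr_rTensor] at h2
  have e1 : (F.rb R).repr (b ⁅A, F.rb R k⁆) l =
      ∑ m, (F.rb R).repr ⁅A, F.rb R k⁆ m * (F.rb R).repr (b (F.rb R m)) l := by
    conv_lhs => rw [← (F.rb R).sum_repr ⁅A, F.rb R k⁆]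
    simp only [map_sum, map_smul, Finsupp.finsetSum_apply, Finsupp.smul_apply, smul_eq_mul]
  have e2 : (F.rb R).repr ⁅A', b (F.rb R k)⁆ l =
      ∑ m, (F.rb R).repr ⁅A', F.rb R m⁆ l * (F.rb R).repr (b (F.rb R k)) m := by
    conv_lhs => rw [← (F.rb R).sum_repr (b (F.rb R k)), lie_sum]
    simp only [map_sum, h', map_smul, Finsupp.finsetSum_apply, Finsupp.smul_apply, smul_eq_mul]
    exact Finset.sum_congr rfl fun m _ => mul_comm _ _
  rw [← e1, ← e2, h2, add_sub_cancel_right]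

/-- The matrix coefficients of a gauge transformation between integral connections are integral. -/
lemma exists_extVec_eq_of_isGauge {b : (ℂ⸨X⸩ ⊗[ℂ] 𝔤) ≃ₗ[ℂ⸨X⸩] (ℂ⸨X⸩ ⊗[ℂ] 𝔤)}
    {A A' : ℂ⟦X⟧ ⊗[ℂ] 𝔤} (h : IsGauge dLaurent b (extVec toLaurent A) (extVec toLaurent A'))
    (k : S ⊕ Φ) : ∃ y, extVec toLaurent y = b (F.rb ℂ⸨X⸩ k) := by
  classical
  have hd : dLaurent 1 = 0 := by
    rw [← map_one toLaurent, dLaurent_toLaurent]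
    simp
  have e : ∀ (A : ℂ⟦X⟧ ⊗[ℂ] 𝔤) (m l : S ⊕ Φ), (F.rb ℂ⸨X⸩).repr ⁅extVec toLaurent A, F.rb ℂ⸨X⸩ m⁆ l =
      toLaurent ((F.rb ℂ⟦X⟧).repr ⁅A, F.rb ℂ⟦X⟧ m⁆ l) := by
    intro A m l
    rw [← F.extVec_rb toLaurent m, ← extVec_lie, repr_extVec]
  have key : ∀ k l, dLaurent ((F.rb ℂ⸨X⸩).repr (b (F.rb ℂ⸨X⸩ k)) l) = _ :=
    fun k l => repr_of_isGauge (F := F) hd h k l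
  simp only [e] at key
  refine F.exists_extVec_eq fun l n hn => ?_
  exact coeff_eq_zero_of_dLaurent_matrix
    (B := fun k l => (F.rb ℂ⸨X⸩).repr (b (F.rb ℂ⸨X⸩ k)) l) _ _ key k l hn

lemma exists_linearMap_of_extVec {R R' : Type*} [CommRing R] [Algebra ℂ R] [CommRing R']
    [Algebra ℂ R'] {j : R →ₐ[ℂ] R'} (b : (R' ⊗[ℂ] 𝔤) →ₗ[R'] (R' ⊗[ℂ] 𝔤))
    (h : ∀ k, ∃ y, extVec j y = b (F.rb R' k)) :
    ∃ g : (R ⊗[ℂ] 𝔤) →ₗ[R] (R ⊗[ℂ] 𝔤), ∀ x, extVec j (g x) = b (extVec j x) := by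
  choose w hw using h
  refine ⟨(F.rb R).constr R w, fun x => ?_⟩
  have e : extVec j x = ∑ k, j ((F.rb R).repr x k) • F.rb R' k := by
    conv_lhs => rw [← (F.rb R).sum_repr x]
    rw [map_sum]
    exact Finset.sum_congr rfl fun k _ => by rw [extVec_smul, extVec_rb]
  rw [Module.Basis.constr_apply_fintype, map_sum, e, map_sum]
  refine Finset.sum_congr rfl fun k _ => ?_
  rw [extVec_smul, hw, map_smul, Module.Basis.equivFun_apply]

/-- A gauge transformation over `ℂ((t))` between connections on the disc extends to the disc. -/
theorem exists_extGL_eq_of_isGauge [FiniteDimensional ℂ 𝔤]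
    {b : (ℂ⸨X⸩ ⊗[ℂ] 𝔤) ≃ₗ[ℂ⸨X⸩] (ℂ⸨X⸩ ⊗[ℂ] 𝔤)} (hb : b ∈ adjPoints 𝔤 ℂ⸨X⸩)
    {A A' : ℂ⟦X⟧ ⊗[ℂ] 𝔤} (h : IsGauge dLaurent b (extVec toLaurent A) (extVec toLaurent A'))
    (F : RootFrame 𝔤 S Φ) :
    ∃ g ∈ adjPoints 𝔤 ℂ⟦X⟧, extGL toLaurent g = b ∧ IsGauge dPower g A A' := by
  obtain ⟨g, hg⟩ := exists_linearMap_of_extVec (F := F) b.toLinearMap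
    fun k => exists_extVec_eq_of_isGauge h k
  obtain ⟨g', hg'⟩ := exists_linearMap_of_extVec (F := F) (b⁻¹).toLinearMap
    fun k => exists_extVec_eq_of_isGauge h.symm k
  have hinj := F.extVec_injective toLaurent_injective
  let e : (ℂ⟦X⟧ ⊗[ℂ] 𝔤) ≃ₗ[ℂ⟦X⟧] (ℂ⟦X⟧ ⊗[ℂ] 𝔤) := LinearEquiv.ofLinearMap g g'
    (LinearMap.ext fun x => hinj (by
      change extVec toLaurent (g (g' x)) = extVec toLaurent x
      rw [hg, hg']
      exact b.apply_symm_apply _))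
    (LinearMap.ext fun x => hinj (by
      change extVec toLaurent (g' (g x)) = extVec toLaurent x
      rw [hg', hg]
      exact b.symm_apply_apply _))
  have he : ∀ x, extVec toLaurent (e x) = b (extVec toLaurent x) := hg
  have hext : extGL toLaurent e = b := by
    refine LinearEquiv.ext fun x => ?_
    rw [← (F.rb ℂ⸨X⸩).sum_repr x, map_sum, map_sum]
    refine Finset.sum_congr rfl fun k _ => ?_
    rw [map_smul, map_smul, ← F.extVec_rb toLaurent, extGL_extVec, he]
  refine ⟨e, mem_adjPoints_of_extGL toLaurent_injective (by rw [hext]; exact hb), hext,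
    fun x => hinj ?_⟩
  have hx := h (extVec toLaurent x)
  rw [rTensor_dLaurent_extVec, ← extVec_lie, ← map_add, ← he, ← he, rTensor_dLaurent_extVec,
    ← extVec_lie, ← map_add] at hx
  exact hx

/-! ### The gauge class of the trivial connection -/

section Coefficients

variable {R : Type*} [CommRing R] [Algebra ℂ R]

/-- The application of a linear form on `R` to the coefficients of a vector of `R ⊗ 𝔤`. -/
def contract (φ : R →ₗ[ℂ] ℂ) : (R ⊗[ℂ] 𝔤) →ₗ[ℂ] 𝔤 :=
  (TensorProduct.lid ℂ 𝔤).toLinearMap ∘ₗ LinearMap.rTensor 𝔤 φ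

lemma contract_tmul (φ : R →ₗ[ℂ] ℂ) (p : R) (x : 𝔤) :
    contract φ (p ⊗ₜ[ℂ] x) = φ p • x := by
  simp [contract]

lemma contract_lie (φ : R →ₗ[ℂ] ℂ) (y : R ⊗[ℂ] 𝔤) (x : 𝔤) :
    contract φ ⁅y, (1 : R) ⊗ₜ[ℂ] x⁆ = ⁅contract φ y, x⁆ := by
  induction y using TensorProduct.induction_on with
  | zero => simp
  | tmul p z =>
    rw [LieAlgebra.ExtendScalars.bracket_tmul, contract_tmul, contract_tmul, mul_one, smul_lie]
  | add y z hy hz => rw [add_lie, map_add, hy, hz, map_add, add_lie]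

lemma repr_contract (φ : R →ₗ[ℂ] ℂ) (y : R ⊗[ℂ] 𝔤) (k : S ⊕ Φ) :
    F.basis.repr (contract φ y) k = φ ((F.rb R).repr y k) := by
  induction y using TensorProduct.induction_on with
  | zero => simp
  | tmul p z =>
    rw [contract_tmul, Module.Basis.baseChange_repr_tmul]
    simp [mul_comm]
  | add y z hy hz => simp only [map_add, Finsupp.add_apply, hy, hz]

lemma rTensor_smul {d : R →ₗ[ℂ] R} (hd : ∀ a b, d (a * b) = a * d b + d a * b) (s : R)
    (w : R ⊗[ℂ] 𝔤) : LinearMap.rTensor 𝔤 d (s • w) = s • LinearMap.rTensor 𝔤 d w + d s • w := by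
  induction w using TensorProduct.induction_on with
  | zero => simp
  | tmul r x =>
    simp only [TensorProduct.smul_tmul', smul_eq_mul, LinearMap.rTensor_tmul, hd,
      TensorProduct.add_tmul]
  | add x y hx hy =>
    simp only [smul_add, map_add, hx, hy]
    abel

lemma rTensor_lie {d : R →ₗ[ℂ] R} (hd : ∀ a b, d (a * b) = a * d b + d a * b)
    (v w : R ⊗[ℂ] 𝔤) : LinearMap.rTensor 𝔤 d ⁅v, w⁆ =
      ⁅LinearMap.rTensor 𝔤 d v, w⁆ + ⁅v, LinearMap.rTensor 𝔤 d w⁆ := by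
  induction v using TensorProduct.induction_on with
  | zero => simp
  | tmul s x =>
    induction w using TensorProduct.induction_on with
    | zero => simp
    | tmul r y =>
      simp only [LieAlgebra.ExtendScalars.bracket_tmul, LinearMap.rTensor_tmul, hd,
        TensorProduct.add_tmul]
      rw [add_comm]
    | add y z hy hz =>
      rw [lie_add, map_add, hy, hz, map_add, lie_add, lie_add]
      abel
  | add y z hy hz =>
    rw [add_lie, map_add, hy, hz, map_add, add_lie, add_lie]
    abel

variable (F)

include F in
/-- Each `R`-point `k` of the adjoint group transforms the trivial connection to a connection: the
derivation `k ∘ d ∘ k⁻¹ - d` is inner, as its coefficients are derivations of a semisimple Lie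
algebra. The equivalence `e` provides the coefficients of the elements of `R`. -/
lemma exists_isGauge_zero [FiniteDimensional ℂ 𝔤] [LieAlgebra.IsKilling ℂ 𝔤] {ι : Type*}
    (e : R ≃ₗ[ℂ] (ι → ℂ)) {d : R →ₗ[ℂ] R} (hd : ∀ a b, d (a * b) = a * d b + d a * b)
    {k : (R ⊗[ℂ] 𝔤) ≃ₗ[R] (R ⊗[ℂ] 𝔤)} (hk : k ∈ adjPoints 𝔤 R) :
    ∃ A, IsGauge d k 0 A := by
  classical
  have hl : ∀ (r : R) (v w : R ⊗[ℂ] 𝔤), ⁅v, r • w⁆ = r • ⁅v, w⁆ := fun r v w => lie_smul r v w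
  have hd0 : ∀ x : 𝔤, LinearMap.rTensor 𝔤 d ((1 : R) ⊗ₜ[ℂ] x) = 0 := by
    intro x
    have h1 := hd 1 1
    rw [mul_one, one_mul, mul_one, left_eq_add] at h1
    rw [LinearMap.rTensor_tmul, h1, TensorProduct.zero_tmul]
  have hkk : ∀ x, k (k⁻¹ x) = x := fun x => k.apply_symm_apply x
  let c : ι → R →ₗ[ℂ] ℂ := fun n => LinearMap.proj n ∘ₗ e.toLinearMap
  -- on constant vectors, the operator `k ∘ d ∘ k⁻¹ - d`
  let D : 𝔤 → R ⊗[ℂ] 𝔤 := fun x => k (LinearMap.rTensor 𝔤 d (k⁻¹ (1 ⊗ₜ x)))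
  have hDl : ∀ x y : 𝔤, D ⁅x, y⁆ = ⁅(1 : R) ⊗ₜ[ℂ] x, D y⁆ - ⁅(1 : R) ⊗ₜ[ℂ] y, D x⁆ := by
    intro x y
    have e : (1 : R) ⊗ₜ[ℂ] ⁅x, y⁆ = ⁅(1 : R) ⊗ₜ[ℂ] x, (1 : R) ⊗ₜ[ℂ] y⁆ := by
      rw [LieAlgebra.ExtendScalars.bracket_tmul, one_mul]
    simp only [D]
    rw [e, F.map_lie_of_mem_adjPoints (inv_mem hk), rTensor_lie hd, map_add,
      F.map_lie_of_mem_adjPoints hk, F.map_lie_of_mem_adjPoints hk, hkk, hkk,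
      ← lie_skew _ ((1 : R) ⊗ₜ[ℂ] y)]
    abel
  let Dn : ι → LieDerivation ℂ 𝔤 𝔤 := fun n =>
    { toFun := fun x => contract (c n) (D x)
      map_add' := fun x y => by simp only [D, TensorProduct.tmul_add, map_add]
      map_smul' := fun a x => by
        simp only [D, TensorProduct.tmul_smul, RingHom.id_apply]
        rw [← map_smul (contract (c n))]
        congr 1
        rw [← algebraMap_smul R a ((1 : R) ⊗ₜ[ℂ] x), map_smul, algebraMap_smul, map_smul,
          ← algebraMap_smul R a, map_smul, algebraMap_smul]
      leibniz' := fun x y => by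
        change contract (c n) (D ⁅x, y⁆) = ⁅x, contract (c n) (D y)⁆ - ⁅y, contract (c n) (D x)⁆
        rw [hDl, map_sub, ← lie_skew _ (D y), ← lie_skew _ (D x), map_neg, map_neg, contract_lie,
          contract_lie, lie_skew, lie_skew] }
  choose a ha using fun n => LieDerivation.IsKilling.exists_eq_ad (Dn n)
  let A : R ⊗[ℂ] 𝔤 := ∑ k, e.symm (fun n => F.basis.repr (a n) k) • F.rb R k
  have hA : ∀ n, contract (c n) A = a n := by
    refine fun n => F.basis.ext_elem fun k => ?_
    rw [repr_contract, map_sum, Finsupp.finsetSum_apply, Finset.sum_eq_single k]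
    · rw [map_smul, Finsupp.smul_apply, Module.Basis.repr_self, Finsupp.single_eq_same,
        smul_eq_mul, mul_one]
      change e (e.symm _) n = _
      rw [LinearEquiv.apply_symm_apply]
    · intro l _ hl
      rw [map_smul, Finsupp.smul_apply, Module.Basis.repr_self, Finsupp.single_apply, if_neg hl,
        smul_zero]
    · simp
  have hAD : ∀ x : 𝔤, D x = ⁅A, (1 : R) ⊗ₜ[ℂ] x⁆ := by
    intro x
    refine (F.rb R).ext_elem fun l => e.injective (funext fun n => ?_)
    change c n _ = c n _
    rw [← repr_contract, ← repr_contract, contract_lie, hA]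
    have : ⁅a n, x⁆ = Dn n x := by rw [← ha n, LieDerivation.ad_apply_apply]
    exact congrArg (fun z => F.basis.repr z l) this.symm
  have hall : ∀ y : R ⊗[ℂ] 𝔤, k (LinearMap.rTensor 𝔤 d (k⁻¹ y)) =
      LinearMap.rTensor 𝔤 d y + ⁅A, y⁆ := by
    intro y
    induction y using TensorProduct.induction_on with
    | zero => simp
    | tmul s x =>
      have e : s ⊗ₜ[ℂ] x = s • ((1 : R) ⊗ₜ[ℂ] x) := by simp [TensorProduct.smul_tmul']
      rw [e, map_smul, rTensor_smul hd, rTensor_smul hd, hd0, hl, ← hAD, map_add, map_smul,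
        map_smul, hkk, smul_zero, zero_add, add_comm]
    | add y z hy hz =>
      simp only [map_add, lie_add, hy, hz]
      abel
  refine ⟨A, fun x => ?_⟩
  rw [zero_lie, add_zero, ← hall]
  have : k⁻¹ (k x) = x := k.symm_apply_apply x
  rw [this]

end Coefficients

/-- An oper with trivial underlying local system is equivalent to a connection on the disc whose
symbol consists of non-zero functions. -/
theorem exists_isGauge_of_trivial [FiniteDimensional ℂ 𝔤] [LieAlgebra.IsKilling ℂ 𝔤]
    {g : (ℂ⸨X⸩ ⊗[ℂ] 𝔤) ≃ₗ[ℂ⸨X⸩] (ℂ⸨X⸩ ⊗[ℂ] 𝔤)} (hg : g ∈ adjPoints 𝔤 ℂ⸨X⸩)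
    {A : ℂ⸨X⸩ ⊗[ℂ] 𝔤} {ψ : S → ℂ⸨X⸩} (hψ : ∀ i, ψ i ≠ 0) (hA : F.HasSymbol A ψ)
    (h : IsGauge dLaurent g A 0) :
    ∃ b ∈ adjPoints 𝔤 ℂ⸨X⸩, (∀ x ∈ F.gr ℂ⸨X⸩ (Set.Ici 0), b x ∈ F.gr ℂ⸨X⸩ (Set.Ici 0)) ∧
      (∀ x ∈ F.gr ℂ⸨X⸩ (Set.Ici 0), b⁻¹ x ∈ F.gr ℂ⸨X⸩ (Set.Ici 0)) ∧
      ∃ (A' : ℂ⟦X⟧ ⊗[ℂ] 𝔤) (ψ' : S → ℂ⟦X⟧), (∀ i, ψ' i ≠ 0) ∧ F.HasSymbol A' ψ' ∧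
        IsGauge dLaurent b A (extVec toLaurent A') := by
  -- write `g⁻¹ = b⁻¹ k` by the Iwasawa decomposition: then `b = k g` transforms `A` to the transform of
  -- the trivial connection by `k`, which is integral
  obtain ⟨k, hk, hgk⟩ := exists_conjBorel_eq (F := F) (inv_mem hg)
  obtain ⟨A', hA'⟩ := exists_isGauge_zero F
    (LinearEquiv.refl ℂ ℂ⟦X⟧ : ℂ⟦X⟧ ≃ₗ[ℂ] ((Unit →₀ ℕ) → ℂ)) (d := dPower) (fun a b => by
      change PowerSeries.derivative ℂ (a * b) = a * PowerSeries.derivative ℂ b +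
        PowerSeries.derivative ℂ a * b
      rw [Derivation.leibniz, smul_eq_mul, smul_eq_mul, mul_comm b]) hk
  have hkK := isGauge_extGL hA'
  rw [map_zero] at hkK
  set b := extGL toLaurent k * g with hb
  have hgauge : IsGauge dLaurent b A (extVec toLaurent A') := h.trans hkK
  have hbG : b ∈ adjPoints 𝔤 ℂ⸨X⸩ := mul_mem (extGL_mem_adjPoints _ hk) hg
  have hbinv : b⁻¹ = g⁻¹ * extGL toLaurent k⁻¹ := by rw [hb, mul_inv_rev, extGL_inv]
  rw [← hbinv] at hgk
  have hB' : ∀ x ∈ F.gr ℂ⸨X⸩ (Set.Ici 0), b⁻¹ x ∈ F.gr ℂ⸨X⸩ (Set.Ici 0) := by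
    intro x hx
    rw [← hgk] at hx
    exact hx
  have hbb : ∀ x, b⁻¹ (b x) = x := fun x => b.symm_apply_apply x
  have hbb' : ∀ x, b (b⁻¹ x) = x := fun x => b.apply_symm_apply x
  have hB : ∀ x ∈ F.gr ℂ⸨X⸩ (Set.Ici 0), b x ∈ F.gr ℂ⸨X⸩ (Set.Ici 0) := by
    intro x hx
    rw [← hgk, mem_conjBorel, hbb]
    exact hx
  -- oper forms are preserved by `b` and can be recognized over `ℂ((t))`
  have hsymK : ∀ y ∈ F.gr ℂ⸨X⸩ (Set.Ioi 0),
      ⁅extVec toLaurent A', y⁆ ∈ F.gr ℂ⸨X⸩ (Set.Ici 0) := by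
    intro y hy
    have hx := F.map_mem_gr_pos (inv_mem hbG) hB' hy
    have h1 := hgauge (b⁻¹ y)
    rw [hbb'] at h1
    rw [← sub_eq_iff_eq_add'.mpr h1]
    refine sub_mem (hB _ (add_mem ?_ (hA.lie_mem hx))) ?_
    · exact rTensor_mem_gr _ (F.gr_mono Set.Ioi_subset_Ici_self hx)
    · exact rTensor_mem_gr _ (F.gr_mono Set.Ioi_subset_Ici_self hy)
  have hsym : F.HasSymbol A' fun i => (F.rb ℂ⟦X⟧).repr A' (F.negRoot i) := by
    refine hasSymbol_of_lie_mem fun x hx => F.mem_gr_of_extVec_mem toLaurent_injective ?_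
    rw [extVec_lie]
    exact hsymK _ (F.extVec_mem_gr _ hx)
  refine ⟨b, hbG, hB, hB', A', _, fun i h0 => hψ i ?_, hsym, hgauge⟩
  have h1 := HasSymbol.dvd (inv_mem hbG) hB' (by rwa [inv_inv]) hgauge.symm
    (hasSymbol_of_lie_mem hsymK) hA i
  rw [repr_extVec, h0, map_zero, zero_dvd_iff] at h1
  exact h1

end RootFrame

/-! ### The root frame of a base -/

/-- Finitely many distinct integral vectors are separated by a linear form with positive integral
coefficients. -/
lemma exists_pos_separating {S Φ : Type*} [Fintype S] [Finite Φ] (c : Φ → S → ℤ)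
    (hc : Function.Injective c) :
    ∃ h : S → ℤ, (∀ i, 0 < h i) ∧ Function.Injective fun α => ∑ i, h i * c α i := by
  classical
  have := Fintype.ofFinite Φ
  -- the coefficients are powers of a common integer which avoids the roots of finitely many
  -- non-zero polynomials
  let e := Fintype.equivFin S
  let p : Φ → Polynomial ℤ := fun α => ∑ i, Polynomial.monomial (e i : ℕ) (c α i)
  have hcoeff : ∀ α i, (p α).coeff (e i : ℕ) = c α i := by
    intro α i
    simp only [p, Polynomial.finsetSum_coeff, Polynomial.coeff_monomial]
    rw [Finset.sum_eq_single i]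
    · simp
    · intro j _ hj
      rw [if_neg]
      intro h
      exact hj (e.injective (Fin.ext h))
    · simp
  have hp : Function.Injective p := fun α β h => hc (funext fun i => by
    rw [← hcoeff, ← hcoeff, h])
  let q : Polynomial ℤ := ∏ x ∈ (Finset.univ : Finset (Φ × Φ)).filter (fun x => x.1 ≠ x.2),
    (p x.1 - p x.2)
  have hq : q ≠ 0 := Finset.prod_ne_zero_iff.mpr fun x hx =>
    sub_ne_zero.mpr fun h => (Finset.mem_filter.mp hx).2 (hp h)
  obtain ⟨B, hB, hB'⟩ : ∃ B : ℤ, 0 < B ∧ ¬ q.IsRoot B := by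
    by_contra! h
    exact (Set.Ioi_infinite (0 : ℤ)) ((Polynomial.finite_setOfPred_isRoot hq).subset fun B hB => h B hB)
  refine ⟨fun i => B ^ (e i : ℕ), fun i => pow_pos hB _, fun α β h => ?_⟩
  by_contra hne
  apply hB'
  have heval : ∀ α, (p α).eval B = ∑ i, B ^ (e i : ℕ) * c α i := by
    intro α
    simp only [p, Polynomial.eval_finsetSum, Polynomial.eval_monomial, mul_comm]
  rw [Polynomial.IsRoot, Polynomial.eval_prod]
  refine Finset.prod_eq_zero (i := (α, β)) (by simpa using hne) ?_
  rw [Polynomial.eval_sub, heval, heval]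
  exact sub_eq_zero.mpr h

section Frame

open LieAlgebra LieAlgebra.IsKilling LieModule

variable {𝔤 : Type*} [LieRing 𝔤] [LieAlgebra ℂ 𝔤] [FiniteDimensional ℂ 𝔤] [IsKilling ℂ 𝔤]
  {H : LieSubalgebra ℂ 𝔤} [H.IsCartanSubalgebra]

/-- A root vector. -/
def rootVec (α : H.root) : 𝔤 := α.1.exists_ne_zero.choose

omit [IsKilling ℂ 𝔤] in
lemma rootVec_mem (α : H.root) : rootVec α ∈ rootSpace H α.1 := α.1.exists_ne_zero.choose_spec.1

omit [IsKilling ℂ 𝔤] in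
lemma rootVec_ne_zero (α : H.root) : rootVec α ≠ 0 := α.1.exists_ne_zero.choose_spec.2

lemma exists_smul_rootVec {α : H.root} {x : 𝔤} (hx : x ∈ rootSpace H α.1) :
    ∃ c : ℂ, x = c • rootVec α := by
  obtain ⟨c, hc⟩ := (finrank_eq_one_iff_of_nonzero' (⟨rootVec α, rootVec_mem α⟩ : rootSpace H α.1)
    (by simpa using rootVec_ne_zero α)).mp (finrank_rootSpace_eq_one α.1 (H.isNonZero_coe_root α)) ⟨x, hx⟩
  exact ⟨c, by simpa using (congrArg Subtype.val hc).symm⟩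

/-- The negative of a root. -/
def negRootOf (α : H.root) : H.root :=
  ⟨-α.1, by simpa using (H.isNonZero_coe_root α).neg⟩

lemma rootVec_neg_mem (α : H.root) : rootVec (negRootOf α) ∈ rootSpace H (-(α.1 : H → ℂ)) :=
  rootVec_mem (negRootOf α)

omit [IsKilling ℂ 𝔤] in
lemma root_ne_zero (α : H.root) : (α.1 : H → ℂ) ≠ 0 := H.isNonZero_coe_root α

lemma killingForm_rootVec_neg_ne_zero (α : H.root) :
    killingForm ℂ 𝔤 (rootVec α) (rootVec (negRootOf α)) ≠ 0 := by
  intro h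
  apply rootVec_ne_zero α
  have := mem_ker_killingForm_of_mem_rootSpace_of_forall_rootSpace_neg ℂ 𝔤 H (rootVec_mem α)
    (fun y hy => by
      obtain ⟨c, rfl⟩ := exists_smul_rootVec (α := negRootOf α) hy
      rw [map_smul, h, smul_zero])
  simpa using this

lemma killingForm_rootVec_neg_of_ne {α β : H.root} (h : α ≠ β) :
    killingForm ℂ 𝔤 (rootVec α) (rootVec (negRootOf β)) = 0 := by
  refine killingForm_apply_eq_zero_of_mem_rootSpace_of_add_ne_zero ℂ 𝔤 H (rootVec_mem α)
    (rootVec_neg_mem β) fun h0 => h ?_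
  apply Subtype.ext
  apply DFunLike.coe_injective
  exact add_neg_eq_zero.mp h0

lemma killingForm_cartan_rootVec_neg (x : H) (β : H.root) :
    killingForm ℂ 𝔤 (x : 𝔤) (rootVec (negRootOf β)) = 0 := by
  refine killingForm_apply_eq_zero_of_mem_rootSpace_of_add_ne_zero ℂ 𝔤 H (α := 0) ?_
    (rootVec_neg_mem β) ?_
  · rw [rootSpace_zero_eq]
    exact x.2
  · rw [zero_add]
    exact neg_ne_zero.mpr (root_ne_zero β)

/-- A bracket of opposite root vectors is a non-zero multiple of a coroot. -/
lemma exists_lie_rootVec_neg (α : H.root) :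
    ∃ c : ℂ, c ≠ 0 ∧ (coroot α.1 : 𝔤) = c • ⁅rootVec α, rootVec (negRootOf α)⁆ := by
  have h0 := root_apply_cartanEquivDual_symm_ne_zero (H.isNonZero_coe_root α)
  have h1 := killingForm_rootVec_neg_ne_zero α
  refine ⟨2 * (α.1 ((cartanEquivDual H).symm α.1))⁻¹ *
    (killingForm ℂ 𝔤 (rootVec α) (rootVec (negRootOf α)))⁻¹, ?_, ?_⟩
  · exact mul_ne_zero (mul_ne_zero two_ne_zero (inv_ne_zero h0)) (inv_ne_zero h1)
  · rw [lie_eq_killingForm_smul_of_mem_rootSpace_of_mem_rootSpace_neg (rootVec_mem α)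
      (rootVec_neg_mem α), smul_smul, mul_assoc, inv_mul_cancel₀ h1, mul_one, coroot]
    push_cast
    rw [← Nat.cast_smul_eq_nsmul ℂ, smul_smul]
    norm_num

lemma lie_cartan_rootVec (x : H) (α : H.root) : ⁅(x : 𝔤), rootVec α⁆ = α.1 x • rootVec α :=
  lie_eq_smul_of_mem_rootSpace (rootVec_mem α) x

lemma lie_coe_cartan (x y : H) : ⁅(x : 𝔤), (y : 𝔤)⁆ = 0 := by
  rw [← LieSubalgebra.coe_bracket, trivial_lie_zero]
  rfl

variable (b : (rootSystem H).Base)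

open scoped Classical in
/-- The fundamental coweights of a base, the basis of the Cartan subalgebra dual to the simple
roots. -/
def fundCoweight : Module.Basis b.support ℂ H :=
  b.toWeightBasis.dualBasis.map (Module.evalEquiv ℂ H).symm

open scoped Classical in
lemma simple_fundCoweight (i j : b.support) :
    (i.1.1 : Weight ℂ H 𝔤) (fundCoweight b j) = if i = j then 1 else 0 := by
  have h : b.toWeightBasis i (fundCoweight b j) = b.toWeightBasis.dualBasis j (b.toWeightBasis i) := by
    rw [fundCoweight, Module.Basis.map_apply]
    exact LinearMap.congr_fun ((Module.evalEquiv ℂ H).apply_symm_apply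
      (b.toWeightBasis.dualBasis j)) (b.toWeightBasis i)
  rw [Module.Basis.dualBasis_apply, Module.Basis.repr_self, Finsupp.single_apply,
    RootPairing.Base.toWeightBasis_apply] at h
  exact h

lemma fundCoweight_repr (x : H) (i : b.support) :
    (fundCoweight b).repr x i = (i.1.1 : Weight ℂ H 𝔤) x := by
  conv_rhs => rw [← (fundCoweight b).sum_repr x]
  rw [← Weight.toLinear_apply, map_sum]
  simp only [map_smul, Weight.toLinear_apply, simple_fundCoweight]
  simp

/-- The coefficients of a root in terms of the simple roots. -/
def rootCoeff (α : H.root) (i : b.support) : ℤ := (b.exists_root_eq_sum_int α).choose i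

lemma root_eq_sum_rootCoeff (α : H.root) :
    (rootSystem H).root α = ∑ j ∈ b.support, (b.exists_root_eq_sum_int α).choose j •
      (rootSystem H).root j :=
  (b.exists_root_eq_sum_int α).choose_spec.2.2

lemma apply_fundCoweight (α : H.root) (i : b.support) :
    α.1 (fundCoweight b i) = (rootCoeff b α i : ℂ) := by
  have h := LinearMap.congr_fun (root_eq_sum_rootCoeff b α) (fundCoweight b i)
  rw [← Finset.sum_coe_sort] at h
  rw [LinearMap.sum_apply] at h
  simp only [LinearMap.smul_apply, rootSystem_root_apply, Weight.toLinear_apply,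
    simple_fundCoweight] at h
  rw [h]
  simp [rootCoeff]

lemma root_ext_rootCoeff {α : H.root} {φ : Module.Dual ℂ H}
    (h : ∀ i, α.1 (fundCoweight b i) = φ (fundCoweight b i)) : (rootSystem H).root α = φ :=
  (fundCoweight b).ext h

lemma rootCoeff_injective : Function.Injective (rootCoeff b) := by
  intro α β h
  apply (rootSystem H).root.injective
  refine root_ext_rootCoeff b fun i => ?_
  rw [rootSystem_root_apply, Weight.toLinear_apply, apply_fundCoweight, apply_fundCoweight, h]

lemma height_eq_sum_rootCoeff (α : H.root) : b.height α = ∑ i, rootCoeff b α i := by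
  rw [b.height_eq_sum (root_eq_sum_rootCoeff b α), ← Finset.sum_coe_sort]
  rfl

lemma rootCoeff_pos_or_neg (α : H.root) :
    (∀ i, 0 ≤ rootCoeff b α i) ∨ (∀ i, rootCoeff b α i ≤ 0) :=
  (b.exists_root_eq_sum_int α).choose_spec.2.1.imp (fun h i => h.le i) (fun h i => h.le i)

/-- Positive roots are positive on every coweight in the open dominant chamber. -/
lemma sum_mul_rootCoeff_pos_iff {h : b.support → ℤ} (hh : ∀ i, 0 < h i) (α : H.root) :
    0 < ∑ i, h i * rootCoeff b α i ↔ b.IsPos α := by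
  rw [RootPairing.Base.isPos_iff, height_eq_sum_rootCoeff]
  rcases rootCoeff_pos_or_neg b α with h0 | h0
  · rw [Finset.sum_pos_iff_of_nonneg fun i _ => mul_nonneg (hh i).le (h0 i),
      Finset.sum_pos_iff_of_nonneg fun i _ => h0 i]
    simp only [mul_pos_iff_of_pos_left (hh _)]
  · refine iff_of_false (not_lt.mpr (Finset.sum_nonpos fun i _ => ?_))
      (not_lt.mpr (Finset.sum_nonpos fun i _ => h0 i))
    exact mul_nonpos_of_nonneg_of_nonpos (hh i).le (h0 i)

lemma isPos_neg_iff (α : H.root) : b.IsPos (negRootOf α) ↔ ¬ b.IsPos α := by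
  have h : b.height (negRootOf α) = - b.height α := by
    rw [height_eq_sum_rootCoeff, height_eq_sum_rootCoeff, ← Finset.sum_neg_distrib]
    refine Finset.sum_congr rfl fun i _ => ?_
    have : ((rootCoeff b (negRootOf α) i : ℤ) : ℂ) = ((- rootCoeff b α i : ℤ) : ℂ) := by
      push_cast
      rw [← apply_fundCoweight, ← apply_fundCoweight]
      rfl
    exact_mod_cast this
  have := b.height_ne_zero α
  rw [RootPairing.Base.isPos_iff, RootPairing.Base.isPos_iff, h]
  omega

/-- The fundamental coweights and the root vectors. -/
def frameVec : b.support ⊕ H.root → 𝔤 :=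
  Sum.elim (fun i => (fundCoweight b i : 𝔤)) rootVec

lemma linearIndependent_frameVec : LinearIndependent ℂ (frameVec b) := by
  classical
  rw [Fintype.linearIndependent_iff]
  intro c hc
  rw [Fintype.sum_sum_type] at hc
  simp only [frameVec, Sum.elim_inl, Sum.elim_inr] at hc
  -- the Killing form against `e (-β)` isolates the coefficient of `e β`
  have h1 : ∀ β : H.root, c (Sum.inr β) = 0 := by
    intro β
    have h := congrArg (fun x => killingForm ℂ 𝔤 x (rootVec (negRootOf β))) hc
    simp only [map_add, map_sum, map_smul, LinearMap.add_apply, LinearMap.sum_apply,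
      LinearMap.smul_apply, killingForm_cartan_rootVec_neg, smul_zero, Finset.sum_const_zero,
      zero_add, map_zero, LinearMap.zero_apply] at h
    rw [Finset.sum_eq_single β (fun α _ hα => by
      rw [killingForm_rootVec_neg_of_ne hα, smul_zero]) (by simp)] at h
    exact (smul_eq_zero.mp h).resolve_right (killingForm_rootVec_neg_ne_zero β)
  simp only [h1, zero_smul, Finset.sum_const_zero, add_zero] at hc
  have h2 : ∑ i, c (Sum.inl i) • fundCoweight b i = 0 := by
    apply Subtype.ext
    rw [ZeroMemClass.coe_zero, ← hc]
    push_cast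
    rfl
  rintro (i | β)
  · exact Fintype.linearIndependent_iff.mp (fundCoweight b).linearIndependent _ h2 i
  · exact h1 β

lemma cartan_le_span_fundCoweight (x : H) :
    (x : 𝔤) ∈ Submodule.span ℂ (Set.range fun i => (fundCoweight b i : 𝔤)) := by
  have h := congrArg Subtype.val ((fundCoweight b).sum_repr x)
  rw [← h]
  push_cast
  exact Submodule.sum_mem _ fun i _ => Submodule.smul_mem _ _ (Submodule.subset_span ⟨i, rfl⟩)

lemma span_frameVec : ⊤ ≤ Submodule.span ℂ (Set.range (frameVec b)) := by
  intro x hx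
  clear hx
  have hx : x ∈ ⨆ χ : Weight ℂ H 𝔤, rootSpace H χ := by
    rw [LieModule.iSup_genWeightSpace_eq_top']
    trivial
  induction hx using LieSubmodule.iSup_induction' with
  | mem χ x hx =>
    by_cases hχ : χ.IsZero
    · rw [show (χ : H → ℂ) = 0 from hχ, rootSpace_zero_eq] at hx
      refine Submodule.span_mono ?_ (cartan_le_span_fundCoweight b ⟨x, hx⟩)
      rintro _ ⟨i, rfl⟩
      exact ⟨Sum.inl i, rfl⟩
    · obtain ⟨c, rfl⟩ := exists_smul_rootVec (α := (⟨χ, by simpa using hχ⟩ : H.root)) hx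
      exact Submodule.smul_mem _ _ (Submodule.subset_span ⟨Sum.inr ⟨χ, by simpa using hχ⟩, rfl⟩)
  | zero => exact zero_mem _
  | add x y _ _ hx hy => exact add_mem hx hy

/-- The basis of `𝔤` formed by the fundamental coweights and by root vectors. -/
def frameBasis : Module.Basis (b.support ⊕ H.root) ℂ 𝔤 :=
  Module.Basis.mk (linearIndependent_frameVec b) (span_frameVec b)

@[simp] lemma frameBasis_inl (i : b.support) : frameBasis b (Sum.inl i) = fundCoweight b i := by
  simp [frameBasis, frameVec]

@[simp] lemma frameBasis_inr (α : H.root) : frameBasis b (Sum.inr α) = rootVec α := by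
  simp [frameBasis, frameVec]

/-- The values of roots on the fundamental coweights. -/
def rootWt (α : H.root) (i : b.support) : ℂ := α.1 (fundCoweight b i)

lemma lie_frameBasis (i : b.support) (k : b.support ⊕ H.root) :
    ⁅frameBasis b (Sum.inl i), frameBasis b k⁆ =
      Sum.elim (fun _ => (0 : b.support → ℂ)) (rootWt b) k i • frameBasis b k := by
  rcases k with j | α
  · simp [lie_coe_cartan]
  · rw [frameBasis_inl, frameBasis_inr, lie_cartan_rootVec]
    rfl

omit [FiniteDimensional ℂ 𝔤] [IsKilling ℂ 𝔤] in
/-- The vectors of an eigenbasis of commuting derivations `⁅ω i, ·⁆` multiply additively. -/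
lemma wt_add_of_lie_eq {S κ : Type*} [Fintype κ] (B : Module.Basis κ ℂ 𝔤) (ω : S → 𝔤)
    (w : κ → S → ℂ)
    (h : ∀ i k, ⁅ω i, B k⁆ = w k i • B k) {j k l : κ} (hl : B.repr ⁅B j, B k⁆ l ≠ 0) :
    w l = w j + w k := by
  funext i
  have h1 : ∀ y : 𝔤, B.repr ⁅ω i, y⁆ l = w l i * B.repr y l := by
    intro y
    conv_lhs => rw [← B.sum_repr y]
    classical
    rw [lie_sum]
    simp only [lie_smul, h, map_sum, map_smul, Finsupp.coe_finsetSum, Finset.sum_apply,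
      Finsupp.smul_apply, Module.Basis.repr_self, Finsupp.single_apply, smul_eq_mul, mul_ite,
      mul_one, mul_zero, Finset.sum_ite_eq', Finset.mem_univ, if_true]
    exact mul_comm _ _
  have h2 : ⁅ω i, ⁅B j, B k⁆⁆ = (w j i + w k i) • ⁅B j, B k⁆ := by
    rw [leibniz_lie, h, h, smul_lie, lie_smul, add_smul]
  have h3 := h1 ⁅B j, B k⁆
  rw [h2, map_smul, Finsupp.smul_apply, smul_eq_mul] at h3
  exact (mul_right_cancel₀ hl h3).symm

open scoped Classical in
lemma rootWt_simple (i j : b.support) : rootWt b i.1 j = if i = j then 1 else 0 :=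
  simple_fundCoweight b i j

lemma root_eq_of_rootWt {γ β : H.root} {i : b.support} {c : ℂ}
    (h : rootWt b γ = rootWt b β - c • rootWt b i.1) :
    (rootSystem H).root γ = (rootSystem H).root β - c • (rootSystem H).root i.1 :=
  root_ext_rootCoeff b fun j => congrFun h j

lemma sum_repr_coroot_mul (i : b.support) (β : H.root) :
    ∑ k, (fundCoweight b).repr (coroot i.1.1) k * rootWt b β k = β.1 (coroot i.1.1) := by
  conv_rhs => rw [← (fundCoweight b).sum_repr (coroot i.1.1)]
  rw [← Weight.toLinear_apply, map_sum]
  simp only [map_smul, Weight.toLinear_apply, smul_eq_mul]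
  rfl

/-- The simple root vector that does not annihilate a given negative root vector, which exists as
a negative root vector is not a primitive vector for all simple `𝔰𝔩₂`. -/
lemma exists_lie_rootVec_simple_ne_zero {β : H.root} (hβ : b.IsPos β) :
    ∃ i : b.support, ⁅rootVec i.1, rootVec (negRootOf β)⁆ ≠ 0 := by
  obtain ⟨i, hi, hpos⟩ := hβ.exists_mem_support_pos_pairingIn
  rw [RootPairing.zero_lt_pairingIn_iff'] at hpos
  refine ⟨⟨i, hi⟩, fun h0 => ?_⟩
  have hnz := H.isNonZero_coe_root i
  obtain ⟨h, e, f, ht, he, hf⟩ := exists_isSl2Triple_of_weight_isNonZero hnz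
  have hc := ht.h_eq_coroot hnz he hf
  obtain ⟨c, rfl⟩ := exists_smul_rootVec he
  have hP : ht.HasPrimitiveVectorWith (rootVec (negRootOf β)) (-(β.1 (coroot i.1))) :=
    { ne_zero := rootVec_ne_zero _
      lie_h := by
        rw [hc, lie_cartan_rootVec]
        rfl
      lie_e := by rw [smul_lie, h0, smul_zero] }
  obtain ⟨n, hn⟩ := hP.exists_nat
  have h1 : ((rootSystem H).pairingIn ℤ β i : ℂ) = β.1 (coroot i.1) := by
    have := (rootSystem H).algebraMap_pairingIn ℤ β i
    rw [rootSystem_pairing_apply] at this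
    exact this
  rw [← h1] at hn
  have h2 : -((rootSystem H).pairingIn ℤ β i) = n := by exact_mod_cast hn
  omega

/-- The root frame of a base of the root system. -/
def rootFrame : RootFrame 𝔤 b.support H.root :=
  let h := exists_pos_separating (rootCoeff b) (rootCoeff_injective b)
  have hpos : ∀ α, 0 < ∑ i, h.choose i * rootCoeff b α i ↔ b.IsPos α :=
    sum_mul_rootCoeff_pos_iff b h.choose_spec.1
  { basis := frameBasis b
    wt := rootWt b
    deg := fun α => ∑ i, h.choose i * rootCoeff b α i
    ht := h.choose
    neg := negRootOf
    simple := fun i => i.1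
    refl := fun i => (rootSystem H).reflectionPerm i.1
    cor := fun i => (fundCoweight b).repr (coroot i.1.1)
    lie_cartan := lie_frameBasis b
    wt_add := fun j k l hl => wt_add_of_lie_eq (frameBasis b) _ _ (lie_frameBasis b) hl
    deg_eq := fun α => by
      push_cast
      simp only [rootWt, apply_fundCoweight]
    deg_injective := h.choose_spec.2
    deg_ne_zero := fun α h0 => by
      have h1 := hpos α
      have h2 := hpos (negRootOf α)
      have h3 : ∑ i, h.choose i * rootCoeff b (negRootOf α) i = 0 := by
        have : ((∑ i, h.choose i * rootCoeff b (negRootOf α) i : ℤ) : ℂ) =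
            ((-∑ i, h.choose i * rootCoeff b α i : ℤ) : ℂ) := by
          push_cast
          simp only [← apply_fundCoweight, ← Finset.sum_neg_distrib, ← mul_neg]
          rfl
        rw [h0] at this
        exact_mod_cast this
      rw [h3, isPos_neg_iff] at h2
      rw [h0] at h1
      have := h1.symm.trans (by simp : (0 : ℤ) < 0 ↔ False)
      simp [this] at h2
    wt_neg := fun α => rfl
    wt_simple_self := fun i => by rw [rootWt_simple, if_pos rfl]
    wt_simple_of_ne := fun i j hij => by rw [rootWt_simple, if_neg (Ne.symm hij)]
    deg_simple_pos := fun i => (hpos _).mpr (b.isPos_of_mem_support i.2)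
    killing_ne_zero := fun α => by
      obtain ⟨c, hc, h1⟩ := exists_lie_rootVec_neg α
      rw [frameBasis_inr, frameBasis_inr]
      intro h0
      have h2 : killingForm ℂ 𝔤 (coroot α.1 : 𝔤) (coroot α.1 : 𝔤) = 0 := by
        rw [h1, map_smul, map_smul, LinearMap.smul_apply, h0, smul_zero, smul_zero]
      have h3 := traceForm_coroot α.1 (coroot α.1)
      rw [root_apply_coroot (H.isNonZero_coe_root α)] at h3
      change killingForm ℂ 𝔤 (coroot α.1 : 𝔤) (coroot α.1 : 𝔤) = _ at h3
      rw [h2] at h3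
      have := root_apply_cartanEquivDual_symm_ne_zero (H.isNonZero_coe_root α)
      simp [this] at h3
    exists_lie_simple_ne_zero := fun β hβ => by
      obtain ⟨i, hi⟩ := exists_lie_rootVec_simple_ne_zero b ((hpos β).mp hβ)
      exact ⟨i, by rwa [frameBasis_inr, frameBasis_inr]⟩
    wt_refl := fun i β => by
      funext j
      rw [sum_repr_coroot_mul]
      have := LinearMap.congr_fun ((rootSystem H).root_reflectionPerm i.1 β) (fundCoweight b j)
      rw [RootPairing.reflection_apply_root] at this
      exact this
    deg_refl_pos := fun i β hβ hne => (hpos _).mpr (((hpos _).mp hβ).reflectionPerm i.2 hne)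
    deg_sub_simple_pos := fun i β γ hβ hγ => (hpos _).mpr (((hpos _).mp hβ).sub i.2 (by
      have := root_eq_of_rootWt b (γ := γ) (β := β) (i := i) (c := 1) (by rw [one_smul, hγ])
      rwa [one_smul] at this))
    exists_lie_eq_cor := fun i => by
      obtain ⟨c, hc, h1⟩ := exists_lie_rootVec_neg i.1
      refine ⟨c, ?_⟩
      rw [frameBasis_inr, frameBasis_inr, lie_smul, ← h1]
      have := congrArg Subtype.val ((fundCoweight b).sum_repr (coroot i.1.1))
      rw [← this]
      push_cast
      simp
    cor_self := fun i => by
      rw [fundCoweight_repr, root_apply_coroot (H.isNonZero_coe_root i.1)] }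

end Frame

/-! ### Opers in terms of the root frame -/

section OperForm

open LieAlgebra LieAlgebra.IsKilling LieModule

variable {𝔤 : Type*} [LieRing 𝔤] [LieAlgebra ℂ 𝔤] [FiniteDimensional ℂ 𝔤] [IsSimple ℂ 𝔤]
  {H : LieSubalgebra ℂ 𝔤} [H.IsCartanSubalgebra] (b : (rootSystem H).Base)
  {R : Type*} [CommRing R] [Algebra ℂ R]

lemma rootFrame_deg_pos_iff (α : H.root) : 0 < (rootFrame b).deg α ↔ b.IsPos α :=
  sum_mul_rootCoeff_pos_iff b
    (exists_pos_separating (rootCoeff b) (rootCoeff_injective b)).choose_spec.1 α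

lemma borel_eq_span :
    borel b = Submodule.span ℂ {x | ∃ k, (rootFrame b).height k ∈ Set.Ici 0 ∧
      x = frameBasis b k} := by
  have hdeg : ∀ α : H.root, (rootFrame b).deg α ∈ Set.Ici 0 ↔ b.IsPos α := fun α => by
    rw [← rootFrame_deg_pos_iff, Set.mem_Ici, lt_iff_le_and_ne]
    exact (and_iff_left ((rootFrame b).deg_ne_zero α).symm).symm
  apply le_antisymm
  · refine sup_le (fun x hx => ?_) (iSup₂_le fun α hα x hx => ?_)
    · refine Submodule.span_mono ?_ (cartan_le_span_fundCoweight b ⟨x, hx⟩)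
      rintro _ ⟨i, rfl⟩
      exact ⟨Sum.inl i, le_refl (0 : ℤ), (frameBasis_inl b i).symm⟩
    · obtain ⟨c, rfl⟩ := exists_smul_rootVec hx
      exact Submodule.smul_mem _ _ (Submodule.subset_span
        ⟨Sum.inr α, (hdeg α).mpr hα, (frameBasis_inr b α).symm⟩)
  · rw [Submodule.span_le]
    rintro _ ⟨i | α, hk, rfl⟩
    · rw [frameBasis_inl]
      exact Submodule.mem_sup_left (fundCoweight b i).2
    · rw [frameBasis_inr]
      exact Submodule.mem_sup_right (Submodule.mem_iSup_of_mem α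
        (Submodule.mem_iSup_of_mem ((hdeg α).mp hk) (rootVec_mem α)))

lemma baseChange_borel : (borel b).baseChange R = (rootFrame b).gr R (Set.Ici 0) := by
  rw [borel_eq_span, Submodule.baseChange_span, RootFrame.gr_eq_span]
  congr 1
  ext x
  constructor
  · rintro ⟨_, ⟨k, hk, rfl⟩, rfl⟩
    exact ⟨k, hk, (Module.Basis.baseChange_apply R (frameBasis b) k).symm⟩
  · rintro ⟨k, hk, rfl⟩
    exact ⟨_, ⟨k, hk, rfl⟩, (Module.Basis.baseChange_apply R (frameBasis b) k).symm⟩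

lemma mem_borelPoints_iff (g : (R ⊗[ℂ] 𝔤) ≃ₗ[R] (R ⊗[ℂ] 𝔤)) :
    g ∈ borelPoints b R ↔ g ∈ adjPoints 𝔤 R ∧
      (∀ x ∈ (rootFrame b).gr R (Set.Ici 0), g x ∈ (rootFrame b).gr R (Set.Ici 0)) ∧
      ∀ x ∈ (rootFrame b).gr R (Set.Ici 0), g⁻¹ x ∈ (rootFrame b).gr R (Set.Ici 0) := by
  have h1 : ∀ g ∈ borelPoints b R, ∀ x ∈ (rootFrame b).gr R (Set.Ici 0),
      g x ∈ (rootFrame b).gr R (Set.Ici 0) := by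
    intro g hg x hx
    have h2 : ((borel b).baseChange R).map g.toLinearMap = (borel b).baseChange R := hg.2
    rw [baseChange_borel] at h2
    rw [← h2]
    exact Submodule.mem_map_of_mem hx
  refine ⟨fun hg => ⟨hg.1, h1 g hg, h1 g⁻¹ (inv_mem hg)⟩, fun hg => ⟨hg.1, ?_⟩⟩
  change ((borel b).baseChange R).map g.toLinearMap = (borel b).baseChange R
  rw [baseChange_borel]
  refine le_antisymm (Submodule.map_le_iff_le_comap.mpr hg.2.1) fun x hx => ?_
  exact ⟨g⁻¹ x, hg.2.2 x hx, g.apply_symm_apply x⟩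

variable {b} {f : b.support → 𝔤} {c : b.support → ℂ}

/-- The operators that appear in the definition of opers are those with a given symbol. -/
lemma exists_mem_borel_iff_hasSymbol (hf : ∀ i, f i = c i • rootVec (negRootOf i.1))
    (A : R ⊗[ℂ] 𝔤) (ψ : b.support → R) :
    (∃ v ∈ (borel b).baseChange R, A = ∑ i, ψ i ⊗ₜ[ℂ] f i + v) ↔
      (rootFrame b).HasSymbol A fun i => c i • ψ i := by
  have h : ∑ i, (c i • ψ i) • (rootFrame b).rb R ((rootFrame b).negRoot i) =
      ∑ i, ψ i ⊗ₜ[ℂ] f i := by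
    refine Finset.sum_congr rfl fun i _ => ?_
    have h1 : (rootFrame b).rb R ((rootFrame b).negRoot i) = 1 ⊗ₜ rootVec (negRootOf i.1) :=
      (Module.Basis.baseChange_apply R (frameBasis b) _).trans (by rw [← frameBasis_inr b]; rfl)
    rw [h1, hf, TensorProduct.smul_tmul', smul_eq_mul, mul_one, TensorProduct.smul_tmul]
  rw [RootFrame.HasSymbol, h, baseChange_borel]
  constructor
  · rintro ⟨v, hv, rfl⟩
    rwa [add_sub_cancel_left]
  · exact fun h => ⟨_, h, (add_sub_cancel _ _).symm⟩

lemma isOper_iff (hf : ∀ i, f i = c i • rootVec (negRootOf i.1)) (A : ℂ⸨X⸩ ⊗[ℂ] 𝔤) :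
    IsOper b f A ↔ ∃ ψ : b.support → ℂ⸨X⸩, (∀ i, ψ i ≠ 0) ∧
      (rootFrame b).HasSymbol A fun i => c i • ψ i := by
  simp only [IsOper, exists_mem_borel_iff_hasSymbol hf]

lemma isOperOfWeight_iff (hf : ∀ i, f i = c i • rootVec (negRootOf i.1))
    (lam : DominantCoweight b) (A : ℂ⟦X⟧ ⊗[ℂ] 𝔤) :
    IsOperOfWeight f lam A ↔ ∃ ψ : b.support → ℂ⟦X⟧,
      (∀ i, PowerSeries.constantCoeff (ψ i) ≠ 0) ∧
      (rootFrame b).HasSymbol A fun i => c i • (PowerSeries.X ^ lam.pairing i * ψ i) := by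
  simp only [IsOperOfWeight, exists_mem_borel_iff_hasSymbol hf]

lemma exists_smul_rootVec_neg (hf : ∀ i : b.support, f i ≠ 0 ∧
      f i ∈ rootSpace H (-(i.1 : Weight ℂ H 𝔤))) :
    ∃ c : b.support → ℂ, (∀ i, c i ≠ 0) ∧ ∀ i, f i = c i • rootVec (negRootOf i.1) := by
  have h : ∀ i, ∃ c : ℂ, f i = c • rootVec (negRootOf i.1) := fun i =>
    exists_smul_rootVec (α := negRootOf i.1) (hf i).2
  choose c hc using h
  refine ⟨c, fun i h0 => (hf i).1 ?_, hc⟩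
  rw [hc, h0, zero_smul]

lemma DominantCoweight.ext_pairing {lam mu : DominantCoweight b}
    (h : ∀ i, lam.pairing i = mu.pairing i) : lam = mu := by
  apply Subtype.ext
  apply (fundCoweight b).repr.injective
  ext i
  rw [fundCoweight_repr, fundCoweight_repr, lam.pairing_spec, mu.pairing_spec, h]

lemma DominantCoweight.exists_pairing_eq (m : b.support → ℕ) :
    ∃ lam : DominantCoweight b, ∀ i, lam.pairing i = m i := by
  have h : ∀ i : b.support, (i.1.1 : Weight ℂ H 𝔤) (∑ j, (m j : ℂ) • fundCoweight b j) = m i := by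
    classical
    intro i
    rw [← Weight.toLinear_apply, map_sum]
    simp only [map_smul, Weight.toLinear_apply, simple_fundCoweight]
    simp
  let lam : DominantCoweight b := ⟨∑ j, (m j : ℂ) • fundCoweight b j, fun i => ⟨m i, h i⟩⟩
  refine ⟨lam, fun i => ?_⟩
  have := (lam.pairing_spec i).symm.trans (h i)
  exact_mod_cast this

/-- Divisibility compares orders of vanishing. -/
lemma le_of_X_pow_mul_dvd {m n : ℕ} {p q : ℂ⟦X⟧} (hq : PowerSeries.constantCoeff q ≠ 0)
    (h : PowerSeries.X ^ m * p ∣ PowerSeries.X ^ n * q) : m ≤ n := by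
  by_contra! hlt
  have h1 := PowerSeries.X_pow_dvd_iff.mp ((Dvd.intro _ rfl).trans h) n hlt
  rw [PowerSeries.coeff_X_pow_mul', if_pos le_rfl, Nat.sub_self,
    PowerSeries.coeff_zero_eq_constantCoeff_apply] at h1
  exact hq h1

/-- A gauge transformation over `ℂ((t))` between integral connections by a point of the Borel
subgroup is integral. -/
lemma exists_mem_borelPoints_of_isGauge {g : (ℂ⸨X⸩ ⊗[ℂ] 𝔤) ≃ₗ[ℂ⸨X⸩] (ℂ⸨X⸩ ⊗[ℂ] 𝔤)}
    (hg : g ∈ borelPoints b ℂ⸨X⸩) {A A' : ℂ⟦X⟧ ⊗[ℂ] 𝔤}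
    (h : IsGauge dLaurent g (extVec toLaurent A) (extVec toLaurent A')) :
    ∃ k ∈ borelPoints b ℂ⟦X⟧, IsGauge dPower k A A' := by
  rw [mem_borelPoints_iff] at hg
  obtain ⟨k, hk, rfl, hgauge⟩ := RootFrame.exists_extGL_eq_of_isGauge hg.1 h (rootFrame b)
  refine ⟨k, (mem_borelPoints_iff b k).mpr ⟨hk, fun x hx => ?_, fun x hx => ?_⟩, hgauge⟩
  · refine (rootFrame b).mem_gr_of_extVec_mem toLaurent_injective ?_
    rw [← extGL_extVec]
    exact hg.2.1 _ ((rootFrame b).extVec_mem_gr _ hx)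
  · refine (rootFrame b).mem_gr_of_extVec_mem toLaurent_injective ?_
    rw [← extGL_extVec, ← extGL_inv]
    exact hg.2.2 _ ((rootFrame b).extVec_mem_gr _ hx)

/-- Gauge transformations from `B[[t]]` do not lower the orders of vanishing of the symbol. -/
lemma pairing_le_of_isGauge (hc : ∀ i, c i ≠ 0)
    (hf : ∀ i, f i = c i • rootVec (negRootOf i.1)) {lam mu : DominantCoweight b}
    {A A' : ℂ⟦X⟧ ⊗[ℂ] 𝔤} (hA : IsOperOfWeight f lam A) (hA' : IsOperOfWeight f mu A')
    {g : (ℂ⟦X⟧ ⊗[ℂ] 𝔤) ≃ₗ[ℂ⟦X⟧] (ℂ⟦X⟧ ⊗[ℂ] 𝔤)} (hg : g ∈ borelPoints b ℂ⟦X⟧)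
    (h : IsGauge dPower g A A') (i : b.support) : lam.pairing i ≤ mu.pairing i := by
  rw [isOperOfWeight_iff hf] at hA hA'
  obtain ⟨ψ, hψ, hA⟩ := hA
  obtain ⟨ψ', hψ', hA'⟩ := hA'
  rw [mem_borelPoints_iff] at hg
  have h1 := RootFrame.HasSymbol.dvd hg.1 hg.2.1 hg.2.2 h hA hA' i
  refine le_of_X_pow_mul_dvd (p := c i • ψ i) (q := c i • ψ' i) ?_ ?_
  · rw [← PowerSeries.coeff_zero_eq_constantCoeff_apply, map_smul, smul_eq_mul]
    exact mul_ne_zero (hc i) (by rw [PowerSeries.coeff_zero_eq_constantCoeff_apply]; exact hψ' i)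
  · rw [mul_smul_comm, mul_smul_comm]
    exact h1

end OperForm

end Oper

end

theorem lemma7p1 {𝔤 : Type*} [LieRing 𝔤] [LieAlgebra ℂ 𝔤] [FiniteDimensional ℂ 𝔤]
    [LieAlgebra.IsSimple ℂ 𝔤] (H : LieSubalgebra ℂ 𝔤) [H.IsCartanSubalgebra]
    (b : (LieAlgebra.IsKilling.rootSystem H).Base) (f : b.support → 𝔤)
    (hf : ∀ i : b.support, f i ≠ 0 ∧
      f i ∈ LieAlgebra.rootSpace H (-(i.1 : LieModule.Weight ℂ H 𝔤))) :
    (∀ lam : Oper.DominantCoweight b,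
      Function.Injective (Oper.OpOfWeight.toOp : Oper.OpOfWeight f lam → Oper.Op b f)) ∧
    (∀ lam mu : Oper.DominantCoweight b, lam ≠ mu →
      Disjoint (Set.range (Oper.OpOfWeight.toOp : Oper.OpOfWeight f lam → Oper.Op b f))
        (Set.range (Oper.OpOfWeight.toOp : Oper.OpOfWeight f mu → Oper.Op b f))) ∧
    ∀ χ : Oper.Op b f, χ.toLoc = Oper.Loc.trivial 𝔤 →
      ∃ lam : Oper.DominantCoweight b,
        χ ∈ Set.range (Oper.OpOfWeight.toOp : Oper.OpOfWeight f lam → Oper.Op b f) := by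
  obtain ⟨c, hc, hfc⟩ := Oper.exists_smul_rootVec_neg hf
  refine ⟨fun lam => ?_, fun lam mu hne => ?_, ?_⟩
  · rintro ⟨A⟩ ⟨A'⟩ h
    obtain ⟨g, hg, hgauge⟩ := Quotient.exact h
    exact Quotient.sound (Oper.exists_mem_borelPoints_of_isGauge hg hgauge)
  · rw [Set.disjoint_left]
    rintro _ ⟨⟨A⟩, rfl⟩ ⟨⟨A'⟩, h⟩
    obtain ⟨g, hg, hgauge⟩ := Quotient.exact h
    -- an integral gauge transformation preserves the orders of the symbol, which determine the weight
    obtain ⟨k, hk, hk'⟩ := Oper.exists_mem_borelPoints_of_isGauge hg hgauge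
    exact hne (Oper.DominantCoweight.ext_pairing fun i => le_antisymm
      (Oper.pairing_le_of_isGauge hc hfc A.2 A'.2 (inv_mem hk) hk'.symm i)
      (Oper.pairing_le_of_isGauge hc hfc A'.2 A.2 hk hk' i))
  · rintro ⟨A⟩ h
    obtain ⟨g, hg, hgauge⟩ := Quotient.exact h
    obtain ⟨ψ, hψ, hA⟩ := (Oper.isOper_iff hfc A.1).mp A.2
    obtain ⟨k, hk, hk1, hk2, A', ψ', hψ', hA', hgauge'⟩ :=
      Oper.RootFrame.exists_isGauge_of_trivial hg
        (fun i => smul_ne_zero (hc i) (hψ i)) hA hgauge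
    -- the weight records the orders of vanishing of the symbol
    obtain ⟨lam, hlam⟩ := Oper.DominantCoweight.exists_pairing_eq (b := b)
      fun i => (ψ' i).order.toNat
    have hA'' : Oper.IsOperOfWeight f lam A' := by
      rw [Oper.isOperOfWeight_iff hfc]
      refine ⟨fun i => (c i)⁻¹ • (ψ' i).divXPowOrder, fun i h0 => ?_, ?_⟩
      · rw [← PowerSeries.coeff_zero_eq_constantCoeff_apply, map_smul, smul_eq_mul,
          PowerSeries.coeff_zero_eq_constantCoeff_apply] at h0
        exact (mul_ne_zero (inv_ne_zero (hc i))
          (mt PowerSeries.constantCoeff_divXPowOrder_eq_zero_iff.mp (hψ' i))) h0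
      · have : (fun i => c i • (PowerSeries.X ^ lam.pairing i *
            ((c i)⁻¹ • (ψ' i).divXPowOrder))) = ψ' := by
          funext i
          rw [hlam, mul_smul_comm, smul_smul, mul_inv_cancel₀ (hc i), one_smul,
            PowerSeries.X_pow_order_mul_divXPowOrder]
        rwa [this]
    have hkB := (Oper.mem_borelPoints_iff b k).mpr ⟨hk, hk1, hk2⟩
    exact ⟨lam, Quotient.mk _ ⟨A', hA''⟩, Quotient.sound ⟨k⁻¹, inv_mem hkB, hgauge'.symm⟩⟩
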